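/- Let $\mathbb D\subset\mathbb C=\mathbb R^2$ be the open unit disk with the flat metric, $C_c^\infty(\mathbb D)$ the space of real valued smooth compactly supported functions, $C_c^\infty(\mathbb D)_0$ the subspace of functions of integral $0$, and $\Delta=-(\partial_1^2+\partial_2^2)$. Write $P(V)=\bigoplus_n \mathrm{Sym}^n V$, and for a symmetric bilinear form $B$ on $V$ let $\partial_B(v_1\cdots v_n)=\sum_{i<j}B(v_i,v_j)\,v_1\cdots\hat v_i\cdots\hat v_j\cdots v_n$ on $P(V)$. A symmetric locally integrable kernel $K$ on $\mathbb D\times\mathbb D$ gives the form $\partial_K(f,g)=\int K(x,y)f(x)g(y)\,dx\,dy$. For $A=C_c^\infty(\mathbb D)$ or $A=C_c^\infty(\mathbb D)_0$ let $\Delta^{BV}:P(A)\otimes C_c^\infty(\mathbb D)\to P(A)$ be $$f_1\cdots f_n\otimes h\mapsto -f_1\cdots f_n\cdot\Delta h+\sum_i\Big(\int f_ih\Big) f_1\cdots\hat f_i\cdots f_n,$$ put $F(A)=P(A)/\mathrm{Im}\,\Delta^{BV}$ and $S(A)=A/\Delta C_c^\infty(\mathbb D)$, and write $S^{cl}=S(C_c^\infty(\mathbb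 D))$, $S^{cl}_0=S(C_c^\infty(\mathbb D)_0)$. If $K$ satisfies $\Delta_yK(x,y)=\delta(x-y)$ as a distribution on $\mathbb D\times\mathbb D$ (a Green kernel), $\exp(\partial_K)$ induces an isomorphism $\Psi_K:F(A)\to P(S(A))$. Let $\mathbb{CE}_2(n)$ be the set of $n$-tuples of injective holomorphic maps $\phi_i:\mathbb D\to\mathbb D$ with pairwise disjoint images; these sets form an operad under composition of embeddings. For $\phi\in\mathbb{CE}_2(1)$ let $W_\phi f=(|\phi'|^{-2}f)\circ\phi^{-1}$ on $\phi(\mathbb D)$ and $0$ elsewhere, extended multiplicatively to $P(A)$, and let $W_\phi^{cl}$ be the induced map of $P(S(A))$. For $\phi_{[n]}=(\phi_1,\dots,\phi_n)\in\mathbb{CE}_2(n)$ let $F(\phi_{[n]})([F_1],\dots,[F_n])=[W_{\phi_1}F_1\cdots W_{\phi_n}F_n]$. Let $G_2(x,y)=-(2\pi)^{-1}\log|x-y|$ and $$\rho^{cl}_{\phi_{[n]}}=\Psi_{G_2}\circ F(\phi_{[n]})\circ(\Psi_{G_2}^{-1})^{\otimes n},$$ $$H_\phi(z,w)=\log|\phi(z)-\phi(w)|-\log|z-w|-\tfrac12\log|\phi'(z)|-\tfrac12\log|\phi'(w)|\qquad(z\ne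 w).$$ Theorem. (0) $G_2$ is a Green kernel, so $\Psi_{G_2}$ and $\rho^{cl}$ are defined. The maps $\rho^{cl}$ make $P(S^{cl})$ and $P(S_0^{cl})$ into $\mathbb{CE}_2$-algebras; $S_0^{cl}\subset S^{cl}$ has codimension one, and $P(S_0^{cl})\to P(S^{cl})$ is the inclusion of a subalgebra. For every $\phi\in\mathbb{CE}_2(1)$ the kernel $H_\phi$ is symmetric, locally integrable and harmonic in each variable (as a distribution; in particular $\partial_{H_\phi}$ descends to $S_0^{cl}$), and $H_{\phi\circ\psi}(z,w)=H_\psi(z,w)+H_\phi(\psi(z),\psi(w))$ for $z\ne w$. (1) For every $\phi\in\mathbb{CE}_2(1)$, $G_2-(2\pi)^{-1}H_\phi$ is a Green kernel, and on $F(C_c^\infty(\mathbb D)_0)$ one has $\Psi_{G_2}\circ F(\phi)=W_\phi^{cl}\circ\Psi_{G_2-(2\pi)^{-1}H_\phi}$. (2) For every $\phi\in\mathbb{CE}_2(1)$, on $P(S_0^{cl})$, $\rho^{cl}_\phi=W^{cl}_\phi\circ\exp(-(2\pi)^{-1}\partial_{H_\phi})$. (3) For every $n\ge0$, $\phi_{[n]}\in\mathbb{CE}_2(n)$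 and $F_1,\dots,F_n\in P(S_0^{cl})$, if $R_i\in P(C_c^\infty(\mathbb D)_0)$ represents $\exp(-(2\pi)^{-1}\partial_{H_{\phi_i}})F_i$, then $\rho^{cl}_{\phi_{[n]}}(F_1,\dots,F_n)$ is the class of the sum of all contractions of $W_{\phi_1}R_1,\dots,W_{\phi_n}R_n$. Here the sum of all contractions is the multilinear operation which sends monomials $\prod_a f_{i,a}$ $(1\le i\le n)$ to the sum, over all sets $M$ of pairwise disjoint pairs of letters (including $M=\emptyset$), each pair taken from two different monomials, of $\prod_{\{p,q\}\in M}\partial_{G_2}(f_p,f_q)$ times the product of the letters not in any pair of $M$. (4) For $\phi\in\mathbb{CE}_2(1)$, naturality $\Psi_{G_2}\circ F(\phi)=W_\phi^{cl}\circ\Psi_{G_2}$ on $F(C_c^\infty(\mathbb D)_0)$ holds if and only if $H_\phi(z,w)=0$ for all $z\ne w$ in $\mathbb D$. -/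

import Mathlib

open scoped TensorProduct Topology ContDiff

namespace FreeField

section Algebra

/-- The polynomial algebra `P(V) = ⨁ₙ Symⁿ V`. -/
abbrev PolyAlg (V : Type*) [AddCommGroup V] [Module ℝ V] : Type _ := SymmetricAlgebra ℝ V

/-- The generator of `P(V)` given by a vector of `V`. -/
noncomputable abbrev gen {V : Type*} [AddCommGroup V] [Module ℝ V] : V →ₗ[ℝ] PolyAlg V :=
  SymmetricAlgebra.ι ℝ V

variable {V : Type*} [AddCommGroup V] [Module ℝ V]

theorem poly_induction {p : PolyAlg V → Prop} (x : PolyAlg V) (one : p 1)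
    (smul : ∀ (c : ℝ) x, p x → p (c • x)) (add : ∀ x y, p x → p y → p (x + y))
    (mul : ∀ v x, p x → p (gen v * x)) : p x := by
  have key : ∀ a : PolyAlg V, ∀ y, p y → p (a * y) := by
    intro a
    induction a using SymmetricAlgebra.induction with
    | algebraMap r => intro y hy; rw [← Algebra.smul_def]; exact smul r y hy
    | ι v => exact mul v
    | mul a b ha hb => intro y hy; rw [mul_assoc]; exact ha _ (hb _ hy)
    | add a b ha hb => intro y hy; rw [add_mul]; exact add _ _ (ha _ hy) (hb _ hy)
  simpa using key x 1 one

/-- The algebra map `x ↦ x + ε d x`, where `d` is the universal derivation of `P(V)`. -/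
noncomputable def univDerivHom (V : Type*) [AddCommGroup V] [Module ℝ V] :
    PolyAlg V →ₐ[ℝ] TrivSqZeroExt (PolyAlg V) (PolyAlg V ⊗[ℝ] V) :=
  SymmetricAlgebra.lift
    ((TrivSqZeroExt.inlAlgHom ℝ (PolyAlg V) (PolyAlg V ⊗[ℝ] V)).toLinearMap ∘ₗ gen +
      (TrivSqZeroExt.inrHom (PolyAlg V) (PolyAlg V ⊗[ℝ] V)).restrictScalars ℝ ∘ₗ
        TensorProduct.mk ℝ (PolyAlg V) V 1)

/-- The universal derivation
`v₁ ⋯ vₙ ↦ ∑ i, (v₁ ⋯ v̂ᵢ ⋯ vₙ) ⊗ vᵢ` of `P(V)`. -/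
noncomputable def univDeriv (V : Type*) [AddCommGroup V] [Module ℝ V] :
    PolyAlg V →ₗ[ℝ] PolyAlg V ⊗[ℝ] V :=
  (TrivSqZeroExt.sndHom (PolyAlg V) (PolyAlg V ⊗[ℝ] V)).restrictScalars ℝ ∘ₗ
    (univDerivHom V).toLinearMap

theorem fst_univDerivHom (x : PolyAlg V) : (univDerivHom V x).fst = x := by
  have : (TrivSqZeroExt.fstHom ℝ (PolyAlg V) (PolyAlg V ⊗[ℝ] V)).comp (univDerivHom V)
      = AlgHom.id ℝ _ := by
    apply SymmetricAlgebra.algHom_ext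
    ext v
    simp [univDerivHom]
  exact congr($this x)

theorem univDeriv_mul (x y : PolyAlg V) :
    univDeriv V (x * y) = x • univDeriv V y + y • univDeriv V x := by
  simp [univDeriv, fst_univDerivHom]

theorem univDeriv_gen (v : V) : univDeriv V (gen v) = 1 ⊗ₜ v := by
  simp [univDeriv, univDerivHom]

theorem univDeriv_one : univDeriv V 1 = 0 := by
  simp [univDeriv]

/-- Contraction with a linear form `ℓ`: the derivation of `P(V)` with `v ↦ ℓ v`, that is
`v₁ ⋯ vₙ ↦ ∑ i, ℓ(vᵢ) v₁ ⋯ v̂ᵢ ⋯ vₙ`. -/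
noncomputable def contract (ℓ : V →ₗ[ℝ] ℝ) : PolyAlg V →ₗ[ℝ] PolyAlg V :=
  TensorProduct.lift (LinearMap.lsmul ℝ (PolyAlg V) ∘ₗ ℓ).flip ∘ₗ univDeriv V

theorem contract_one (ℓ : V →ₗ[ℝ] ℝ) : contract ℓ 1 = 0 := by
  simp [contract, univDeriv_one]

theorem contract_gen (ℓ : V →ₗ[ℝ] ℝ) (v : V) : contract ℓ (gen v) = ℓ v • 1 := by
  simp [contract, univDeriv_gen]

theorem contract_mul (ℓ : V →ₗ[ℝ] ℝ) (x y : PolyAlg V) :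
    contract ℓ (x * y) = x * contract ℓ y + y * contract ℓ x := by
  have key : ∀ (a : PolyAlg V) (t : PolyAlg V ⊗[ℝ] V),
      TensorProduct.lift (LinearMap.lsmul ℝ (PolyAlg V) ∘ₗ ℓ).flip (a • t)
        = a * TensorProduct.lift (LinearMap.lsmul ℝ (PolyAlg V) ∘ₗ ℓ).flip t := by
    intro a t
    induction t with
    | zero => simp
    | tmul b v => simp [TensorProduct.smul_tmul']
    | add t u ht hu => simp only [smul_add, map_add, ht, hu, mul_add]
  simp [contract, univDeriv_mul, key]

theorem contract_gen_mul (ℓ : V →ₗ[ℝ] ℝ) (v : V) (x : PolyAlg V) :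
    contract ℓ (gen v * x) = gen v * contract ℓ x + ℓ v • x := by
  rw [contract_mul, contract_gen]; simp

theorem contract_add (ℓ m : V →ₗ[ℝ] ℝ) : contract (ℓ + m) = contract ℓ + contract m := by
  ext x
  induction x using poly_induction with
  | one => simp [contract_one]
  | smul c x h => simp only [map_smul, h]
  | add x y hx hy => simp only [map_add, hx, hy]
  | mul v x h =>
    simp only [contract_gen_mul, LinearMap.add_apply, h, add_smul, mul_add]; abel

theorem contract_smul (c : ℝ) (ℓ : V →ₗ[ℝ] ℝ) : contract (c • ℓ) = c • contract ℓ := by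
  ext x
  induction x using poly_induction with
  | one => simp [contract_one]
  | smul c x h => simp only [map_smul, h]
  | add x y hx hy => simp only [map_add, hx, hy]
  | mul v x h =>
    simp only [contract_gen_mul, LinearMap.smul_apply, h, smul_add, smul_eq_mul, mul_smul,
      mul_smul_comm]

theorem contract_comm (ℓ m : V →ₗ[ℝ] ℝ) (x : PolyAlg V) :
    contract ℓ (contract m x) = contract m (contract ℓ x) := by
  induction x using poly_induction with
  | one => simp [contract_one]
  | smul c x h => simp only [map_smul, h]
  | add x y hx hy => simp only [map_add, hx, hy]
  | mul v x h => simp only [contract_gen_mul, map_add, map_smul, h]; abel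

/-- The map `x ⊗ v ↦ ∂_{B(v, ·)} x`. -/
noncomputable def contractWith (B : V →ₗ[ℝ] V →ₗ[ℝ] ℝ) : PolyAlg V ⊗[ℝ] V →ₗ[ℝ] PolyAlg V :=
  TensorProduct.lift (LinearMap.mk₂ ℝ (fun x v => contract (B v) x)
    (by intros; simp) (by intros; simp)
    (by intro x v w; simp [contract_add]) (by intro c x v; simp [contract_smul]))

/-- The second order operator `∂_B` attached to a symmetric bilinear form `B`:
`v₁ ⋯ vₙ ↦ ∑_{i < j} B(vᵢ, vⱼ) v₁ ⋯ v̂ᵢ ⋯ v̂ⱼ ⋯ vₙ`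
(written as half the sum over all `i ≠ j`). -/
noncomputable def contractPair (B : V →ₗ[ℝ] V →ₗ[ℝ] ℝ) : Module.End ℝ (PolyAlg V) :=
  (1 / 2 : ℝ) • (contractWith B ∘ₗ univDeriv V)

/-- The symmetrization of a bilinear form. -/
noncomputable def symForm (B : V →ₗ[ℝ] V →ₗ[ℝ] ℝ) : V →ₗ[ℝ] V →ₗ[ℝ] ℝ :=
  (1 / 2 : ℝ) • (B + B.flip)

theorem symForm_eq {B : V →ₗ[ℝ] V →ₗ[ℝ] ℝ} (hB : ∀ v w, B v w = B w v) : symForm B = B := by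
  ext v w
  simp only [symForm, LinearMap.smul_apply, LinearMap.add_apply, LinearMap.flip_apply, hB w v,
    smul_eq_mul]
  ring

theorem contractPair_one (B : V →ₗ[ℝ] V →ₗ[ℝ] ℝ) : contractPair B 1 = 0 := by
  simp [contractPair, univDeriv_one]

theorem contractPair_gen_mul (B : V →ₗ[ℝ] V →ₗ[ℝ] ℝ) (v : V) (x : PolyAlg V) :
    contractPair B (gen v * x) = gen v * contractPair B x + contract (symForm B v) x := by
  have key : ∀ t : PolyAlg V ⊗[ℝ] V, contractWith B (gen v • t)
      = gen v * contractWith B t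
        + TensorProduct.lift (LinearMap.lsmul ℝ (PolyAlg V) ∘ₗ B.flip v).flip t := by
    intro t
    induction t with
    | zero => simp
    | tmul b w => simp [TensorProduct.smul_tmul', contractWith, contract_gen_mul]
    | add t u ht hu => simp only [smul_add, map_add, ht, hu, mul_add]; abel
  have h2 : contractWith B (x • ((1 : PolyAlg V) ⊗ₜ[ℝ] v)) = contract (B v) x := by
    simp [TensorProduct.smul_tmul', contractWith]
  have h3 : TensorProduct.lift (LinearMap.lsmul ℝ (PolyAlg V) ∘ₗ B.flip v).flip (univDeriv V x)
      = contract (B.flip v) x := rfl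
  simp only [contractPair, LinearMap.smul_apply, LinearMap.comp_apply, univDeriv_mul,
    univDeriv_gen, map_add, key, h2, h3, symForm, LinearMap.add_apply, contract_add,
    contract_smul, smul_add, mul_smul_comm]
  abel

theorem contractPair_contract (B : V →ₗ[ℝ] V →ₗ[ℝ] ℝ) (ℓ : V →ₗ[ℝ] ℝ) (x : PolyAlg V) :
    contractPair B (contract ℓ x) = contract ℓ (contractPair B x) := by
  induction x using poly_induction with
  | one => simp [contract_one, contractPair_one]
  | smul c x h => simp only [map_smul, h]
  | add x y hx hy => simp only [map_add, hx, hy]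
  | mul v x h =>
    simp only [contract_gen_mul, contractPair_gen_mul, map_add, map_smul, h,
      contract_comm ℓ (symForm B v)]
    abel

theorem contractPair_pow_contract (B : V →ₗ[ℝ] V →ₗ[ℝ] ℝ) (ℓ : V →ₗ[ℝ] ℝ) (n : ℕ)
    (x : PolyAlg V) :
    (contractPair B ^ n) (contract ℓ x) = contract ℓ ((contractPair B ^ n) x) := by
  induction n with
  | zero => simp
  | succ n ih => simp only [pow_succ', Module.End.mul_apply, ih, contractPair_contract]

theorem contractPair_pow_gen_mul (B : V →ₗ[ℝ] V →ₗ[ℝ] ℝ) (v : V) (n : ℕ) (x : PolyAlg V) :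
    (contractPair B ^ (n + 1)) (gen v * x) = gen v * (contractPair B ^ (n + 1)) x
      + ((n : ℝ) + 1) • contract (symForm B v) ((contractPair B ^ n) x) := by
  induction n with
  | zero => simp [contractPair_gen_mul]
  | succ n ih =>
    have hp : ∀ (k : ℕ) (y : PolyAlg V),
        contractPair B ((contractPair B ^ k) y) = (contractPair B ^ (k + 1)) y := by
      intro k y; rw [pow_succ', Module.End.mul_apply]
    rw [← hp (n + 1), ih, map_add, contractPair_gen_mul, map_smul,
      contractPair_contract, hp, hp, add_assoc]
    congr 1
    push_cast
    rw [add_smul ((n : ℝ) + 1), one_smul, add_comm]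

theorem contractPair_pow_eq_zero (B : V →ₗ[ℝ] V →ₗ[ℝ] ℝ) {x : PolyAlg V} {m n : ℕ} (hmn : m ≤ n)
    (h : (contractPair B ^ m) x = 0) : (contractPair B ^ n) x = 0 := by
  obtain ⟨k, rfl⟩ := Nat.exists_eq_add_of_le hmn
  rw [add_comm, pow_add, Module.End.mul_apply, h, map_zero]

/-- `∂_B` lowers the degree, hence it is locally nilpotent. -/
theorem exists_contractPair_pow_eq_zero (B : V →ₗ[ℝ] V →ₗ[ℝ] ℝ) (x : PolyAlg V) :
    ∃ n, (contractPair B ^ n) x = 0 := by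
  induction x using poly_induction with
  | one => exact ⟨1, by simp [contractPair_one]⟩
  | smul c x h => obtain ⟨n, hn⟩ := h; exact ⟨n, by simp [hn]⟩
  | add x y hx hy =>
    obtain ⟨m, hm⟩ := hx
    obtain ⟨n, hn⟩ := hy
    exact ⟨max m n, by
      rw [map_add, contractPair_pow_eq_zero B (le_max_left m n) hm,
        contractPair_pow_eq_zero B (le_max_right m n) hn, add_zero]⟩
  | mul v x h =>
    obtain ⟨n, hn⟩ := h
    exact ⟨n + 1, by
      rw [contractPair_pow_gen_mul, hn, contractPair_pow_eq_zero B n.le_succ hn]; simp⟩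

theorem finite_support_expPair (B : V →ₗ[ℝ] V →ₗ[ℝ] ℝ) (x : PolyAlg V) :
    (Function.support fun n : ℕ => ((n.factorial : ℝ)⁻¹) • (contractPair B ^ n) x).Finite := by
  obtain ⟨N, hN⟩ := exists_contractPair_pow_eq_zero B x
  refine (Finset.range N).finite_toSet.subset fun n hn => ?_
  by_contra h
  refine hn ?_
  have : N ≤ n := by simpa using h
  simp [contractPair_pow_eq_zero B this hN]

/-- `exp(∂_B) = ∑ₙ ∂_Bⁿ / n!`, a finite sum on each element. -/
noncomputable def expPair (B : V →ₗ[ℝ] V →ₗ[ℝ] ℝ) : PolyAlg V →ₗ[ℝ] PolyAlg V where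
  toFun x := ∑ᶠ n : ℕ, ((n.factorial : ℝ)⁻¹) • (contractPair B ^ n) x
  map_add' x y := by
    rw [← finsum_add_distrib (finite_support_expPair B x) (finite_support_expPair B y)]
    simp
  map_smul' c x := by
    rw [RingHom.id_apply, smul_finsum' c (finite_support_expPair B x)]
    exact finsum_congr fun n => by rw [map_smul, smul_comm]

theorem expPair_eq_sum (B : V →ₗ[ℝ] V →ₗ[ℝ] ℝ) {x : PolyAlg V} {N : ℕ}
    (hN : (contractPair B ^ N) x = 0) :
    expPair B x = ∑ n ∈ Finset.range N, ((n.factorial : ℝ)⁻¹) • (contractPair B ^ n) x := by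
  refine finsum_eq_sum_of_support_subset _ fun n hn => ?_
  by_contra h
  refine hn ?_
  have : N ≤ n := by simpa using h
  simp [contractPair_pow_eq_zero B this hN]

theorem expPair_one (B : V →ₗ[ℝ] V →ₗ[ℝ] ℝ) : expPair B 1 = 1 := by
  rw [expPair_eq_sum B (N := 1) (by simp [contractPair_one])]
  simp

theorem expPair_gen_mul (B : V →ₗ[ℝ] V →ₗ[ℝ] ℝ) (v : V) (x : PolyAlg V) :
    expPair B (gen v * x) = gen v * expPair B x + contract (symForm B v) (expPair B x) := by
  obtain ⟨N, hN⟩ := exists_contractPair_pow_eq_zero B x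
  have hN1 := contractPair_pow_eq_zero B N.le_succ hN
  rw [expPair_eq_sum B (x := gen v * x) (N := N + 1)
    (by rw [contractPair_pow_gen_mul, hN, hN1]; simp), Finset.sum_range_succ']
  nth_rewrite 1 [expPair_eq_sum B hN1]
  rw [expPair_eq_sum B hN, Finset.sum_range_succ', mul_add, Finset.mul_sum, map_sum,
    add_right_comm, ← Finset.sum_add_distrib]
  congr 1
  · refine Finset.sum_congr rfl fun n _ => ?_
    rw [contractPair_pow_gen_mul, smul_add, mul_smul_comm, smul_smul, map_smul]
    congr 2
    rw [Nat.factorial_succ]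
    push_cast
    field_simp
  · simp

theorem expPair_contract (B : V →ₗ[ℝ] V →ₗ[ℝ] ℝ) (ℓ : V →ₗ[ℝ] ℝ) (x : PolyAlg V) :
    expPair B (contract ℓ x) = contract ℓ (expPair B x) := by
  obtain ⟨N, hN⟩ := exists_contractPair_pow_eq_zero B x
  rw [expPair_eq_sum B hN, expPair_eq_sum B (N := N)
    (by rw [contractPair_pow_contract, hN, map_zero]), map_sum]
  exact Finset.sum_congr rfl fun n _ => by rw [contractPair_pow_contract, map_smul]

theorem expPair_neg_expPair (B : V →ₗ[ℝ] V →ₗ[ℝ] ℝ) (x : PolyAlg V) :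
    expPair (-B) (expPair B x) = x := by
  induction x using poly_induction with
  | one => simp [expPair_one]
  | smul c x h => simp only [map_smul, h]
  | add x y hx hy => simp only [map_add, hx, hy]
  | mul v x h =>
    have hs : symForm (-B) v = (-1 : ℝ) • symForm B v := by
      ext w
      simp only [symForm, LinearMap.smul_apply, LinearMap.add_apply, LinearMap.neg_apply,
        LinearMap.flip_apply, smul_eq_mul]
      ring
    rw [expPair_gen_mul, map_add, expPair_gen_mul, expPair_contract, h, hs, contract_smul]
    simp

theorem expPair_expPair_neg (B : V →ₗ[ℝ] V →ₗ[ℝ] ℝ) (x : PolyAlg V) :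
    expPair B (expPair (-B) x) = x := by
  have h := expPair_neg_expPair (-B) x
  have hB : -(-B) = B := by ext v w; simp
  rwa [hB] at h

end Algebra

section Observables

variable {V T : Type*} [AddCommGroup V] [Module ℝ V] [AddCommGroup T] [Module ℝ T]

/-- The operator `F ⊗ h ↦ - F · L h + ∂_{I(·, h)} F` on `P(V) ⊗ T`, for a linear map
`L : T → V` and a bilinear pairing `I` of `V` and `T`. -/
noncomputable def bvOperator (L : T →ₗ[ℝ] V) (I : V →ₗ[ℝ] T →ₗ[ℝ] ℝ) :
    PolyAlg V ⊗[ℝ] T →ₗ[ℝ] PolyAlg V :=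
  TensorProduct.lift (LinearMap.mk₂ ℝ (fun F h => -(F * gen (L h)) + contract (I.flip h) F)
    (by intro F G h; simp only [map_add, add_mul]; abel)
    (by intro c F h; simp only [map_smul, smul_mul_assoc, smul_add, smul_neg])
    (by intro F h k; simp only [map_add, mul_add, contract_add, LinearMap.add_apply]; abel)
    (by intro c F h; simp only [map_smul, mul_smul_comm, contract_smul, LinearMap.smul_apply,
          smul_add, smul_neg]))

theorem bvOperator_tmul (L : T →ₗ[ℝ] V) (I : V →ₗ[ℝ] T →ₗ[ℝ] ℝ) (F : PolyAlg V) (h : T) :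
    bvOperator L I (F ⊗ₜ h) = -(F * gen (L h)) + contract (I.flip h) F := by
  simp [bvOperator]

/-- The algebra map `P(V) → P(W)` induced by a linear map `V → W`. -/
noncomputable def polyMap {W : Type*} [AddCommGroup W] [Module ℝ W] (f : V →ₗ[ℝ] W) :
    PolyAlg V →ₐ[ℝ] PolyAlg W :=
  SymmetricAlgebra.lift (gen ∘ₗ f)

@[simp]
theorem polyMap_gen {W : Type*} [AddCommGroup W] [Module ℝ W] (f : V →ₗ[ℝ] W) (v : V) :
    polyMap f (gen v) = gen (f v) := by
  simp [polyMap]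

theorem polyMap_surjective {W : Type*} [AddCommGroup W] [Module ℝ W] {f : V →ₗ[ℝ] W}
    (hf : Function.Surjective f) : Function.Surjective (polyMap f) := by
  intro y
  induction y using poly_induction with
  | one => exact ⟨1, map_one _⟩
  | smul c y h => obtain ⟨x, rfl⟩ := h; exact ⟨c • x, map_smul _ _ _⟩
  | add y z hy hz =>
    obtain ⟨x, rfl⟩ := hy
    obtain ⟨w, rfl⟩ := hz
    exact ⟨x + w, map_add _ _ _⟩
  | mul w y h =>
    obtain ⟨x, rfl⟩ := h
    obtain ⟨v, rfl⟩ := hf w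
    exact ⟨gen v * x, by simp⟩

/-- The quotient map `P(V) → P(V / L T)`. -/
noncomputable def classicalProj (L : T →ₗ[ℝ] V) : PolyAlg V →ₐ[ℝ] PolyAlg (V ⧸ LinearMap.range L) :=
  polyMap (LinearMap.range L).mkQ

/-- The kernel of `P(V) → P(V / L T)` is spanned by the elements `F · L h`. -/
theorem mem_span_of_classicalProj_eq_zero (L : T →ₗ[ℝ] V) {x : PolyAlg V}
    (hx : classicalProj L x = 0) :
    x ∈ Submodule.span ℝ {y : PolyAlg V | ∃ F h, y = F * gen (L h)} := by
  let J : Ideal (PolyAlg V) := Ideal.span (Set.range fun h : T => gen (L h))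
  let q : V ⧸ LinearMap.range L →ₗ[ℝ] PolyAlg V ⧸ J :=
    (LinearMap.range L).liftQ ((Ideal.Quotient.mkₐ ℝ J).toLinearMap ∘ₗ gen) (by
      rintro _ ⟨h, rfl⟩
      simp only [LinearMap.mem_ker, LinearMap.comp_apply, AlgHom.toLinearMap_apply,
        Ideal.Quotient.mkₐ_eq_mk]
      exact Ideal.Quotient.eq_zero_iff_mem.2 (Ideal.subset_span ⟨h, rfl⟩))
  have hcomp : (SymmetricAlgebra.lift q).comp (classicalProj L) = Ideal.Quotient.mkₐ ℝ J := by
    apply SymmetricAlgebra.algHom_ext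
    ext v
    simp [classicalProj, q]
  have hxJ : x ∈ J := by
    have := congr($hcomp x)
    rw [AlgHom.comp_apply, hx, map_zero] at this
    exact Ideal.Quotient.eq_zero_iff_mem.1 this.symm
  refine Submodule.span_induction (p := fun y _ => y ∈ Submodule.span ℝ
    {y : PolyAlg V | ∃ F h, y = F * gen (L h)}) ?_ (zero_mem _) (fun _ _ _ _ h k => add_mem h k)
    ?_ hxJ
  · rintro _ ⟨h, rfl⟩
    exact Submodule.subset_span ⟨1, h, by simp⟩
  · intro a y hyJ hy
    clear hyJ
    induction hy using Submodule.span_induction with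
    | mem y hy =>
      obtain ⟨F, h, rfl⟩ := hy
      exact Submodule.subset_span ⟨a * F, h, by simp [mul_assoc]⟩
    | zero => simp
    | add y z _ _ hy hz => rw [smul_add]; exact add_mem hy hz
    | smul c y _ hy => rw [smul_comm]; exact Submodule.smul_mem _ c hy

theorem expPair_bvOperator {L : T →ₗ[ℝ] V} {I : V →ₗ[ℝ] T →ₗ[ℝ] ℝ} {B : V →ₗ[ℝ] V →ₗ[ℝ] ℝ}
    (hsymm : ∀ v w, B v w = B w v) (hgreen : ∀ v h, B v (L h) = I v h) (F : PolyAlg V) (h : T) :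
    expPair B (bvOperator L I (F ⊗ₜ h)) = -(expPair B F * gen (L h)) := by
  have hI : B (L h) = I.flip h := by
    ext v
    rw [hsymm, hgreen, LinearMap.flip_apply]
  rw [bvOperator_tmul, map_add, map_neg, mul_comm F, expPair_gen_mul, symForm_eq hsymm, hI,
    expPair_contract, mul_comm (gen (L h))]
  abel

/-- If `B` is symmetric and `B(v, L h) = I(v, h)`, then `exp(∂_B)` induces an isomorphism
`P(V) / Im(bvOperator L I) ≅ P(V / L T)`. -/
noncomputable def quantumEquiv {L : T →ₗ[ℝ] V} {I : V →ₗ[ℝ] T →ₗ[ℝ] ℝ}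
    (B : V →ₗ[ℝ] V →ₗ[ℝ] ℝ) (hsymm : ∀ v w, B v w = B w v)
    (hgreen : ∀ v h, B v (L h) = I v h) :
    (PolyAlg V ⧸ LinearMap.range (bvOperator L I)) ≃ₗ[ℝ] PolyAlg (V ⧸ LinearMap.range L) :=
  LinearEquiv.ofBijective
    ((LinearMap.range (bvOperator L I)).liftQ ((classicalProj L).toLinearMap ∘ₗ expPair B) (by
      rintro _ ⟨t, rfl⟩
      rw [LinearMap.mem_ker]
      induction t with
      | zero => simp
      | tmul F h =>
        have h0 : (LinearMap.range L).mkQ (L h) = 0 := by simp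
        rw [LinearMap.comp_apply, expPair_bvOperator hsymm hgreen, AlgHom.toLinearMap_apply,
          map_neg, map_mul]
        rw [show classicalProj L (gen (L h)) = 0 by
          rw [classicalProj, polyMap_gen, h0, map_zero], mul_zero, neg_zero]
      | add s t hs ht => rw [map_add, map_add, hs, ht, add_zero]))
    (by
      constructor
      · rw [← LinearMap.ker_eq_bot, Submodule.eq_bot_iff]
        intro z hz
        obtain ⟨x, rfl⟩ := Submodule.mkQ_surjective _ z
        rw [LinearMap.mem_ker, Submodule.mkQ_apply, Submodule.liftQ_apply] at hz
        have hmem := mem_span_of_classicalProj_eq_zero L hz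
        have hmap : ∀ y ∈ Submodule.span ℝ {y : PolyAlg V | ∃ F h, y = F * gen (L h)},
            expPair (-B) y ∈ LinearMap.range (bvOperator L I) := by
          intro y hy
          induction hy using Submodule.span_induction with
          | mem y hy =>
            obtain ⟨F, h, rfl⟩ := hy
            refine ⟨-(expPair (-B) F ⊗ₜ h), ?_⟩
            have h1 := expPair_bvOperator hsymm hgreen (expPair (-B) F) h
            rw [expPair_expPair_neg] at h1
            rw [map_neg, ← expPair_neg_expPair B (bvOperator L I _), h1, map_neg, neg_neg]
          | zero => simp
          | add y z _ _ hy hz => rw [map_add]; exact add_mem hy hz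
          | smul c y _ hy => rw [map_smul]; exact Submodule.smul_mem _ c hy
        have := hmap _ hmem
        rw [expPair_neg_expPair] at this
        simpa using this
      · intro y
        obtain ⟨x, rfl⟩ := polyMap_surjective (Submodule.mkQ_surjective (LinearMap.range L)) y
        refine ⟨Submodule.Quotient.mk (expPair (-B) x), ?_⟩
        rw [Submodule.liftQ_apply]
        rw [LinearMap.comp_apply, expPair_expPair_neg]
        rfl)

end Observables

section Disk

/-- The open unit disk `𝔻 ⊆ ℂ = ℝ²`. -/
def disk : TopologicalSpace.Opens ℂ := ⟨Metric.ball 0 1, Metric.isOpen_ball⟩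

/-- `C_c^∞(𝔻)`: real valued smooth functions with compact support contained in `𝔻`. -/
abbrev TestFun : Type := TestFunction disk ℝ ⊤

/-- The directional derivative `∂_v` on `C_c^∞(𝔻)`. -/
noncomputable def dirDeriv (v : ℂ) : TestFun →ₗ[ℝ] TestFun :=
  (TestFunction.lineDerivCLM ℝ v : TestFun →L[ℝ] TestFun).toLinearMap

/-- The Laplacian `Δ = -(∂₁² + ∂₂²)` of the flat metric, on `C_c^∞(𝔻)`. -/
noncomputable def lap : TestFun →ₗ[ℝ] TestFun :=
  -(dirDeriv 1 ∘ₗ dirDeriv 1 + dirDeriv Complex.I ∘ₗ dirDeriv Complex.I)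

/-- Orientation preserving conformal open embeddings `𝔻 → 𝔻`, that is, injective holomorphic
maps (their derivative vanishes nowhere). Only the values on `𝔻` matter. -/
structure ConfEmb where
  toFun : ℂ → ℂ
  mapsTo : Set.MapsTo toFun disk disk
  injOn : Set.InjOn toFun disk
  holo : DifferentiableOn ℂ toFun disk
  deriv_ne_zero : ∀ z ∈ disk, deriv toFun z ≠ 0

namespace ConfEmb

/-- The image `φ(𝔻)`. -/
def image (φ : ConfEmb) : Set ℂ := φ.toFun '' disk

/-- The inverse `φ⁻¹ : φ(𝔻) → 𝔻`. -/
noncomputable def inv (φ : ConfEmb) : ℂ → ℂ := Function.invFunOn φ.toFun disk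

theorem inv_apply (φ : ConfEmb) {z : ℂ} (hz : z ∈ disk) : φ.inv (φ.toFun z) = z :=
  φ.injOn.leftInvOn_invFunOn hz

theorem analyticAt (φ : ConfEmb) {z : ℂ} (hz : z ∈ disk) : AnalyticAt ℂ φ.toFun z :=
  φ.holo.analyticAt (disk.isOpen.mem_nhds hz)

theorem hasStrictDerivAt (φ : ConfEmb) {z : ℂ} (hz : z ∈ disk) :
    HasStrictDerivAt φ.toFun (deriv φ.toFun z) z :=
  (φ.analyticAt hz).hasStrictDerivAt

theorem image_mem_nhds (φ : ConfEmb) {z : ℂ} (hz : z ∈ disk) : φ.image ∈ 𝓝 (φ.toFun z) := by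
  rw [← (φ.hasStrictDerivAt hz).map_nhds_eq (φ.deriv_ne_zero z hz)]
  exact Filter.image_mem_map (disk.isOpen.mem_nhds hz)

theorem isOpen_image (φ : ConfEmb) : IsOpen φ.image := by
  rw [isOpen_iff_mem_nhds]
  rintro _ ⟨z, hz, rfl⟩
  exact φ.image_mem_nhds hz

theorem image_subset (φ : ConfEmb) : φ.image ⊆ disk := φ.mapsTo.image_subset

theorem differentiableOn_inv (φ : ConfEmb) : DifferentiableOn ℂ φ.inv φ.image := by
  rintro _ ⟨z, hz, rfl⟩
  refine ((φ.hasStrictDerivAt hz).to_local_left_inverse (φ.deriv_ne_zero z hz)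
    ?_).hasDerivAt.differentiableAt.differentiableWithinAt
  filter_upwards [disk.isOpen.mem_nhds hz] with w hw using φ.inv_apply hw

theorem contDiffAt_inv (φ : ConfEmb) {x : ℂ} (hx : x ∈ φ.image) : ContDiffAt ℝ ∞ φ.inv x :=
  ((φ.differentiableOn_inv.contDiffOn φ.isOpen_image).contDiffAt
    (φ.isOpen_image.mem_nhds hx)).restrict_scalars ℝ

open Classical in
/-- `g ∘ φ⁻¹` on `φ(𝔻)`, extended by zero. -/
noncomputable def extendZero (φ : ConfEmb) (g : ℂ → ℝ) (x : ℂ) : ℝ :=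
  if x ∈ φ.image then g (φ.inv x) else 0

theorem extendZero_apply (φ : ConfEmb) (g : ℂ → ℝ) {z : ℂ} (hz : z ∈ disk) :
    φ.extendZero g (φ.toFun z) = g z := by
  rw [extendZero, if_pos ⟨z, hz, rfl⟩, φ.inv_apply hz]

theorem extendZero_eq_zero (φ : ConfEmb) {g : ℂ → ℝ} {x : ℂ}
    (hx : x ∉ φ.toFun '' tsupport g) : φ.extendZero g x = 0 := by
  rw [extendZero]
  split_ifs with h
  · obtain ⟨z, hz, rfl⟩ := h
    rw [φ.inv_apply hz]
    exact image_eq_zero_of_notMem_tsupport fun h => hx ⟨z, h, rfl⟩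
  · rfl

theorem isCompact_image_tsupport (φ : ConfEmb) {g : ℂ → ℝ} (hg : HasCompactSupport g)
    (hs : tsupport g ⊆ disk) : IsCompact (φ.toFun '' tsupport g) :=
  hg.isCompact.image_of_continuousOn (φ.holo.continuousOn.mono hs)

theorem tsupport_extendZero_subset (φ : ConfEmb) {g : ℂ → ℝ} (hg : HasCompactSupport g)
    (hs : tsupport g ⊆ disk) : tsupport (φ.extendZero g) ⊆ φ.toFun '' tsupport g :=
  closure_minimal (fun _ hx => by_contra fun h => hx (φ.extendZero_eq_zero h))
    (φ.isCompact_image_tsupport hg hs).isClosed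

theorem hasCompactSupport_extendZero (φ : ConfEmb) {g : ℂ → ℝ} (hg : HasCompactSupport g)
    (hs : tsupport g ⊆ disk) : HasCompactSupport (φ.extendZero g) :=
  (φ.isCompact_image_tsupport hg hs).of_isClosed_subset (isClosed_tsupport _)
    (φ.tsupport_extendZero_subset hg hs)

theorem tsupport_extendZero_subset_disk (φ : ConfEmb) {g : ℂ → ℝ} (hg : HasCompactSupport g)
    (hs : tsupport g ⊆ disk) : tsupport (φ.extendZero g) ⊆ disk :=
  (φ.tsupport_extendZero_subset hg hs).trans
    ((Set.image_mono hs).trans φ.image_subset)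

theorem contDiff_extendZero (φ : ConfEmb) {g : ℂ → ℝ} (hg : HasCompactSupport g)
    (hs : tsupport g ⊆ disk) (hd : ContDiffOn ℝ ∞ g disk) : ContDiff ℝ ∞ (φ.extendZero g) := by
  rw [contDiff_iff_contDiffAt]
  intro x
  by_cases hx : x ∈ φ.image
  · have h1 : ContDiffAt ℝ ∞ (g ∘ φ.inv) x := by
      refine ContDiffAt.comp x (hd.contDiffAt (disk.isOpen.mem_nhds ?_)) (φ.contDiffAt_inv hx)
      obtain ⟨z, hz, rfl⟩ := hx
      rw [φ.inv_apply hz]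
      exact hz
    refine h1.congr_of_eventuallyEq ?_
    filter_upwards [φ.isOpen_image.mem_nhds hx] with y hy
    simp [extendZero, hy]
  · refine (contDiffAt_const (c := (0 : ℝ))).congr_of_eventuallyEq ?_
    have hx' : x ∈ (φ.toFun '' tsupport g)ᶜ := fun h => hx (Set.image_mono hs h)
    filter_upwards [(φ.isCompact_image_tsupport hg hs).isClosed.isOpen_compl.mem_nhds hx']
      with y hy using φ.extendZero_eq_zero hy

/-- The conformal factor `Ω_φ = |φ'|`, with `φ^* g_std = Ω_φ² g_std`. -/
noncomputable def factor (φ : ConfEmb) (z : ℂ) : ℝ := ‖deriv φ.toFun z‖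

theorem factor_pos (φ : ConfEmb) {z : ℂ} (hz : z ∈ disk) : 0 < φ.factor z :=
  norm_pos_iff.2 (φ.deriv_ne_zero z hz)

theorem contDiffOn_factor_zpow (φ : ConfEmb) (k : ℤ) :
    ContDiffOn ℝ ∞ (fun z => φ.factor z ^ k) disk := by
  intro z hz
  have h1 : ContDiffAt ℝ ∞ (deriv φ.toFun) z :=
    ((φ.analyticAt hz).deriv.contDiffAt).restrict_scalars ℝ
  have h2 : ContDiffAt ℝ ∞ φ.factor z := h1.norm ℝ (φ.deriv_ne_zero z hz)
  have h0 := (φ.factor_pos hz).ne'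
  refine ContDiffAt.contDiffWithinAt ?_
  cases k with
  | ofNat n => simpa using h2.pow n
  | negSucc n =>
    simp only [zpow_negSucc]
    exact (h2.pow (n + 1)).fun_inv (pow_ne_zero _ h0)

theorem tsupport_weighted_subset (φ : ConfEmb) (f : TestFun) :
    tsupport (fun z => φ.factor z ^ (-2 : ℤ) * f z) ⊆ tsupport f :=
  closure_mono fun _ hz h => hz (by simp [h])

theorem hasCompactSupport_weighted (φ : ConfEmb) (f : TestFun) :
    HasCompactSupport (fun z => φ.factor z ^ (-2 : ℤ) * f z) :=
  f.hasCompactSupport.of_isClosed_subset (isClosed_tsupport _) (φ.tsupport_weighted_subset f)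

/-- The push-forward `W_φ f = (Ω_φ⁻² f) ∘ φ⁻¹` on `φ(𝔻)`, extended by zero. -/
noncomputable def push (φ : ConfEmb) : TestFun →ₗ[ℝ] TestFun where
  toFun f :=
    { toFun := φ.extendZero fun z => φ.factor z ^ (-2 : ℤ) * f z
      contDiff' := φ.contDiff_extendZero (φ.hasCompactSupport_weighted f)
        ((φ.tsupport_weighted_subset f).trans f.tsupport_subset)
        ((φ.contDiffOn_factor_zpow (-2)).mul f.contDiff.contDiffOn)
      hasCompactSupport' := φ.hasCompactSupport_extendZero (φ.hasCompactSupport_weighted f)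
        ((φ.tsupport_weighted_subset f).trans f.tsupport_subset)
      tsupport_subset' := φ.tsupport_extendZero_subset_disk (φ.hasCompactSupport_weighted f)
        ((φ.tsupport_weighted_subset f).trans f.tsupport_subset) }
  map_add' f g := by
    ext x
    by_cases hx : x ∈ φ.image <;> simp [extendZero, hx, mul_add]
  map_smul' c f := by
    ext x
    by_cases hx : x ∈ φ.image <;> simp [extendZero, hx, mul_left_comm]

/-- The push-forward `W̃_φ f = f ∘ φ⁻¹` on `φ(𝔻)`, extended by zero. -/
noncomputable def pushScalar (φ : ConfEmb) (f : TestFun) : TestFun where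
  toFun := φ.extendZero f
  contDiff' := φ.contDiff_extendZero f.hasCompactSupport f.tsupport_subset f.contDiff.contDiffOn
  hasCompactSupport' := φ.hasCompactSupport_extendZero f.hasCompactSupport f.tsupport_subset
  tsupport_subset' := φ.tsupport_extendZero_subset_disk f.hasCompactSupport f.tsupport_subset

theorem push_apply (φ : ConfEmb) (f : TestFun) {z : ℂ} (hz : z ∈ disk) :
    φ.push f (φ.toFun z) = φ.factor z ^ (-2 : ℤ) * f z :=
  φ.extendZero_apply (fun z => φ.factor z ^ (-2 : ℤ) * f z) hz

theorem push_eq_zero (φ : ConfEmb) (f : TestFun) {x : ℂ} (hx : x ∉ φ.image) :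
    φ.push f x = 0 := if_neg hx

theorem pushScalar_apply (φ : ConfEmb) (f : TestFun) {z : ℂ} (hz : z ∈ disk) :
    φ.pushScalar f (φ.toFun z) = f z :=
  φ.extendZero_apply _ hz

theorem pushScalar_eq_zero (φ : ConfEmb) (f : TestFun) {x : ℂ} (hx : x ∉ φ.image) :
    φ.pushScalar f x = 0 := if_neg hx

/-- Change of variables: `∫_{φ(𝔻)} u = ∫_𝔻 Ω_φ² u ∘ φ`. -/
theorem integral_image (φ : ConfEmb) (u : ℂ → ℝ) :
    ∫ x in φ.image, u x = ∫ z in disk, φ.factor z ^ 2 * u (φ.toFun z) := by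
  have hd : ∀ z ∈ (disk : Set ℂ), HasFDerivWithinAt φ.toFun
      ((ContinuousLinearMap.toSpanSingleton ℂ (deriv φ.toFun z)).restrictScalars ℝ) disk z :=
    fun z hz => ((φ.hasStrictDerivAt hz).hasDerivAt.hasFDerivAt.restrictScalars
      ℝ).hasFDerivWithinAt
  rw [image, MeasureTheory.integral_image_eq_integral_abs_det_fderiv_smul _
    disk.isOpen.measurableSet hd φ.injOn]
  refine MeasureTheory.setIntegral_congr_fun disk.isOpen.measurableSet fun z _ => ?_
  have hdet : ((ContinuousLinearMap.toSpanSingleton ℂ (deriv φ.toFun z)).restrictScalars ℝ).det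
      = φ.factor z ^ 2 := by
    simp [ContinuousLinearMap.det, LinearMap.det_restrictScalars, Algebra.norm_complex_eq,
      Complex.normSq_eq_norm_sq, factor]
  simp only [hdet, smul_eq_mul, abs_of_nonneg (sq_nonneg (φ.factor z))]

theorem integral_eq_of_eq_zero (φ : ConfEmb) {u : ℂ → ℝ} (hu : ∀ x ∉ φ.image, u x = 0) :
    ∫ x, u x = ∫ z in disk, φ.factor z ^ 2 * u (φ.toFun z) := by
  rw [← φ.integral_image, MeasureTheory.setIntegral_eq_integral_of_forall_compl_eq_zero hu]

end ConfEmb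

theorem testFun_eq_zero (f : TestFun) {z : ℂ} (hz : z ∉ disk) : f z = 0 :=
  image_eq_zero_of_notMem_tsupport fun h => hz (f.tsupport_subset h)

theorem testFun_integrable (f : TestFun) : MeasureTheory.Integrable f :=
  f.continuous.integrable_of_hasCompactSupport f.hasCompactSupport

theorem ConfEmb.integral_push_mul (φ : ConfEmb) (f : TestFun) (u : ℂ → ℝ) :
    ∫ x, φ.push f x * u x = ∫ z, f z * u (φ.toFun z) := by
  rw [φ.integral_eq_of_eq_zero fun x hx => by rw [φ.push_eq_zero f hx, zero_mul],
    ← MeasureTheory.setIntegral_eq_integral_of_forall_compl_eq_zero (s := disk)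
      (f := fun z => f z * u (φ.toFun z))
      (fun z hz => by rw [testFun_eq_zero f hz, zero_mul])]
  refine MeasureTheory.setIntegral_congr_fun disk.isOpen.measurableSet fun z hz => ?_
  have h0 := (φ.factor_pos hz).ne'
  simp only [φ.push_apply f hz, zpow_neg]
  field_simp

theorem ConfEmb.integral_push (φ : ConfEmb) (f : TestFun) : ∫ x, φ.push f x = ∫ z, f z := by
  simpa using φ.integral_push_mul f fun _ => 1

theorem dirDeriv_apply (v : ℂ) (f : TestFun) (x : ℂ) : dirDeriv v f x = fderiv ℝ f x v := by
  have h := TestFunction.lineDerivCLM_eq_fderivCLM (𝕜 := ℝ) (k := ⊤) (f := f) (v := v) (x := x)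
  rw [TestFunction.fderivCLM_apply_of_le f le_top] at h
  exact h

theorem lap_apply (f : TestFun) (x : ℂ) :
    lap f x = -(fderiv ℝ (fun y => fderiv ℝ f y 1) x 1 +
      fderiv ℝ (fun y => fderiv ℝ f y Complex.I) x Complex.I) := by
  have h : ∀ v, (dirDeriv v f : ℂ → ℝ) = fun y => fderiv ℝ f y v := fun v =>
    funext fun y => dirDeriv_apply v f y
  rw [← h, ← h, ← dirDeriv_apply, ← dirDeriv_apply]
  rfl

theorem lap_eq_zero (f : TestFun) {x : ℂ} (hx : f =ᶠ[𝓝 x] 0) : lap f x = 0 := by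
  have h : ∀ v, (fun y => fderiv ℝ f y v) =ᶠ[𝓝 x] 0 := fun v => by
    filter_upwards [hx.fderiv (𝕜 := ℝ)] with y hy
    rw [hy]
    simp
  rw [lap_apply, (h 1).fderiv_eq, (h Complex.I).fderiv_eq]
  simp

theorem integral_lap (f : TestFun) : ∫ x, lap f x = 0 := by
  have key : ∀ (g : TestFun) (v : ℂ), ∫ x, dirDeriv v g x = 0 := by
    intro g v
    have hv : (dirDeriv v g : ℂ → ℝ) = fun x => fderiv ℝ g x v :=
      funext fun x => dirDeriv_apply v g x
    have h := integral_mul_fderiv_eq_neg_fderiv_mul_of_integrable (μ := MeasureTheory.volume)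
      (f := fun _ : ℂ => (1 : ℝ)) (g := g) (v := v)
      (by simp)
      (by simpa [hv] using testFun_integrable (dirDeriv v g))
      (by simpa using testFun_integrable g) (fun _ _ => differentiableAt_const _)
      (fun x _ => (g.contDiff.differentiable (by simp)).differentiableAt)
    simpa [dirDeriv_apply] using h
  have h : ∀ x, lap f x = -(dirDeriv 1 (dirDeriv 1 f) x +
    dirDeriv Complex.I (dirDeriv Complex.I f) x) := fun x => rfl
  simp only [h]
  rw [MeasureTheory.integral_neg, MeasureTheory.integral_add (testFun_integrable _)
    (testFun_integrable _), key, key]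
  simp

/-- Conformal covariance of the Laplacian in two dimensions. -/
theorem ConfEmb.lap_pushScalar (φ : ConfEmb) (h : TestFun) :
    lap (φ.pushScalar h) = φ.push (lap h) := by
  set u := φ.pushScalar h with hu
  ext x
  by_cases hx : x ∈ φ.image
  swap
  · rw [φ.push_eq_zero _ hx]
    refine lap_eq_zero u ?_
    have hx' : x ∈ (φ.toFun '' tsupport h)ᶜ :=
      fun h' => hx (Set.image_mono h.tsupport_subset h')
    filter_upwards [(φ.isCompact_image_tsupport h.hasCompactSupport
      h.tsupport_subset).isClosed.isOpen_compl.mem_nhds hx'] with y hy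
      using φ.extendZero_eq_zero hy
  obtain ⟨z, hz, rfl⟩ := hx
  rw [φ.push_apply _ hz]
  set a := deriv φ.toFun z with ha
  set A := fderiv ℝ (fderiv ℝ u) (φ.toFun z) with hA
  set D := fderiv ℝ u (φ.toFun z) with hD
  have hud : ContDiff ℝ ∞ u := u.contDiff
  have hdiff : ∀ w ∈ disk, HasFDerivAt φ.toFun
      ((ContinuousLinearMap.toSpanSingleton ℂ (deriv φ.toFun w)).restrictScalars ℝ) w :=
    fun w hw => ((φ.hasStrictDerivAt hw).hasDerivAt.hasFDerivAt.restrictScalars ℝ)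
  have h1 : ∀ w ∈ disk, ∀ v, fderiv ℝ h w v
      = fderiv ℝ u (φ.toFun w) (v * deriv φ.toFun w) := by
    intro w hw v
    have he : (h : ℂ → ℝ) =ᶠ[𝓝 w] u ∘ φ.toFun := by
      filter_upwards [disk.isOpen.mem_nhds hw] with y hy using (φ.pushScalar_apply h hy).symm
    rw [he.fderiv_eq, (((hud.differentiable (by simp)).differentiableAt.hasFDerivAt).comp w
      (hdiff w hw)).fderiv]
    simp
  have h2 : ∀ v, fderiv ℝ (fun y => fderiv ℝ h y v) z v
      = A (v * a) (v * a) + D (v * (v * deriv (deriv φ.toFun) z)) := by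
    intro v
    have he : (fun y => fderiv ℝ h y v) =ᶠ[𝓝 z]
        fun y => fderiv ℝ u (φ.toFun y) (v * deriv φ.toFun y) := by
      filter_upwards [disk.isOpen.mem_nhds hz] with y hy using h1 y hy v
    have hc : HasFDerivAt (fun y => fderiv ℝ u (φ.toFun y)) (A ∘L
        ((ContinuousLinearMap.toSpanSingleton ℂ a).restrictScalars ℝ)) z := by
      have : DifferentiableAt ℝ (fderiv ℝ u) (φ.toFun z) :=
        ((hud.fderiv_right (m := ∞) (by simp)).differentiable (by simp)).differentiableAt
      exact this.hasFDerivAt.comp z (hdiff z hz)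
    have hv : HasFDerivAt (fun y => v * deriv φ.toFun y)
        ((ContinuousLinearMap.toSpanSingleton ℂ
          (v * deriv (deriv φ.toFun) z)).restrictScalars ℝ) z :=
      (((φ.analyticAt hz).deriv.differentiableAt.hasDerivAt.const_mul
        v).hasFDerivAt.restrictScalars ℝ)
    rw [he.fderiv_eq, (hc.clm_apply hv).fderiv]
    simp [hD, ha]
    ring
  have h3 : A a a + A (Complex.I * a) (Complex.I * a)
      = φ.factor z ^ 2 * (A 1 1 + A Complex.I Complex.I) := by
    have e1 : a = a.re • (1 : ℂ) + a.im • Complex.I := by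
      apply Complex.ext <;> simp
    have e2 : Complex.I * a = (-a.im) • (1 : ℂ) + a.re • Complex.I := by
      apply Complex.ext <;> simp
    have e3 : φ.factor z ^ 2 = a.re ^ 2 + a.im ^ 2 := by
      rw [factor, ← Complex.normSq_eq_norm_sq, Complex.normSq_apply]; ring
    rw [e2, e3]
    nth_rewrite 1 2 [e1]
    simp only [map_add, map_smul, _root_.add_apply, _root_.smul_apply, smul_eq_mul]
    ring
  have h4 : ∀ v, fderiv ℝ (fun y => fderiv ℝ u y v) (φ.toFun z) v = A v v := by
    intro v
    have : DifferentiableAt ℝ (fderiv ℝ u) (φ.toFun z) :=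
      ((hud.fderiv_right (m := ∞) (by simp)).differentiable (by simp)).differentiableAt
    rw [(this.hasFDerivAt.clm_apply (hasFDerivAt_const v (φ.toFun z))).fderiv]
    simp [hA]
  have h5 : Complex.I * (Complex.I * deriv (deriv φ.toFun) z) = -deriv (deriv φ.toFun) z := by
    rw [← mul_assoc, Complex.I_mul_I]; ring
  have h0 := (φ.factor_pos hz).ne'
  rw [lap_apply, lap_apply, h4, h4, h2, h2, h5, one_mul, one_mul, one_mul, map_neg]
  have h6 : A a a + D (deriv (deriv φ.toFun) z) + (A (Complex.I * a) (Complex.I * a) +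
      -D (deriv (deriv φ.toFun) z)) = φ.factor z ^ 2 * (A 1 1 + A Complex.I Complex.I) := by
    rw [← h3]; ring
  rw [h6, zpow_neg]
  norm_cast
  field_simp

end Disk

section MoreAlgebra

variable {V : Type*} [AddCommGroup V] [Module ℝ V]

theorem contract_polyMap {W : Type*} [AddCommGroup W] [Module ℝ W] (f : V →ₗ[ℝ] W)
    (ℓ : W →ₗ[ℝ] ℝ) (x : PolyAlg V) :
    contract ℓ (polyMap f x) = polyMap f (contract (ℓ ∘ₗ f) x) := by
  induction x using poly_induction with
  | one => simp [contract_one]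
  | smul c x h => simp only [map_smul, h]
  | add x y hx hy => simp only [map_add, hx, hy]
  | mul v x h => simp [contract_gen_mul, h]

theorem contract_zero (x : PolyAlg V) : contract (0 : V →ₗ[ℝ] ℝ) x = 0 := by
  simpa using congr($(contract_smul (0 : ℝ) (0 : V →ₗ[ℝ] ℝ)) x)

theorem contract_prod_eq_zero {ι : Type*} (ℓ : V →ₗ[ℝ] ℝ) (s : Finset ι) (x : ι → PolyAlg V)
    (h : ∀ i ∈ s, contract ℓ (x i) = 0) : contract ℓ (∏ i ∈ s, x i) = 0 := by
  classical
  induction s using Finset.induction_on with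
  | empty => simp [contract_one]
  | insert i s hi ih =>
    rw [Finset.prod_insert hi, contract_mul, h i (by simp),
      ih fun j hj => h j (Finset.mem_insert_of_mem hj)]
    simp

theorem multilinear_congr {ι M N : Type*} [Finite ι] [AddCommGroup M] [Module ℝ M]
    [AddCommGroup N] [Module ℝ N] (m : MultilinearMap ℝ (fun _ : ι => M) N) (K : Submodule ℝ M)
    (hm : ∀ x i, x i ∈ K → m x = 0) {x y : ι → M} (h : ∀ i, x i - y i ∈ K) : m x = m y := by
  classical
  have := Fintype.ofFinite ι
  have key : ∀ s : Finset ι, m (s.piecewise x y) = m y := by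
    intro s
    induction s using Finset.induction_on with
    | empty => simp
    | insert j s hj ih =>
      rw [Finset.piecewise_insert, ← ih]
      have h1 : Function.update (s.piecewise x y) j (y j) = s.piecewise x y := by
        rw [Function.update_eq_self_iff, Finset.piecewise_eq_of_notMem _ _ _ hj]
      rw [← sub_eq_zero]
      nth_rewrite 2 [← h1]
      rw [← m.map_update_sub]
      exact hm _ j (by simpa using h j)
  simpa using key Finset.univ

/-- A multilinear map which vanishes as soon as one argument lies in `K` descends to `M / K`. -/
noncomputable def multilinearDescend {ι M N : Type*} [Finite ι] [AddCommGroup M] [Module ℝ M]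
    [AddCommGroup N] [Module ℝ N] (m : MultilinearMap ℝ (fun _ : ι => M) N) (K : Submodule ℝ M)
    (hm : ∀ x i, x i ∈ K → m x = 0) : MultilinearMap ℝ (fun _ : ι => M ⧸ K) N where
  toFun q := m fun i => (q i).out
  map_update_add' {d} q i a b := by
    have hu : ∀ c : M ⧸ K, (fun j => (Function.update q i c j).out)
        = Function.update (fun j => (q j).out) i c.out := by
      intro c
      ext j
      rcases eq_or_ne j i with rfl | hj <;> simp [*]
    rw [hu a, hu b, ← m.map_update_add]
    refine multilinear_congr m K hm fun j => ?_
    rw [← Submodule.Quotient.mk_eq_zero, Submodule.Quotient.mk_sub, sub_eq_zero]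
    rcases eq_or_ne j i with rfl | hj
    · simp [Submodule.Quotient.mk_out]
    · simp [hj]
  map_update_smul' {d} q i c a := by
    have hu : ∀ c : M ⧸ K, (fun j => (Function.update q i c j).out)
        = Function.update (fun j => (q j).out) i c.out := by
      intro c
      ext j
      rcases eq_or_ne j i with rfl | hj <;> simp [*]
    rw [hu a, ← m.map_update_smul]
    refine multilinear_congr m K hm fun j => ?_
    rw [← Submodule.Quotient.mk_eq_zero, Submodule.Quotient.mk_sub, sub_eq_zero]
    rcases eq_or_ne j i with rfl | hj
    · simp [Submodule.Quotient.mk_out]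
    · simp [hj]

theorem multilinearDescend_mk {ι M N : Type*} [Finite ι] [AddCommGroup M] [Module ℝ M]
    [AddCommGroup N] [Module ℝ N] (m : MultilinearMap ℝ (fun _ : ι => M) N) (K : Submodule ℝ M)
    (hm : ∀ x i, x i ∈ K → m x = 0) (x : ι → M) :
    multilinearDescend m K hm (fun i => Submodule.Quotient.mk (x i)) = m x :=
  multilinear_congr m K hm fun i => by
    rw [← Submodule.Quotient.mk_eq_zero, Submodule.Quotient.mk_sub, sub_eq_zero]
    exact Submodule.Quotient.mk_out _

end MoreAlgebra

/-- A configuration of conformal open embeddings `𝔻 → 𝔻` with pairwise disjoint images, indexed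
by a finite set `ι`; the operad `ℂ𝔼₂^emb` has `ℂ𝔼₂^emb(n) = Config (Fin n)`. -/
structure Config (ι : Type) where
  emb : ι → ConfEmb
  disjoint : ∀ i j, i ≠ j → Disjoint (emb i).image (emb j).image

/-- A space `A ⊆ C_c^∞(𝔻)` of test functions which contains `Δ C_c^∞(𝔻)` and is stable under all
push-forwards. Only `fullSpace` and `meanZeroSpace` are used. -/
structure TestSpace where
  carrier : Submodule ℝ TestFun
  lap_mem : ∀ h, lap h ∈ carrier
  push_mem : ∀ (φ : ConfEmb), ∀ f ∈ carrier, φ.push f ∈ carrier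

/-- All of `C_c^∞(𝔻)`. -/
noncomputable def fullSpace : TestSpace where
  carrier := ⊤
  lap_mem _ := trivial
  push_mem _ _ _ := trivial

/-- Integration `∫_𝔻 f d²x` on `C_c^∞(𝔻)`. -/
noncomputable def integralForm : TestFun →ₗ[ℝ] ℝ where
  toFun f := ∫ x, f x
  map_add' f g := MeasureTheory.integral_add (testFun_integrable f) (testFun_integrable g)
  map_smul' c f := MeasureTheory.integral_const_mul c f

/-- The mean zero test functions `C_c^∞(𝔻)₀`. -/
noncomputable def meanZeroSpace : TestSpace where
  carrier := LinearMap.ker integralForm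
  lap_mem h := integral_lap h
  push_mem φ f hf := (φ.integral_push f).trans hf

/-- The `L²` pairing `(f, h) ↦ ∫_𝔻 f h d²x`. -/
noncomputable def l2Form : TestFun →ₗ[ℝ] TestFun →ₗ[ℝ] ℝ :=
  have hi : ∀ f g : TestFun, MeasureTheory.Integrable fun x => f x * g x := fun f g =>
    (f.continuous.mul g.continuous).integrable_of_hasCompactSupport
      (f.hasCompactSupport.mul_right)
  LinearMap.mk₂ ℝ (fun f h => ∫ x, f x * h x)
    (fun f g h => by
      rw [← MeasureTheory.integral_add (hi f h) (hi g h)]; simp [add_mul])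
    (fun c f h => by
      rw [smul_eq_mul, ← MeasureTheory.integral_const_mul]; simp [mul_assoc])
    (fun f g h => by
      rw [← MeasureTheory.integral_add (hi f g) (hi f h)]; simp [mul_add])
    (fun c f h => by
      rw [smul_eq_mul, ← MeasureTheory.integral_const_mul]; simp [mul_left_comm])

theorem l2Form_apply (f h : TestFun) : l2Form f h = ∫ x, f x * h x := rfl

theorem l2Form_push (φ : ConfEmb) (f h : TestFun) :
    l2Form (φ.push f) (φ.pushScalar h) = l2Form f h := by
  rw [l2Form_apply, l2Form_apply, φ.integral_push_mul]
  refine MeasureTheory.integral_congr_ae (Filter.Eventually.of_forall fun z => ?_)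
  by_cases hz : z ∈ disk
  · simp only [φ.pushScalar_apply h hz]
  · simp only [testFun_eq_zero f hz, zero_mul]

theorem l2Form_push_of_disjoint {φ ψ : ConfEmb} (hd : Disjoint φ.image ψ.image)
    (f h : TestFun) : l2Form (φ.push f) (ψ.pushScalar h) = 0 := by
  rw [l2Form_apply]
  refine (MeasureTheory.integral_congr_ae (Filter.Eventually.of_forall fun z => ?_)).trans
    (MeasureTheory.integral_zero _ _)
  by_cases hz : z ∈ φ.image
  · simp only [ψ.pushScalar_eq_zero h (Set.disjoint_left.1 hd hz), mul_zero]
  · simp only [φ.push_eq_zero f hz, zero_mul]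

namespace TestSpace

/-- `Δ : C_c^∞(𝔻) → A`. -/
noncomputable def lap (A : TestSpace) : TestFun →ₗ[ℝ] A.carrier :=
  FreeField.lap.codRestrict A.carrier A.lap_mem

/-- The `L²` pairing of `A` and `C_c^∞(𝔻)`. -/
noncomputable def l2Form (A : TestSpace) : A.carrier →ₗ[ℝ] TestFun →ₗ[ℝ] ℝ :=
  FreeField.l2Form ∘ₗ A.carrier.subtype

/-- The Batalin-Vilkovisky operator `Δ^BV : P(A) ⊗ C_c^∞(𝔻) → P(A)`,
`f₁ ⋯ fₙ ⊗ h ↦ - f₁ ⋯ fₙ · Δ h + ∑ i, (∫ fᵢ h) f₁ ⋯ f̂ᵢ ⋯ fₙ`. -/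
noncomputable def bv (A : TestSpace) : PolyAlg A.carrier ⊗[ℝ] TestFun →ₗ[ℝ] PolyAlg A.carrier :=
  bvOperator A.lap A.l2Form

/-- The quantum observables `P(A) / Im Δ^BV`; this is `F_CL(𝔻)` for `A = C_c^∞(𝔻)` and
`F_CL(𝔻)₀` for `A = C_c^∞(𝔻)₀`. -/
abbrev Quantum (A : TestSpace) : Type := PolyAlg A.carrier ⧸ LinearMap.range A.bv

/-- The space `A / Δ C_c^∞(𝔻)`; this is `S^cl(𝔻)`, respectively `S₀^cl(𝔻)`. -/
abbrev Linear (A : TestSpace) : Type := A.carrier ⧸ LinearMap.range A.lap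

/-- The classical observables `P(A / Δ C_c^∞(𝔻))`. -/
abbrev Classical (A : TestSpace) : Type := PolyAlg A.Linear

/-- The quotient map from `P(A)` to the classical observables. -/
noncomputable def proj (A : TestSpace) : PolyAlg A.carrier →ₐ[ℝ] A.Classical := classicalProj A.lap

/-- `W_φ` on `A`. -/
noncomputable def push (A : TestSpace) (φ : ConfEmb) : A.carrier →ₗ[ℝ] A.carrier :=
  φ.push.restrict (A.push_mem φ)

theorem push_lap (A : TestSpace) (φ : ConfEmb) (h : TestFun) :
    A.push φ (A.lap h) = A.lap (φ.pushScalar h) :=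
  Subtype.ext (φ.lap_pushScalar h).symm

/-- The map `W_φ^cl` of classical observables induced by `W_φ`. -/
noncomputable def pushClassical (A : TestSpace) (φ : ConfEmb) : A.Classical →ₐ[ℝ] A.Classical :=
  polyMap ((LinearMap.range A.lap).mapQ (LinearMap.range A.lap) (A.push φ) (by
    rintro _ ⟨h, rfl⟩
    exact ⟨φ.pushScalar h, (A.push_lap φ h).symm⟩))

/-- The multilinear map `(F_i) ↦ ∏ W_{φ_i} F_i` on `P(A)`. -/
noncomputable def pushProd (A : TestSpace) {ι : Type} [Fintype ι] (φ : Config ι) :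
    MultilinearMap ℝ (fun _ : ι => PolyAlg A.carrier) (PolyAlg A.carrier) :=
  (MultilinearMap.mkPiAlgebra ℝ ι (PolyAlg A.carrier)).compLinearMap
    fun i => (polyMap (A.push (φ.emb i))).toLinearMap

theorem pushProd_apply (A : TestSpace) {ι : Type} [Fintype ι] (φ : Config ι)
    (x : ι → PolyAlg A.carrier) : A.pushProd φ x = ∏ i, polyMap (A.push (φ.emb i)) (x i) := by
  simp [pushProd]

theorem pushProd_mem (A : TestSpace) {ι : Type} [Fintype ι] (φ : Config ι)
    (x : ι → PolyAlg A.carrier) (i : ι) (hi : x i ∈ LinearMap.range A.bv) :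
    A.pushProd φ x ∈ LinearMap.range A.bv := by
  classical
  rw [pushProd_apply, ← Finset.mul_prod_erase _ _ (Finset.mem_univ i)]
  obtain ⟨t, ht⟩ := hi
  rw [← ht]
  clear ht
  induction t with
  | zero => simp
  | add s t hs ht => rw [map_add, map_add, add_mul]; exact add_mem hs ht
  | tmul F h =>
    set R := ∏ j ∈ Finset.univ.erase i, polyMap (A.push (φ.emb j)) (x j) with hR
    refine ⟨(polyMap (A.push (φ.emb i)) F * R) ⊗ₜ (φ.emb i).pushScalar h, ?_⟩
    have h1 : contract (A.l2Form.flip ((φ.emb i).pushScalar h)) R = 0 := by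
      refine contract_prod_eq_zero _ _ _ fun j hj => ?_
      rw [contract_polyMap]
      have : A.l2Form.flip ((φ.emb i).pushScalar h) ∘ₗ A.push (φ.emb j) = 0 := by
        ext f
        exact l2Form_push_of_disjoint (φ.disjoint j i (Finset.ne_of_mem_erase hj)) f.1 h
      rw [this, contract_zero, map_zero]
    have h2 : A.l2Form.flip ((φ.emb i).pushScalar h) ∘ₗ A.push (φ.emb i) = A.l2Form.flip h := by
      ext f
      exact l2Form_push (φ.emb i) f.1 h
    rw [bv, bvOperator_tmul, bvOperator_tmul, contract_mul, h1, contract_polyMap, h2, map_add,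
      map_neg, map_mul, polyMap_gen, push_lap]
    ring

/-- The structure map `F_CL(φ) : [F₁] ⊗ ⋯ ⊗ [Fₙ] ↦ [W_{φ₁} F₁ ⋯ W_{φₙ} Fₙ]` of quantum
observables attached to `φ : 𝔻 ⊔ ⋯ ⊔ 𝔻 → 𝔻`. -/
noncomputable def quantumMap (A : TestSpace) {ι : Type} [Fintype ι] (φ : Config ι) :
    MultilinearMap ℝ (fun _ : ι => A.Quantum) A.Quantum :=
  multilinearDescend ((LinearMap.range A.bv).mkQ.compMultilinearMap (A.pushProd φ))
    (LinearMap.range A.bv) fun x i hi => by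
      rw [LinearMap.compMultilinearMap_apply, Submodule.mkQ_apply,
        Submodule.Quotient.mk_eq_zero]
      exact A.pushProd_mem φ x i hi

theorem quantumMap_mk (A : TestSpace) {ι : Type} [Fintype ι] (φ : Config ι)
    (x : ι → PolyAlg A.carrier) :
    A.quantumMap φ (fun i => Submodule.Quotient.mk (x i))
      = Submodule.Quotient.mk (∏ i, polyMap (A.push (φ.emb i)) (x i)) := by
  rw [quantumMap, multilinearDescend_mk, LinearMap.compMultilinearMap_apply, pushProd_apply,
    Submodule.mkQ_apply]

end TestSpace

section Kernels

/-- The square `𝔻 × 𝔻`. -/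
def disk2 : Set (ℂ × ℂ) := (disk : Set ℂ) ×ˢ (disk : Set ℂ)

/-- Local integrability of a kernel on `𝔻 × 𝔻`. -/
def LocIntKernel (P : ℂ → ℂ → ℝ) : Prop :=
  MeasureTheory.LocallyIntegrableOn (fun p : ℂ × ℂ => P p.1 p.2) disk2

theorem LocIntKernel.integrableOn {P : ℂ → ℂ → ℝ} (hP : LocIntKernel P) (f g : TestFun) :
    MeasureTheory.IntegrableOn (fun p : ℂ × ℂ => P p.1 p.2 * (f p.1 * g p.2)) disk2 := by
  have hK : IsCompact (tsupport f ×ˢ tsupport g) :=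
    f.hasCompactSupport.isCompact.prod g.hasCompactSupport.isCompact
  have h1 := hP.integrableOn_compact_subset
    (Set.prod_mono f.tsupport_subset g.tsupport_subset) hK
  have h2 : ContinuousOn (fun p : ℂ × ℂ => f p.1 * g p.2) (tsupport f ×ˢ tsupport g) :=
    ((f.continuous.comp continuous_fst).mul (g.continuous.comp continuous_snd)).continuousOn
  have h3 := h1.mul_continuousOn h2 hK
  refine (MeasureTheory.IntegrableOn.of_forall_sdiff_eq_zero h3
    (disk.isOpen.prod disk.isOpen).measurableSet fun p hp => ?_)
  by_cases hp1 : p.1 ∈ tsupport f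
  · have : p.2 ∉ tsupport g := fun h => hp.2 ⟨hp1, h⟩
    simp [image_eq_zero_of_notMem_tsupport this]
  · simp [image_eq_zero_of_notMem_tsupport hp1]

/-- The bilinear form `∂_P(f, g) = ∫_{𝔻 × 𝔻} P(x, y) f(x) g(y) dx dy` of a locally integrable
kernel. -/
noncomputable def kernelForm (P : ℂ → ℂ → ℝ) (hP : LocIntKernel P) :
    TestFun →ₗ[ℝ] TestFun →ₗ[ℝ] ℝ :=
  LinearMap.mk₂ ℝ (fun f g => ∫ p in disk2, P p.1 p.2 * (f p.1 * g p.2))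
    (fun f g h => by
      rw [← MeasureTheory.integral_add (hP.integrableOn f h) (hP.integrableOn g h)]
      simp [add_mul, mul_add])
    (fun c f h => by
      rw [smul_eq_mul, ← MeasureTheory.integral_const_mul]
      simp [mul_assoc, mul_left_comm])
    (fun f g h => by
      rw [← MeasureTheory.integral_add (hP.integrableOn f g) (hP.integrableOn f h)]
      simp [mul_add])
    (fun c f h => by
      rw [smul_eq_mul, ← MeasureTheory.integral_const_mul]
      simp [mul_left_comm])

theorem kernelForm_apply {P : ℂ → ℂ → ℝ} (hP : LocIntKernel P) (f g : TestFun) :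
    kernelForm P hP f g = ∫ p in disk2, P p.1 p.2 * (f p.1 * g p.2) := rfl

/-- Symmetric locally integrable kernels `P` with `Δ_y P(x, y) = δ(x - y)` on `𝔻 × 𝔻`, as
distributions (tested on functions `f(x) h(y)`, whose span is dense). -/
structure IsGreenKernel (P : ℂ → ℂ → ℝ) : Prop where
  symm : ∀ x ∈ disk, ∀ y ∈ disk, P x y = P y x
  locInt : LocIntKernel P
  green : ∀ f h : TestFun, kernelForm P locInt f (lap h) = l2Form f h

/-- Symmetric locally integrable kernels `P` with `Δ_y P(x, y) = 0` on `𝔻 × 𝔻`, as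
distributions. -/
structure IsHarmonicKernel (P : ℂ → ℂ → ℝ) : Prop where
  symm : ∀ x ∈ disk, ∀ y ∈ disk, P x y = P y x
  locInt : LocIntKernel P
  harmonic : ∀ f h : TestFun, kernelForm P locInt f (lap h) = 0

theorem kernelForm_symm {P : ℂ → ℂ → ℝ} (hs : ∀ x ∈ disk, ∀ y ∈ disk, P x y = P y x)
    (hP : LocIntKernel P) (f g : TestFun) : kernelForm P hP f g = kernelForm P hP g f := by
  rw [kernelForm_apply, kernelForm_apply, disk2, MeasureTheory.Measure.volume_eq_prod,
    ← MeasureTheory.Measure.prod_restrict, ← MeasureTheory.integral_prod_swap,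
    MeasureTheory.Measure.prod_restrict]
  refine MeasureTheory.setIntegral_congr_fun (disk.isOpen.prod disk.isOpen).measurableSet
    fun p hp => ?_
  simp only [Prod.fst_swap, Prod.snd_swap, hs p.2 hp.2 p.1 hp.1]
  ring

namespace TestSpace

/-- The restriction of `∂_P` to `A`. -/
noncomputable def form (A : TestSpace) (P : ℂ → ℂ → ℝ) (hP : LocIntKernel P) :
    A.carrier →ₗ[ℝ] A.carrier →ₗ[ℝ] ℝ :=
  (kernelForm P hP).domRestrict₁₂ A.carrier A.carrier

/-- The isomorphism `Ψ_P = exp(∂_P)` from quantum to classical observables. -/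
noncomputable def Psi (A : TestSpace) {P : ℂ → ℂ → ℝ} (hP : IsGreenKernel P) :
    A.Quantum ≃ₗ[ℝ] A.Classical :=
  quantumEquiv (A.form P hP.locInt) (fun f g => kernelForm_symm hP.symm hP.locInt f.1 g.1)
    (fun f h => hP.green f.1 h)

theorem Psi_mk (A : TestSpace) {P : ℂ → ℂ → ℝ} (hP : IsGreenKernel P) (F : PolyAlg A.carrier) :
    A.Psi hP (Submodule.Quotient.mk F) = A.proj (expPair (A.form P hP.locInt) F) := rfl

/-- The form `∂_P` of a harmonic kernel, as a form on `A / Δ C_c^∞(𝔻)`. -/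
noncomputable def classicalForm (A : TestSpace) {P : ℂ → ℂ → ℝ} (hP : IsHarmonicKernel P) :
    A.Linear →ₗ[ℝ] A.Linear →ₗ[ℝ] ℝ :=
  (LinearMap.range A.lap).liftQ
    (((LinearMap.range A.lap).liftQ (A.form P hP.locInt) (by
        rintro _ ⟨h, rfl⟩
        rw [LinearMap.mem_ker]
        ext f
        exact (kernelForm_symm hP.symm hP.locInt _ f.1).trans (hP.harmonic f.1 h))).flip) (by
    rintro _ ⟨h, rfl⟩
    rw [LinearMap.mem_ker]
    ext f
    exact hP.harmonic f.1 h)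

theorem classicalForm_mk (A : TestSpace) {P : ℂ → ℂ → ℝ} (hP : IsHarmonicKernel P)
    (f g : A.carrier) :
    A.classicalForm hP (Submodule.Quotient.mk f) (Submodule.Quotient.mk g)
      = A.form P hP.locInt f g :=
  kernelForm_symm hP.symm hP.locInt g.1 f.1

/-- The structure maps `ρ^cl_φ = Ψ_P ∘ F_CL(φ) ∘ (⊗ Ψ_P⁻¹)` on classical observables. -/
noncomputable def rho (A : TestSpace) {P : ℂ → ℂ → ℝ} (hP : IsGreenKernel P) {ι : Type}
    [Fintype ι] (φ : Config ι) : MultilinearMap ℝ (fun _ : ι => A.Classical) A.Classical :=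
  (A.Psi hP).toLinearMap.compMultilinearMap
    ((A.quantumMap φ).compLinearMap fun _ => (A.Psi hP).symm.toLinearMap)

end TestSpace

/-- The Green function `G₂(x, y) = -(2π)⁻¹ log |x - y|`. -/
noncomputable def green2 (x y : ℂ) : ℝ := -(2 * Real.pi)⁻¹ * Real.log ‖x - y‖

/-- The harmonic cocycle
`H_φ(z, w) = log |φ(z) - φ(w)| - log |z - w| - ½ log |φ'(z)| - ½ log |φ'(w)|` (for `z ≠ w`). -/
noncomputable def cocycle (φ : ConfEmb) (z w : ℂ) : ℝ :=
  Real.log ‖φ.toFun z - φ.toFun w‖ - Real.log ‖z - w‖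
    - 1 / 2 * Real.log ‖deriv φ.toFun z‖ - 1 / 2 * Real.log ‖deriv φ.toFun w‖

/-- The inclusion `S₀^cl(𝔻) → S^cl(𝔻)`. -/
noncomputable def meanZeroInclusion : meanZeroSpace.Linear →ₗ[ℝ] fullSpace.Linear :=
  (LinearMap.range meanZeroSpace.lap).mapQ (LinearMap.range fullSpace.lap)
    (Submodule.inclusion (le_top : meanZeroSpace.carrier ≤ fullSpace.carrier)) (by
      rintro _ ⟨h, rfl⟩
      exact ⟨h, rfl⟩)

end Kernels

section Operad

/-- The identity of `𝔻`. -/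
def ConfEmb.id : ConfEmb where
  toFun z := z
  mapsTo _ h := h
  injOn _ _ _ _ h := h
  holo := differentiableOn_id
  deriv_ne_zero z _ := by simp

/-- The composition `φ ∘ ψ`. -/
def ConfEmb.comp (φ ψ : ConfEmb) : ConfEmb where
  toFun z := φ.toFun (ψ.toFun z)
  mapsTo := φ.mapsTo.comp ψ.mapsTo
  injOn := φ.injOn.comp ψ.injOn ψ.mapsTo
  holo := φ.holo.comp ψ.holo ψ.mapsTo
  deriv_ne_zero z hz := by
    have h := ((φ.hasStrictDerivAt (ψ.mapsTo hz)).hasDerivAt.comp z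
      (ψ.hasStrictDerivAt hz).hasDerivAt).deriv
    exact h ▸ mul_ne_zero (φ.deriv_ne_zero _ (ψ.mapsTo hz)) (ψ.deriv_ne_zero z hz)

theorem ConfEmb.image_comp_subset (φ ψ : ConfEmb) : (φ.comp ψ).image ⊆ φ.image := by
  rintro _ ⟨z, hz, rfl⟩
  exact ⟨ψ.toFun z, ψ.mapsTo hz, rfl⟩

namespace Config

/-- A single embedding, as an element of `ℂ𝔼₂^emb(1)`. -/
def single (φ : ConfEmb) : Config (Fin 1) where
  emb _ := φ
  disjoint i j h := (h (Subsingleton.elim i j)).elim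

/-- The right action of relabellings. -/
def reindex {ι κ : Type} (φ : Config ι) (e : κ ≃ ι) : Config κ where
  emb k := φ.emb (e k)
  disjoint _ _ h := φ.disjoint _ _ (e.injective.ne h)

/-- The operadic composition `φ ∘ᵢ ψ`: the `i`-th disk of `φ` is replaced by the disks
`φᵢ ∘ ψₖ`. -/
def circ {ι κ : Type} (φ : Config ι) (i : ι) (ψ : Config κ) : Config ({j : ι // j ≠ i} ⊕ κ) where
  emb := Sum.elim (fun j => φ.emb j) (fun k => (φ.emb i).comp (ψ.emb k))
  disjoint := by
    rintro (j | k) (j' | k') h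
    · exact φ.disjoint _ _ fun h' => h (congrArg Sum.inl (Subtype.ext h'))
    · exact (φ.disjoint _ _ j.2).mono_right ((φ.emb i).image_comp_subset _)
    · exact (φ.disjoint _ _ j'.2.symm).mono_left ((φ.emb i).image_comp_subset _)
    · have hk : k ≠ k' := fun h' => h (congrArg Sum.inr h')
      rw [Set.disjoint_left]
      rintro _ ⟨z, hz, rfl⟩ ⟨w, hw, hzw⟩
      have := (φ.emb i).injOn ((ψ.emb k').mapsTo hw) ((ψ.emb k).mapsTo hz) hzw
      exact Set.disjoint_left.1 (ψ.disjoint k k' hk) ⟨z, hz, rfl⟩ ⟨w, hw, this⟩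

end Config

open Classical in
/-- `ℂ𝔼₂^emb`-algebra structures on a vector space `M`: unit, compatibility with the partial
compositions, and equivariance. -/
structure IsOperadAlgebra {M : Type*} [AddCommGroup M] [Module ℝ M]
    (ρ : ∀ (ι : Type) [Fintype ι], Config ι → MultilinearMap ℝ (fun _ : ι => M) M) : Prop where
  unit : ∀ F : Fin 1 → M, ρ (Fin 1) (Config.single ConfEmb.id) F = F 0
  circ : ∀ (ι κ : Type) [Fintype ι] [Fintype κ] (φ : Config ι) (i : ι) (ψ : Config κ)
    (F : {j : ι // j ≠ i} ⊕ κ → M),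
    ρ ({j : ι // j ≠ i} ⊕ κ) (φ.circ i ψ) F
      = ρ ι φ (fun j => if h : j = i then ρ κ ψ (fun k => F (Sum.inr k)) else F (Sum.inl ⟨j, h⟩))
  equivariant : ∀ (ι κ : Type) [Fintype ι] [Fintype κ] (φ : Config ι) (e : κ ≃ ι) (F : κ → M),
    ρ κ (φ.reindex e) F = ρ ι φ (fun i => F (e.symm i))

/-- The letters of `n` monomials of lengths `m 0, …, m (n - 1)`. -/
abbrev Letter {n : ℕ} (m : Fin n → ℕ) : Type := Σ i : Fin n, Fin (m i)

/-- Partial pairings of the letters: sets of pairwise disjoint pairs of letters, each pair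
consisting of a letter of one monomial and a letter of a later one. -/
def IsPairing {n : ℕ} {m : Fin n → ℕ} (M : Finset (Letter m × Letter m)) : Prop :=
  (∀ e ∈ M, e.1.1 < e.2.1) ∧
    ∀ e ∈ M, ∀ e' ∈ M, e ≠ e' → e.1 ≠ e'.1 ∧ e.1 ≠ e'.2 ∧ e.2 ≠ e'.1 ∧ e.2 ≠ e'.2

open Classical in
/-- `C` is the sum over all contractions: on monomials `Fᵢ = ∏ₐ f_{i,a}`, the value
`C(F₁, …, Fₙ)` is the sum over all partial pairings `M` between letters of different monomials
(including the empty one) of `∏_{(p, q) ∈ M} B(f_p, f_q)` times the product of the remaining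
letters. -/
def IsContractionMap {V : Type*} [AddCommGroup V] [Module ℝ V] (B : V →ₗ[ℝ] V →ₗ[ℝ] ℝ) {n : ℕ}
    (C : MultilinearMap ℝ (fun _ : Fin n => PolyAlg V) (PolyAlg V)) : Prop :=
  ∀ (m : Fin n → ℕ) (f : Letter m → V),
    C (fun i => ∏ a : Fin (m i), gen (f ⟨i, a⟩))
      = ∑ M : Finset (Letter m × Letter m) with IsPairing M,
          (∏ e ∈ M, B (f e.1) (f e.2)) •
            ∏ p : Letter m with ∀ e ∈ M, p ≠ e.1 ∧ p ≠ e.2, gen (f p)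

end Operad

end FreeField

open FreeField

/-! The push-forward is dual to composition: `∫ (W_φ f) u = ∫ f (u ∘ φ)`. Hence pairing `W_φ f` with
`W_φ g` through `G₂` is pairing `f` with `g` through `G₂(φ(x), φ(y))`, which equals `G₂(x, y) -
(2π)⁻¹ H_φ(x, y)` minus `(4π)⁻¹ (log |φ'(x)| + log |φ'(y)|)`. Each of the last two terms depends on
one variable only, so both die on functions of integral zero. This is `kernelForm_green2_push`; by
naturality of `exp(∂_B)` in the form `B` (`expPair_polyMap`) it gives the covariance (1). Additivity
of `exp(∂_B)` in `B` (`expPair_add`) separates the harmonic correction and gives (2).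

For (3), (1) shows that `F_i` is the `Ψ_{G₂}`-image of the class of `exp(-∂)` applied to `R_i`, with
`∂` formed from the pull-back of `G₂` by `W_{φ_i}`. After pushing forward, `ρ^cl` becomes the
operation `exp(∂_B) ∘ (product) ∘ exp(-∂_B)^{⊗ n}` for `B = ∂_{G₂}`. Wick's theorem
(`wick_eq_sum_pairings`) says that the inner exponentials remove exactly the contractions within one
factor, leaving those between different factors.

For (4), the operator `exp(-(2π)⁻¹ ∂_{H_φ})` changes a quadratic monomial `f g` by the scalar
`-(2π)⁻¹ ∂_{H_φ}(f, g)`, so naturality forces `∂_{H_φ}` to vanish on mean zero functions. Testing it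
on a difference of two approximate Dirac masses at `z` and `w` yields `H_φ(z, z) - 2 H_φ(z, w) +
H_φ(w, w)` for the continuous extension of `H_φ`, which vanishes on the diagonal; thus `H_φ(z, w) =
0`.

Two analytic facts enter. First, `G₂` is a Green kernel, because the Laplacian of `½ log(r² + ε)` is
an approximate identity of mass `2π` (`integral_log_mul_lap`). Second, `H_φ` is harmonic, being a
combination of logarithms of moduli of nonvanishing holomorphic functions: the divided difference of
`φ`, and `φ'`. The operad axioms are immediate for quantum observables, where `W` is functorial and
the operation is a product, and `Ψ_{G₂}` transports them. -/

namespace FreeField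

/-! ### Naturality and additivity of `exp(∂_B)`, and the recursion behind Wick's theorem. -/

section WickAlgebra

variable {V W : Type*} [AddCommGroup V] [Module ℝ V] [AddCommGroup W] [Module ℝ W]

theorem polyMap_comp {U : Type*} [AddCommGroup U] [Module ℝ U] (g : W →ₗ[ℝ] U) (f : V →ₗ[ℝ] W) :
    polyMap (g ∘ₗ f) = (polyMap g).comp (polyMap f) := by
  apply SymmetricAlgebra.algHom_ext
  ext v
  simp

theorem polyMap_comp_apply {U : Type*} [AddCommGroup U] [Module ℝ U] (g : W →ₗ[ℝ] U)
    (f : V →ₗ[ℝ] W) (x : PolyAlg V) : polyMap (g ∘ₗ f) x = polyMap g (polyMap f x) := by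
  rw [polyMap_comp, AlgHom.comp_apply]

theorem polyMap_id : polyMap (LinearMap.id : V →ₗ[ℝ] V) = AlgHom.id ℝ _ := by
  apply SymmetricAlgebra.algHom_ext
  ext v
  simp

/-- Over a field an injective linear map has a linear retraction, and `polyMap` is functorial. -/
theorem polyMap_injective {f : V →ₗ[ℝ] W} (hf : Function.Injective f) :
    Function.Injective (polyMap f) := by
  obtain ⟨g, hg⟩ := f.exists_leftInverse_of_injective (LinearMap.ker_eq_bot.2 hf)
  refine Function.LeftInverse.injective (g := polyMap g) fun x => ?_
  rw [← polyMap_comp_apply, hg, polyMap_id, AlgHom.id_apply]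

theorem symForm_compl₁₂ (B : W →ₗ[ℝ] W →ₗ[ℝ] ℝ) (f : V →ₗ[ℝ] W) (v : V) :
    symForm (B.compl₁₂ f f) v = symForm B (f v) ∘ₗ f := by
  ext w
  simp [symForm]

/-- Contracting after a substitution is contracting beforehand with the pulled back form. With `f =
W_φ` this converts push-forwards into changes of kernel; with `f` a quotient map it lets `exp(∂_B)`
descend to classical observables. -/
theorem expPair_polyMap (B : W →ₗ[ℝ] W →ₗ[ℝ] ℝ) (f : V →ₗ[ℝ] W) (x : PolyAlg V) :
    expPair B (polyMap f x) = polyMap f (expPair (B.compl₁₂ f f) x) := by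
  induction x using poly_induction with
  | one => simp [expPair_one]
  | smul c x h => simp only [map_smul, h]
  | add x y hx hy => simp only [map_add, hx, hy]
  | mul v x h =>
    rw [map_mul, polyMap_gen, expPair_gen_mul, expPair_gen_mul, h, contract_polyMap, map_add,
      map_mul, polyMap_gen, symForm_compl₁₂]

theorem symForm_add (B C : V →ₗ[ℝ] V →ₗ[ℝ] ℝ) : symForm (B + C) = symForm B + symForm C := by
  ext v w
  simp [symForm]
  ring

theorem symForm_neg (B : V →ₗ[ℝ] V →ₗ[ℝ] ℝ) : symForm (-B) = -symForm B := by
  ext v w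
  simp [symForm]
  ring

theorem contract_neg (ℓ : V →ₗ[ℝ] ℝ) : contract (-ℓ) = -contract ℓ := by
  have h : contract (ℓ + -ℓ) = contract ℓ + contract (-ℓ) := contract_add _ _
  rw [add_neg_cancel, show contract (0 : V →ₗ[ℝ] ℝ) = 0 from LinearMap.ext contract_zero] at h
  exact eq_neg_of_add_eq_zero_right h.symm

/-- Both sides satisfy the same recursion on `gen v * x`, since contractions commute with
`exp(∂_B)`; no manipulation of commuting power series is needed. This compares the maps `Ψ` of two
Green kernels that differ by a harmonic kernel. -/
theorem expPair_add (B C : V →ₗ[ℝ] V →ₗ[ℝ] ℝ) (x : PolyAlg V) :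
    expPair (B + C) x = expPair B (expPair C x) := by
  induction x using poly_induction with
  | one => simp [expPair_one]
  | smul c x h => simp only [map_smul, h]
  | add x y hx hy => simp only [map_add, hx, hy]
  | mul v x h =>
    rw [expPair_gen_mul, expPair_gen_mul, map_add, expPair_gen_mul, expPair_contract, h,
      symForm_add, LinearMap.add_apply, contract_add, LinearMap.add_apply, add_assoc]

theorem expPair_zero (x : PolyAlg V) : expPair (0 : V →ₗ[ℝ] V →ₗ[ℝ] ℝ) x = x := by
  induction x using poly_induction with
  | one => simp [expPair_one]
  | smul c x h => simp only [map_smul, h]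
  | add x y hx hy => simp only [map_add, hx, hy]
  | mul v x h =>
    have : symForm (0 : V →ₗ[ℝ] V →ₗ[ℝ] ℝ) v = 0 := by ext w; simp [symForm]
    rw [expPair_gen_mul, h, this, contract_zero, add_zero]

theorem contract_prod_gen {L : Type*} [DecidableEq L] (ℓ : V →ₗ[ℝ] ℝ) (f : L → V) (S : Finset L) :
    contract ℓ (∏ p ∈ S, gen (f p)) = ∑ q ∈ S, ℓ (f q) • ∏ p ∈ S.erase q, gen (f p) := by
  induction S using Finset.induction_on with
  | empty => simp [contract_one]
  | insert v S hv ih =>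
    rw [Finset.prod_insert hv, contract_gen_mul, ih, Finset.sum_insert hv,
      Finset.erase_insert hv, add_comm, Finset.mul_sum]
    congr 1
    refine Finset.sum_congr rfl fun q hq => ?_
    have hqv : v ≠ q := fun h => hv (h ▸ hq)
    rw [Finset.erase_insert_of_ne hqv, Finset.prod_insert (fun h => hv (Finset.mem_of_mem_erase h)),
      mul_smul_comm]

/-- `exp(∂_B)` of the product over the colours `i` of the normally ordered monomials
`exp(-∂_B) (∏ f_p)` in the letters `p ∈ S` of colour `i`. -/
noncomputable def wick {n : ℕ} {L : Type*} [DecidableEq L] (B : V →ₗ[ℝ] V →ₗ[ℝ] ℝ)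
    (col : L → Fin n) (f : L → V) (S : Finset L) : PolyAlg V :=
  expPair B (∏ i, expPair (-B) (∏ p ∈ S with col p = i, gen (f p)))

theorem contract_prod_eq {ι : Type*} [DecidableEq ι] (ℓ : V →ₗ[ℝ] ℝ) (s : Finset ι)
    (x : ι → PolyAlg V) :
    contract ℓ (∏ i ∈ s, x i) = ∑ i ∈ s, contract ℓ (x i) * ∏ j ∈ s.erase i, x j := by
  induction s using Finset.induction_on with
  | empty => simp [contract_one]
  | insert i s hi ih =>
    rw [Finset.prod_insert hi, contract_mul, ih, Finset.sum_insert hi, Finset.erase_insert hi,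
      add_comm, mul_comm (∏ j ∈ s, x j), Finset.mul_sum]
    congr 1
    refine Finset.sum_congr rfl fun j hj => ?_
    have hij : i ≠ j := fun h => hi (h ▸ hj)
    rw [Finset.erase_insert_of_ne hij, Finset.prod_insert (fun h => hi (Finset.mem_of_mem_erase h))]
    ring

/-- The outer exponential contracts the new letter with every other letter, whereas the exponential
of its own colour subtracts the contractions with letters of that colour. Only partners of a
different colour survive. -/
theorem wick_insert {n : ℕ} {L : Type*} [DecidableEq L] {B : V →ₗ[ℝ] V →ₗ[ℝ] ℝ}
    (hB : ∀ v w, B v w = B w v) (col : L → Fin n) (f : L → V) (S : Finset L) {v : L}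
    (hv : v ∉ S) :
    wick B col f (insert v S) = gen (f v) * wick B col f S
      + ∑ q ∈ S with col q ≠ col v, B (f v) (f q) • wick B col f (S.erase q) := by
  set X : Fin n → PolyAlg V := fun i => ∏ p ∈ S with col p = i, gen (f p) with hX
  have hins : ∀ i, (∏ p ∈ insert v S with col p = i, gen (f p))
      = if i = col v then gen (f v) * X i else X i := by
    intro i
    rw [Finset.filter_insert]
    by_cases h : col v = i
    · rw [if_pos h, if_pos h.symm, Finset.prod_insert (by simp [hv])]
    · rw [if_neg h, if_neg (Ne.symm h)]
  have hneg : ∀ (w : V) (x : PolyAlg V), expPair (-B) (gen w * x)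
      = gen w * expPair (-B) x - contract (B w) (expPair (-B) x) := by
    intro w x
    rw [expPair_gen_mul, symForm_neg, symForm_eq hB, LinearMap.neg_apply, contract_neg,
      LinearMap.neg_apply, sub_eq_add_neg]
  have hcon : ∀ i, contract (B (f v)) (expPair (-B) (X i))
      = ∑ q ∈ S with col q = i, B (f v) (f q) •
          expPair (-B) (∏ p ∈ S.erase q with col p = i, gen (f p)) := by
    intro i
    rw [← expPair_contract, hX, contract_prod_gen, map_sum]
    refine Finset.sum_congr rfl fun q hq => ?_
    rw [map_smul, Finset.filter_erase]
  -- Inserting `v` affects only the factor of its own colour.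
  have hprod : ∏ i, expPair (-B) (∏ p ∈ insert v S with col p = i, gen (f p))
      = gen (f v) * ∏ i, expPair (-B) (X i) - contract (B (f v)) (expPair (-B) (X (col v))) *
        ∏ i ∈ Finset.univ.erase (col v), expPair (-B) (X i) := by
    rw [← Finset.mul_prod_erase _ _ (Finset.mem_univ (col v)), hins, if_pos rfl, hneg, sub_mul,
      mul_assoc, Finset.prod_congr rfl (fun i hi => by
        rw [hins, if_neg (Finset.ne_of_mem_erase hi)]),
      Finset.mul_prod_erase _ (fun i => expPair (-B) (X i)) (Finset.mem_univ (col v))]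
  -- Leibniz' rule splits the outer contraction by colours; the summand of colour `col v` cancels
  -- the term subtracted in `hprod`.
  rw [wick, hprod, map_sub, expPair_gen_mul, symForm_eq hB, add_sub_assoc, wick,
    ← expPair_contract, ← map_sub, contract_prod_eq,
    ← Finset.add_sum_erase _ _ (Finset.mem_univ (col v)), add_sub_cancel_left, map_sum,
    ← Finset.sum_fiberwise_of_maps_to (s := S.filter fun q => col q ≠ col v)
      (t := Finset.univ.erase (col v)) (g := col) (by simp)]
  congr 1
  refine Finset.sum_congr rfl fun i hi => ?_
  have hi' := Finset.ne_of_mem_erase hi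
  rw [hcon, Finset.sum_mul, map_sum, Finset.filter_filter]
  refine Finset.sum_congr (by ext q; aesop) fun q hq => ?_
  rw [smul_mul_assoc, map_smul, wick, ← Finset.mul_prod_erase _ _ (Finset.mem_univ i)]
  have hqi : col q = i := (Finset.mem_filter.1 hq).2.2
  congr 3
  refine Finset.prod_congr rfl fun j hj => ?_
  congr 1
  rw [hX, Finset.filter_erase, Finset.erase_eq_of_notMem]
  simp only [Finset.mem_filter, not_and]
  exact fun _ h => Finset.ne_of_mem_erase hj (h.symm.trans hqi)

theorem wick_empty {n : ℕ} {L : Type*} [DecidableEq L] (B : V →ₗ[ℝ] V →ₗ[ℝ] ℝ)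
    (col : L → Fin n) (f : L → V) : wick B col f ∅ = 1 := by
  simp [wick, expPair_one]

end WickAlgebra

/-! ### Partial pairings of letters satisfy the same recursion: Wick's theorem. -/

section Pairings

variable {V : Type*} [AddCommGroup V] [Module ℝ V] {n : ℕ} {m : Fin n → ℕ}

/-- The pair consisting of the letters `v` and `q`, the one of smaller colour first. -/
def orderedPair (v q : Letter m) : Letter m × Letter m := if v.1 < q.1 then (v, q) else (q, v)

theorem orderedPair_fst_lt {v q : Letter m} (h : q.1 ≠ v.1) :
    (orderedPair v q).1.1 < (orderedPair v q).2.1 := by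
  unfold orderedPair
  split_ifs with h'
  · exact h'
  · exact lt_of_le_of_ne (not_lt.1 h') h

theorem ne_orderedPair_iff {v q p : Letter m} :
    (p ≠ (orderedPair v q).1 ∧ p ≠ (orderedPair v q).2) ↔ p ≠ v ∧ p ≠ q := by
  unfold orderedPair
  split_ifs
  · rfl
  · exact and_comm

theorem orderedPair_eq {e : Letter m × Letter m} (h : e.1.1 < e.2.1) :
    orderedPair e.1 e.2 = e ∧ orderedPair e.2 e.1 = e := by
  simp [orderedPair, h, h.not_gt]

theorem apply_orderedPair {B : V →ₗ[ℝ] V →ₗ[ℝ] ℝ} (hB : ∀ v w, B v w = B w v) (f : Letter m → V)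
    (v q : Letter m) : B (f (orderedPair v q).1) (f (orderedPair v q).2) = B (f v) (f q) := by
  unfold orderedPair
  split_ifs
  · rfl
  · exact hB _ _

theorem orderedPair_mem (v q : Letter m) :
    (orderedPair v q).1 ∈ ({v, q} : Set (Letter m)) ∧
      (orderedPair v q).2 ∈ ({v, q} : Set (Letter m)) := by
  unfold orderedPair
  split_ifs <;> simp

theorem IsPairing.mono {M N : Finset (Letter m × Letter m)} (hN : IsPairing N) (h : M ⊆ N) :
    IsPairing M :=
  ⟨fun e he => hN.1 e (h he), fun e he e' he' => hN.2 e (h he) e' (h he')⟩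

theorem IsPairing.eq_of_mem {M : Finset (Letter m × Letter m)} (hM : IsPairing M)
    {e e' : Letter m × Letter m} (he : e ∈ M) (he' : e' ∈ M) {v : Letter m}
    (hv : v = e.1 ∨ v = e.2) (hv' : v = e'.1 ∨ v = e'.2) : e = e' := by
  by_contra h
  obtain ⟨h1, h2, h3, h4⟩ := hM.2 e he e' he' h
  rcases hv with rfl | rfl <;> rcases hv' with h' | h' <;> simp_all

open Classical in
/-- The pairings of the letters of `S`. -/
noncomputable def pairings (S : Finset (Letter m)) : Finset (Finset (Letter m × Letter m)) :=
  (S ×ˢ S).powerset.filter IsPairing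

theorem mem_pairings {S : Finset (Letter m)} {M : Finset (Letter m × Letter m)} :
    M ∈ pairings S ↔ (∀ e ∈ M, e.1 ∈ S ∧ e.2 ∈ S) ∧ IsPairing M := by
  simp [pairings, Finset.subset_iff]

open Classical in
/-- The letters of `S` which do not belong to any pair of `M`. -/
noncomputable def freeLetters (S : Finset (Letter m)) (M : Finset (Letter m × Letter m)) :
    Finset (Letter m) :=
  S.filter fun p => ∀ e ∈ M, p ≠ e.1 ∧ p ≠ e.2

theorem mem_freeLetters {S : Finset (Letter m)} {M : Finset (Letter m × Letter m)}
    {p : Letter m} : p ∈ freeLetters S M ↔ p ∈ S ∧ ∀ e ∈ M, p ≠ e.1 ∧ p ≠ e.2 := by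
  simp [freeLetters]

/-- The contribution of the pairing `M` to the contractions of the letters of `S`. -/
noncomputable def pairingTerm (B : V →ₗ[ℝ] V →ₗ[ℝ] ℝ) (f : Letter m → V) (S : Finset (Letter m))
    (M : Finset (Letter m × Letter m)) : PolyAlg V :=
  (∏ e ∈ M, B (f e.1) (f e.2)) • ∏ p ∈ freeLetters S M, gen (f p)

/-- The new pair is disjoint from all pairs of `M`, because `v` lies outside `S` and `q` has been
erased from the letters available to `M`. -/
theorem insert_orderedPair_mem_pairings {S : Finset (Letter m)} {v q : Letter m} (hv : v ∉ S)
    (hq : q ∈ S) (hc : q.1 ≠ v.1) {M : Finset (Letter m × Letter m)}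
    (hM : M ∈ pairings (S.erase q)) : insert (orderedPair v q) M ∈ pairings (insert v S) := by
  rw [mem_pairings] at hM ⊢
  obtain ⟨hM1, hM2, hM3⟩ := hM
  have hne : ∀ e ∈ M, (e.1 ≠ v ∧ e.1 ≠ q) ∧ (e.2 ≠ v ∧ e.2 ≠ q) := by
    intro e he
    obtain ⟨h1, h2⟩ := hM1 e he
    rw [Finset.mem_erase] at h1 h2
    exact ⟨⟨fun h => hv (h ▸ h1.2), h1.1⟩, fun h => hv (h ▸ h2.2), h2.1⟩
  refine ⟨fun e he => ?_, fun e he => ?_, fun e he e' he' hee => ?_⟩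
  · rcases Finset.mem_insert.1 he with rfl | he
    · have := orderedPair_mem v q
      constructor
      · rcases this.1 with h | h <;> rw [h] <;> simp [hq]
      · rcases this.2 with h | h <;> rw [h] <;> simp [hq]
    · have := hM1 e he
      simp only [Finset.mem_erase] at this
      simp [this.1.2, this.2.2]
  · rcases Finset.mem_insert.1 he with rfl | he
    · exact orderedPair_fst_lt hc
    · exact hM2 e he
  · rcases Finset.mem_insert.1 he with rfl | he <;> rcases Finset.mem_insert.1 he' with rfl | he'
    · exact absurd rfl hee
    · have h1 := ne_orderedPair_iff.2 (hne e' he').1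
      have h2 := ne_orderedPair_iff.2 (hne e' he').2
      exact ⟨h1.1.symm, h2.1.symm, h1.2.symm, h2.2.symm⟩
    · have h1 := ne_orderedPair_iff.2 (hne e he).1
      have h2 := ne_orderedPair_iff.2 (hne e he).2
      exact ⟨h1.1, h1.2, h2.1, h2.2⟩
    · exact hM3 e he e' he' hee

theorem orderedPair_notMem {S : Finset (Letter m)} {v q : Letter m} (hv : v ∉ S)
    {M : Finset (Letter m × Letter m)} (hM : M ∈ pairings S) : orderedPair v q ∉ M := by
  intro h
  have h1 := (mem_pairings.1 hM).1 _ h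
  unfold orderedPair at h1
  split_ifs at h1
  · exact hv h1.1
  · exact hv h1.2

theorem pairingTerm_insert_of_mem {B : V →ₗ[ℝ] V →ₗ[ℝ] ℝ} (f : Letter m → V)
    {S : Finset (Letter m)} {v : Letter m} (hv : v ∉ S) {M : Finset (Letter m × Letter m)}
    (hM : M ∈ pairings S) :
    pairingTerm B f (insert v S) M = gen (f v) * pairingTerm B f S M := by
  have hfree : freeLetters (insert v S) M = insert v (freeLetters S M) := by
    ext p
    simp only [mem_freeLetters, Finset.mem_insert]
    constructor
    · rintro ⟨rfl | h, h'⟩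
      · exact Or.inl rfl
      · exact Or.inr ⟨h, h'⟩
    · rintro (rfl | h)
      · refine ⟨Or.inl rfl, fun e he => ?_⟩
        have := (mem_pairings.1 hM).1 e he
        exact ⟨fun h => hv (h ▸ this.1), fun h => hv (h ▸ this.2)⟩
      · exact ⟨Or.inr h.1, h.2⟩
  rw [pairingTerm, hfree, Finset.prod_insert fun h => hv (mem_freeLetters.1 h).1, pairingTerm,
    mul_smul_comm]

theorem pairingTerm_insert_orderedPair {B : V →ₗ[ℝ] V →ₗ[ℝ] ℝ} (hB : ∀ v w, B v w = B w v)
    (f : Letter m → V) {S : Finset (Letter m)} {v q : Letter m} (hv : v ∉ S)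
    {M : Finset (Letter m × Letter m)} (hM : M ∈ pairings (S.erase q)) :
    pairingTerm B f (insert v S) (insert (orderedPair v q) M)
      = B (f v) (f q) • pairingTerm B f (S.erase q) M := by
  have hfree : freeLetters (insert v S) (insert (orderedPair v q) M)
      = freeLetters (S.erase q) M := by
    ext p
    simp only [mem_freeLetters, Finset.mem_insert, forall_eq_or_imp, ne_orderedPair_iff,
      Finset.mem_erase]
    have : p ∈ S → p ≠ v := fun h h' => hv (h' ▸ h)
    tauto
  rw [pairingTerm, hfree, Finset.prod_insert
    (orderedPair_notMem (fun h => hv (Finset.mem_of_mem_erase h)) hM), apply_orderedPair hB,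
    pairingTerm, mul_smul]

-- In a pairing of the enlarged set the letter `v` is either free or matched with exactly one letter
-- of another colour. These are the two terms of `wick_insert`.
open Classical in
theorem sum_pairingTerm_insert {B : V →ₗ[ℝ] V →ₗ[ℝ] ℝ} (hB : ∀ v w, B v w = B w v)
    (f : Letter m → V) {S : Finset (Letter m)} {v : Letter m} (hv : v ∉ S) :
    ∑ M ∈ pairings (insert v S), pairingTerm B f (insert v S) M
      = gen (f v) * ∑ M ∈ pairings S, pairingTerm B f S M
        + ∑ q ∈ S with q.1 ≠ v.1, B (f v) (f q) •
            ∑ M ∈ pairings (S.erase q), pairingTerm B f (S.erase q) M := by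
  rw [← Finset.sum_filter_add_sum_filter_not (pairings (insert v S))
    (fun M => ∀ e ∈ M, v ≠ e.1 ∧ v ≠ e.2)]
  congr 1
  · rw [Finset.mul_sum]
    refine Finset.sum_congr ?_ fun M hM => ?_
    · ext M
      simp only [Finset.mem_filter, mem_pairings, Finset.mem_insert]
      constructor
      · rintro ⟨⟨h1, h2⟩, h3⟩
        exact ⟨fun e he => ⟨(h1 e he).1.resolve_left (h3 e he).1.symm,
          (h1 e he).2.resolve_left (h3 e he).2.symm⟩, h2⟩
      · rintro ⟨h1, h2⟩
        exact ⟨⟨fun e he => ⟨Or.inr (h1 e he).1, Or.inr (h1 e he).2⟩, h2⟩, fun e he =>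
          ⟨fun h => hv (h ▸ (h1 e he).1), fun h => hv (h ▸ (h1 e he).2)⟩⟩
    · exact pairingTerm_insert_of_mem f hv hM
  · simp only [Finset.smul_sum]
    rw [Finset.sum_sigma']
    symm
    -- A pairing that uses `v` corresponds to the partner `q` of `v` together with a pairing of the
    -- letters other than `v` and `q`. Injectivity holds since `v` lies in only one pair.
    refine Finset.sum_bij (fun x _ => insert (orderedPair v x.1) x.2) ?_ ?_ ?_ ?_
    · rintro ⟨q, M⟩ h
      simp only [Finset.mem_sigma, Finset.mem_filter] at h ⊢
      refine ⟨insert_orderedPair_mem_pairings hv h.1.1 h.1.2 h.2, fun h' => ?_⟩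
      exact (ne_orderedPair_iff.1 (h' _ (Finset.mem_insert_self _ _))).1 rfl
    · rintro ⟨q, M⟩ h ⟨q', M'⟩ h' heq
      simp only [Finset.mem_sigma, Finset.mem_filter] at h h' heq
      have hmem := mem_pairings.1 (insert_orderedPair_mem_pairings hv h.1.1 h.1.2 h.2)
      have hvm : ∀ r : Letter m, v = (orderedPair v r).1 ∨ v = (orderedPair v r).2 := by
        intro r
        by_contra hc
        rw [not_or] at hc
        exact (ne_orderedPair_iff.1 hc).1 rfl
      have he : orderedPair v q = orderedPair v q' :=
        hmem.2.eq_of_mem (Finset.mem_insert_self _ _)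
          (heq ▸ Finset.mem_insert_self _ _) (hvm q) (hvm q')
      have hqq : q = q' := by
        by_contra hc
        have hqv : q ≠ v := fun h'' => h.1.2 (by rw [h''])
        have := ne_orderedPair_iff.2 ⟨hqv, hc⟩
        rw [← he, ne_orderedPair_iff] at this
        exact this.2 rfl
      subst hqq
      have hv' : v ∉ S.erase q := fun h => hv (Finset.mem_of_mem_erase h)
      have hMM : M = M' := by
        rw [← Finset.erase_insert (orderedPair_notMem (q := q) hv' h.2), heq,
          Finset.erase_insert (orderedPair_notMem (q := q) hv' h'.2)]
      rw [hMM]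
    · intro M hM
      simp only [Finset.mem_filter, not_forall] at hM
      obtain ⟨hM, e, he, hne⟩ := hM
      have hM' := mem_pairings.1 hM
      have hlt := hM'.2.1 e he
      -- The pair `e` contains `v`; `q` is its other entry. The ordering by colour determines `e`
      -- from the unordered pair `{v, q}`.
      obtain ⟨q, hq, hqv, hmem⟩ : ∃ q, orderedPair v q = e ∧ q.1 ≠ v.1 ∧ (q = e.1 ∨ q = e.2) := by
        by_cases h1 : v = e.1
        · exact ⟨e.2, by rw [h1]; exact (orderedPair_eq hlt).1, by rw [h1]; exact hlt.ne',
            Or.inr rfl⟩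
        · have h2 : v = e.2 := by by_contra h2; exact hne ⟨h1, h2⟩
          exact ⟨e.1, by rw [h2]; exact (orderedPair_eq hlt).2, by rw [h2]; exact hlt.ne,
            Or.inl rfl⟩
      have hqS : q ∈ S := by
        have : q ∈ insert v S := by
          rcases hmem with rfl | rfl
          exacts [(hM'.1 e he).1, (hM'.1 e he).2]
        exact (Finset.mem_insert.1 this).resolve_left fun h => hqv (by rw [h])
      refine ⟨⟨q, M.erase e⟩, ?_, by rw [hq]; exact Finset.insert_erase he⟩
      simp only [Finset.mem_sigma, Finset.mem_filter, mem_pairings]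
      refine ⟨⟨hqS, hqv⟩, fun e' he' => ?_, hM'.2.mono (Finset.erase_subset _ _)⟩
      have he'M := Finset.mem_of_mem_erase he'
      have hdis := hM'.2.2 e' he'M e he (Finset.ne_of_mem_erase he')
      have h1 := ne_orderedPair_iff.1 (show e'.1 ≠ (orderedPair v q).1 ∧ _ by
        rw [hq]; exact ⟨hdis.1, hdis.2.1⟩)
      have h2 := ne_orderedPair_iff.1 (show e'.2 ≠ (orderedPair v q).1 ∧ _ by
        rw [hq]; exact ⟨hdis.2.2.1, hdis.2.2.2⟩)
      have h3 := hM'.1 e' he'M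
      simp only [Finset.mem_insert] at h3
      simp only [Finset.mem_erase]
      exact ⟨⟨h1.2, h3.1.resolve_left h1.1⟩, h2.2, h3.2.resolve_left h2.1⟩
    · rintro ⟨q, M⟩ h
      simp only [Finset.mem_sigma] at h
      exact (pairingTerm_insert_orderedPair hB f hv h.2).symm

/-- Wick's theorem: both sides are `1` on the empty set and obey the same recursion. The recursion
also calls on sets with two letters removed, hence the strong induction. -/
theorem wick_eq_sum_pairings {B : V →ₗ[ℝ] V →ₗ[ℝ] ℝ} (hB : ∀ v w, B v w = B w v)
    (f : Letter m → V) (S : Finset (Letter m)) :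
    wick B Sigma.fst f S = ∑ M ∈ pairings S, pairingTerm B f S M := by
  induction S using Finset.strongInduction with
  | H S ih =>
    rcases S.eq_empty_or_nonempty with rfl | ⟨v, hvS⟩
    · have : pairings (∅ : Finset (Letter m)) = {∅} := by
        ext M
        rw [mem_pairings, Finset.mem_singleton]
        constructor
        · rintro ⟨h, -⟩
          exact Finset.eq_empty_of_forall_notMem fun e he => by simpa using h e he
        · rintro rfl
          simp [IsPairing]
      rw [wick_empty, this]
      simp [pairingTerm, freeLetters]
    · obtain ⟨T, hvT, rfl⟩ : ∃ T, v ∉ T ∧ insert v T = S :=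
        ⟨S.erase v, Finset.notMem_erase v S, Finset.insert_erase hvS⟩
      rw [wick_insert hB _ _ _ hvT, sum_pairingTerm_insert hB f hvT,
        ih T (Finset.ssubset_insert hvT)]
      congr 1
      refine Finset.sum_congr (by ext; simp) fun q hq => ?_
      rw [ih _ ((Finset.erase_subset q T).trans_ssubset (Finset.ssubset_insert hvT))]

/-- The sum over all contractions, `exp(∂_B) ∘ ∏ ∘ exp(-∂_B)^{⊗ n}`. -/
noncomputable def contractionMap (B : V →ₗ[ℝ] V →ₗ[ℝ] ℝ) (n : ℕ) :
    MultilinearMap ℝ (fun _ : Fin n => PolyAlg V) (PolyAlg V) :=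
  (expPair B).compMultilinearMap
    ((MultilinearMap.mkPiAlgebra ℝ (Fin n) (PolyAlg V)).compLinearMap fun _ => expPair (-B))

theorem contractionMap_apply (B : V →ₗ[ℝ] V →ₗ[ℝ] ℝ) (R : Fin n → PolyAlg V) :
    contractionMap B n R = expPair B (∏ i, expPair (-B) (R i)) := by
  simp [contractionMap]

/-- The case of all letters, coloured by the monomial they come from; what remains is the
identification of `Fin (m i)` with the letters of colour `i`. -/
theorem isContractionMap_contractionMap {B : V →ₗ[ℝ] V →ₗ[ℝ] ℝ} (hB : ∀ v w, B v w = B w v) :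
    IsContractionMap B (contractionMap B n) := by
  classical
  intro m f
  have h := wick_eq_sum_pairings hB f Finset.univ
  have hpair : pairings (Finset.univ : Finset (Letter m)) = Finset.univ.filter IsPairing := by
    ext M
    simp [mem_pairings]
  rw [hpair] at h
  rw [contractionMap_apply]
  refine Eq.trans ?_ (h.trans ?_)
  · rw [wick]
    congr 1
    refine Finset.prod_congr rfl fun i _ => ?_
    congr 1
    refine Finset.prod_bij (fun a _ => ⟨i, a⟩) (by simp) (by simp) ?_ (by simp)
    rintro ⟨j, a⟩ hj
    simp only [Finset.mem_filter, Finset.mem_univ, true_and] at hj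
    subst hj
    exact ⟨a, Finset.mem_univ a, rfl⟩
  · refine Finset.sum_congr (by ext; simp) fun M _ => ?_
    rw [pairingTerm]
    congr 1

end Pairings

/-! ### Integration by parts against functions smooth on the disk. -/

section WeakDerivatives

open MeasureTheory

/-- The product of a smooth function on `𝔻` and a test function. -/
noncomputable def smoothMul (u : ℂ → ℝ) (hu : ContDiffOn ℝ ∞ u disk) (k : TestFun) : TestFun where
  toFun x := u x * k x
  contDiff' := by
    rw [contDiff_iff_contDiffAt]
    intro x
    by_cases hx : x ∈ tsupport k
    · exact (hu.contDiffAt (disk.isOpen.mem_nhds (k.tsupport_subset hx))).mul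
        k.contDiff.contDiffAt
    · refine (contDiffAt_const (c := (0 : ℝ))).congr_of_eventuallyEq ?_
      filter_upwards [(isClosed_tsupport k).isOpen_compl.mem_nhds hx] with y hy
      rw [image_eq_zero_of_notMem_tsupport hy, mul_zero]
  hasCompactSupport' := k.hasCompactSupport.mul_left
  tsupport_subset' := (tsupport_mul_subset_right (f := u)).trans k.tsupport_subset

theorem smoothMul_apply (u : ℂ → ℝ) (hu : ContDiffOn ℝ ∞ u disk) (k : TestFun) (x : ℂ) :
    smoothMul u hu k x = u x * k x := rfl

theorem integral_dirDeriv (g : TestFun) (v : ℂ) : ∫ x, dirDeriv v g x = 0 := by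
  have hv : (dirDeriv v g : ℂ → ℝ) = fun x => fderiv ℝ g x v :=
    funext fun x => dirDeriv_apply v g x
  have h := integral_mul_fderiv_eq_neg_fderiv_mul_of_integrable (μ := volume)
    (f := fun _ : ℂ => (1 : ℝ)) (g := g) (v := v)
    (by simp)
    (by simpa [hv] using testFun_integrable (dirDeriv v g))
    (by simpa using testFun_integrable g) (fun _ _ => differentiableAt_const _)
    (fun x _ => (g.contDiff.differentiable (by simp)).differentiableAt)
  simpa [dirDeriv_apply] using h

theorem contDiffOn_fderiv_apply {u : ℂ → ℝ} (hu : ContDiffOn ℝ ∞ u disk) (v : ℂ) :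
    ContDiffOn ℝ ∞ (fun x => fderiv ℝ u x v) disk :=
  (hu.fderiv_of_isOpen disk.isOpen (by simp)).clm_apply contDiffOn_const

/-- No boundary term appears, even if `u` blows up at the unit circle: `u k` is itself a test
function, so its directional derivative integrates to zero. -/
theorem integral_mul_dirDeriv {u : ℂ → ℝ} (hu : ContDiffOn ℝ ∞ u disk) (k : TestFun) (v : ℂ) :
    ∫ x, u x * dirDeriv v k x = -∫ x, fderiv ℝ u x v * k x := by
  have h : ∀ x, dirDeriv v (smoothMul u hu k) x
      = smoothMul u hu (dirDeriv v k) x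
        + smoothMul _ (contDiffOn_fderiv_apply hu v) k x := by
    intro x
    by_cases hx : x ∈ disk
    · rw [dirDeriv_apply, smoothMul_apply, smoothMul_apply, dirDeriv_apply]
      have h1 : DifferentiableAt ℝ u x :=
        (hu.contDiffAt (disk.isOpen.mem_nhds hx)).differentiableAt (by simp)
      have h2 : DifferentiableAt ℝ k x := (k.contDiff.differentiable (by simp)).differentiableAt
      have := (h1.hasFDerivAt.mul h2.hasFDerivAt).fderiv
      rw [show (smoothMul u hu k : ℂ → ℝ) = u * k from rfl, this]
      simp [mul_comm]
    · simp [testFun_eq_zero _ hx]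
  have h0 := integral_dirDeriv (smoothMul u hu k) v
  simp only [h] at h0
  rw [integral_add (testFun_integrable _) (testFun_integrable _)] at h0
  exact eq_neg_of_add_eq_zero_left h0

theorem integral_mul_lap {u : ℂ → ℝ} (hu : ContDiffOn ℝ ∞ u disk) (h : TestFun) :
    ∫ x, u x * lap h x = -∫ x, (fderiv ℝ (fun y => fderiv ℝ u y 1) x 1 +
      fderiv ℝ (fun y => fderiv ℝ u y Complex.I) x Complex.I) * h x := by
  have key : ∀ v, ∫ x, u x * dirDeriv v (dirDeriv v h) x
      = ∫ x, fderiv ℝ (fun y => fderiv ℝ u y v) x v * h x := by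
    intro v
    rw [integral_mul_dirDeriv hu, integral_mul_dirDeriv (contDiffOn_fderiv_apply hu v), neg_neg]
  have hl : ∀ x, u x * lap h x = -(u x * dirDeriv 1 (dirDeriv 1 h) x +
      u x * dirDeriv Complex.I (dirDeriv Complex.I h) x) := fun x => by
    rw [← mul_add, ← mul_neg]; rfl
  have hi : ∀ k : TestFun, Integrable fun x => u x * k x := fun k =>
    testFun_integrable (smoothMul u hu k)
  have hi' : ∀ v, Integrable fun x => fderiv ℝ (fun y => fderiv ℝ u y v) x v * h x := fun v =>
    testFun_integrable
      (smoothMul _ (contDiffOn_fderiv_apply (contDiffOn_fderiv_apply hu v) v) h)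
  simp only [hl, add_mul]
  rw [integral_neg, integral_add (hi _) (hi _), integral_add (hi' _) (hi' _), key, key]

open InnerProductSpace in
/-- Harmonic functions are weakly harmonic. -/
theorem integral_mul_lap_eq_zero {u : ℂ → ℝ} (hu : ContDiffOn ℝ ∞ u disk)
    (hh : ∀ x ∈ disk, HarmonicAt u x) (h : TestFun) : ∫ x, u x * lap h x = 0 := by
  rw [integral_mul_lap hu, neg_eq_zero]
  refine (integral_congr_ae (Filter.Eventually.of_forall fun x => ?_)).trans
    (integral_zero _ _)
  by_cases hx : x ∈ disk
  · have h1 := (hh x hx).2.eq_of_nhds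
    have hd : DifferentiableAt ℝ (fderiv ℝ u) x :=
      ((hu.fderiv_of_isOpen disk.isOpen (m := ∞) (by simp)).contDiffAt
        (disk.isOpen.mem_nhds hx)).differentiableAt (by simp)
    have h2 : ∀ v, fderiv ℝ (fun y => fderiv ℝ u y v) x v = fderiv ℝ (fderiv ℝ u) x v v := by
      intro v
      rw [(hd.hasFDerivAt.clm_apply (hasFDerivAt_const v x)).fderiv]
      simp
    rw [laplacian_eq_iteratedFDeriv_complexPlane] at h1
    simp only [iteratedFDeriv_two_apply, Matrix.cons_val_zero, Matrix.cons_val_one] at h1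
    simp only [h2]
    rw [h1]
    simp
  · simp [testFun_eq_zero _ hx]

end WeakDerivatives

/-! ### The logarithm as a fundamental solution of the Laplacian. -/

section Logarithm

open MeasureTheory Set

/-- In polar coordinates the integrand becomes `r log r`, which is continuous up to `r = 0`. -/
theorem locallyIntegrable_log_norm : LocallyIntegrable fun x : ℂ => Real.log ‖x‖ := by
  have key : ∀ R : ℝ, IntegrableOn (fun x : ℂ => Real.log ‖x‖) (Metric.closedBall 0 R) := by
    intro R
    rw [← integrable_indicator_iff Metric.isClosed_closedBall.measurableSet]
    have : (Metric.closedBall (0 : ℂ) R).indicator (fun x => Real.log ‖x‖)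
        = fun x => (Iic R).indicator Real.log ‖x‖ := by
      ext x
      simp [indicator]
    rw [this, integrable_fun_norm_addHaar]
    have h2 : (fun y : ℝ => y ^ (Module.finrank ℝ ℂ - 1) • (Iic R).indicator Real.log y)
        = (Iic R).indicator fun y => y * Real.log y := by
      ext y
      simp [indicator, Complex.finrank_real_complex]
    rw [h2, IntegrableOn, integrable_indicator_iff measurableSet_Iic, IntegrableOn,
      Measure.restrict_restrict measurableSet_Iic]
    exact (Real.continuous_mul_log.continuousOn.integrableOn_compact
      (isCompact_Icc (a := 0) (b := R))).mono_set fun y hy => ⟨le_of_lt hy.2, hy.1⟩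
  intro x
  exact ⟨_, Metric.closedBall_mem_nhds_of_mem (x := x) (c := 0) (ε := ‖x‖ + 1) (by simp), key _⟩

theorem locallyIntegrable_log_norm_sub (x : ℂ) :
    LocallyIntegrable fun y : ℂ => Real.log ‖y - x‖ := by
  intro y
  obtain ⟨s, hs, hi⟩ := locallyIntegrable_log_norm (y - x)
  refine ⟨(fun z => z - x) ⁻¹' s, (continuous_id.sub continuous_const).continuousAt hs, ?_⟩
  exact ((measurePreserving_sub_right volume x).integrableOn_comp_preimage
    (MeasurableEquiv.subRight x).measurableEmbedding).2 hi

/-- The integrand is `(2π)⁻¹` times the Laplacian `∂₁² + ∂₂²` of `½ log(|x|² + 1)`, and serves as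
the profile of an approximate identity. The radial integral has the primitive `-½ (1 + r²)⁻¹`. -/
theorem integral_inv_one_add_norm_sq :
    ∫ x : ℂ, Real.pi⁻¹ * ((1 + ‖x‖ ^ 2) ^ 2)⁻¹ = 1 := by
  rw [integral_const_mul,
    integral_fun_norm_addHaar volume (fun r : ℝ => ((1 + r ^ 2) ^ 2)⁻¹)]
  have h1 : ∫ r in Ioi (0 : ℝ), r * ((1 + r ^ 2) ^ 2)⁻¹ = 0 - (-(1 / 2 : ℝ)) := by
    have hd : ∀ r ∈ Ici (0 : ℝ), HasDerivAt (fun r : ℝ => -(1 / 2) * (1 + r ^ 2)⁻¹)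
        (r * ((1 + r ^ 2) ^ 2)⁻¹) r := by
      intro r _
      have h0 : (1 + r ^ 2 : ℝ) ≠ 0 := by positivity
      have := (((hasDerivAt_pow 2 r).const_add 1).inv h0).const_mul (-(1 / 2 : ℝ))
      refine this.congr_deriv ?_
      field_simp
      simp
    have hlim : Filter.Tendsto (fun r : ℝ => -(1 / 2) * (1 + r ^ 2)⁻¹) Filter.atTop (𝓝 0) := by
      have : Filter.Tendsto (fun r : ℝ => (1 + r ^ 2)) Filter.atTop Filter.atTop :=
        Filter.tendsto_atTop_add_const_left _ _ (Filter.tendsto_pow_atTop (by simp))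
      simpa using this.inv_tendsto_atTop.const_mul (-(1 / 2 : ℝ))
    rw [integral_Ioi_of_hasDerivAt_of_nonneg' hd ?_ hlim]
    · norm_num
    · intro r hr
      have : (0 : ℝ) < r := hr
      positivity
  simp only [Complex.finrank_real_complex, Nat.add_one_sub_one, pow_one, smul_eq_mul, h1]
  simp [Measure.real, Complex.volume_ball]
  field_simp

/-- The smooth approximation `½ log(|y - x|² + ε)` of `log |y - x|`. -/
noncomputable def regLog (ε : ℝ) (x y : ℂ) : ℝ := 1 / 2 * Real.log (‖y - x‖ ^ 2 + ε)

theorem hasFDerivAt_norm_sub_sq (x y : ℂ) (ε : ℝ) :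
    HasFDerivAt (fun y : ℂ => ‖y - x‖ ^ 2 + ε) (2 • innerSL ℝ (y - x)) y := by
  simpa using (((hasFDerivAt_id y).sub_const x).norm_sq).add_const ε

theorem contDiff_regLog {ε : ℝ} (hε : 0 < ε) (x : ℂ) : ContDiff ℝ ∞ (regLog ε x) := by
  unfold regLog
  refine contDiff_const.mul (ContDiff.log ?_ fun y => by positivity)
  exact ((contDiff_id.sub contDiff_const).norm_sq ℝ).add contDiff_const

theorem fderiv_regLog {ε : ℝ} (hε : 0 < ε) (x v : ℂ) :
    (fun y => fderiv ℝ (regLog ε x) y v) = fun y => inner ℝ (y - x) v / (‖y - x‖ ^ 2 + ε) := by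
  ext y
  have h0 : ‖y - x‖ ^ 2 + ε ≠ 0 := by positivity
  have := ((hasFDerivAt_norm_sub_sq x y ε).log h0).const_mul (1 / 2 : ℝ)
  rw [HasFDerivAt.fderiv (f := regLog ε x) this]
  simp
  field_simp
  ring

theorem fderiv_fderiv_regLog {ε : ℝ} (hε : 0 < ε) (x v y : ℂ) :
    fderiv ℝ (fun y => fderiv ℝ (regLog ε x) y v) y v
      = ‖v‖ ^ 2 / (‖y - x‖ ^ 2 + ε)
        - 2 * (inner ℝ (y - x) v) ^ 2 / (‖y - x‖ ^ 2 + ε) ^ 2 := by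
  have h0 : ‖y - x‖ ^ 2 + ε ≠ 0 := by positivity
  rw [fderiv_regLog hε]
  have h1 : HasFDerivAt (fun y : ℂ => inner ℝ (y - x) v) (innerSL ℝ v) y := by
    have := (innerSL ℝ v).hasFDerivAt.comp y ((hasFDerivAt_id y).sub_const x)
    refine this.congr_of_eventuallyEq (Filter.Eventually.of_forall fun z => ?_)
    simp [real_inner_comm]
  have h2 := h1.mul ((hasDerivAt_inv h0).comp_hasFDerivAt y (hasFDerivAt_norm_sub_sq x y ε))
  rw [HasFDerivAt.fderiv (f := fun y => inner ℝ (y - x) v / (‖y - x‖ ^ 2 + ε)) h2]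
  simp only [Function.comp_apply, _root_.add_apply, _root_.smul_apply, innerSL_apply_apply,
    smul_eq_mul, real_inner_self_eq_norm_sq, nsmul_eq_mul, Nat.cast_ofNat]
  field_simp
  ring

/-- Summed over the orthonormal directions `1` and `I`, the second derivatives give `2 / (r² + ε) -
2 r² / (r² + ε)²`. The result is nonnegative and concentrates at `x` as `ε` tends to zero. -/
theorem laplacian_regLog {ε : ℝ} (hε : 0 < ε) (x y : ℂ) :
    fderiv ℝ (fun y => fderiv ℝ (regLog ε x) y 1) y 1
      + fderiv ℝ (fun y => fderiv ℝ (regLog ε x) y Complex.I) y Complex.I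
      = 2 * ε / (‖y - x‖ ^ 2 + ε) ^ 2 := by
  have h0 : ‖y - x‖ ^ 2 + ε ≠ 0 := by positivity
  have h1 : (inner ℝ (y - x) 1) ^ 2 + (inner ℝ (y - x) Complex.I) ^ 2 = ‖y - x‖ ^ 2 := by
    rw [← Complex.normSq_eq_norm_sq, Complex.normSq_apply, Complex.inner, Complex.inner]
    simp
    ring
  rw [fderiv_fderiv_regLog hε, fderiv_fderiv_regLog hε]
  simp only [norm_one, Complex.norm_I]
  field_simp
  linarith

/-- The choice `ε = c⁻²` matches the dilations `c² φ(c y)` of an approximate identity on the plane.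
Convergence is dominated. -/
theorem tendsto_integral_regLog {x : ℂ} (hx : x ∈ disk) (k : TestFun) :
    Filter.Tendsto (fun c : ℝ => ∫ y, regLog ((c ^ 2)⁻¹) x y * k y) Filter.atTop
      (𝓝 (∫ y, Real.log ‖y - x‖ * k y)) := by
  have hlog : Integrable fun y => Real.log ‖y - x‖ * k y :=
    (locallyIntegrable_log_norm_sub x).integrable_smul_right_of_hasCompactSupport
      k.continuous k.hasCompactSupport
  have hε : Filter.Tendsto (fun c : ℝ => (c ^ 2)⁻¹) Filter.atTop (𝓝 0) :=
    (Filter.tendsto_pow_atTop (by simp)).inv_tendsto_atTop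
  have hne : ∀ᵐ y : ℂ, y ≠ x := by simp [ae_iff]
  refine tendsto_integral_filter_of_dominated_convergence
    -- The regularization lies above `log |y - x|`. On the disk `|y - x| ≤ 2`, and `ε ≤ 1` once `c ≥
    -- 1`, so it is at most `½ log(2² + 1)`.
    (fun y => ‖Real.log ‖y - x‖ * k y‖ + (1 / 2 * Real.log 5) * ‖k y‖) ?_ ?_
    (hlog.norm.add ((testFun_integrable k).norm.const_mul _)) ?_
  · filter_upwards [Filter.eventually_gt_atTop 0] with c hc
    exact (((contDiff_regLog (by positivity) x).continuous).mul k.continuous).aestronglyMeasurable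
  · filter_upwards [Filter.eventually_ge_atTop 1] with c hc
    filter_upwards [hne] with y hy
    by_cases hyd : y ∈ disk
    swap
    · simp [testFun_eq_zero k hyd]
    rw [norm_mul, norm_mul, ← add_mul]
    gcongr
    have hx1 : ‖x‖ < 1 := by simpa [disk] using hx
    have hy1 : ‖y‖ < 1 := by simpa [disk] using hyd
    have hpos : 0 < ‖y - x‖ := norm_pos_iff.2 (sub_ne_zero.2 hy)
    have hlt : ‖y - x‖ ≤ 2 := (norm_sub_le y x).trans (by linarith)
    have hc0 : 0 < (c ^ 2)⁻¹ := by positivity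
    have hc1 : (c ^ 2)⁻¹ ≤ 1 := inv_le_one_of_one_le₀ (one_le_pow₀ hc)
    have h1 : Real.log ‖y - x‖ ≤ regLog ((c ^ 2)⁻¹) x y := by
      have := Real.log_le_log (by positivity) (le_add_of_nonneg_right hc0.le :
        ‖y - x‖ ^ 2 ≤ ‖y - x‖ ^ 2 + (c ^ 2)⁻¹)
      rw [Real.log_pow] at this
      unfold regLog
      push_cast at this
      linarith
    have h2 : regLog ((c ^ 2)⁻¹) x y ≤ 1 / 2 * Real.log 5 := by
      unfold regLog
      gcongr
      nlinarith
    have h3 : 0 ≤ Real.log 5 := Real.log_nonneg (by norm_num)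
    rw [Real.norm_eq_abs, Real.norm_eq_abs, abs_le]
    constructor
    · linarith [neg_abs_le (Real.log ‖y - x‖)]
    · linarith [abs_nonneg (Real.log ‖y - x‖)]
  · filter_upwards [hne] with y hy
    have hpos : 0 < ‖y - x‖ := norm_pos_iff.2 (sub_ne_zero.2 hy)
    refine Filter.Tendsto.mul_const _ ?_
    have h1 : Filter.Tendsto (fun c : ℝ => ‖y - x‖ ^ 2 + (c ^ 2)⁻¹) Filter.atTop
        (𝓝 (‖y - x‖ ^ 2)) := by
      simpa using hε.const_add (‖y - x‖ ^ 2)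
    have h2 := ((Real.continuousAt_log (by positivity)).tendsto.comp h1).const_mul (1 / 2 : ℝ)
    rw [Real.log_pow, show 1 / 2 * (((2 : ℕ) : ℝ) * Real.log ‖y - x‖) = Real.log ‖y - x‖ by
      push_cast; ring] at h2
    exact h2

/-- `log |y - x|` is `-2π` times the fundamental solution of `Δ`. -/
theorem integral_log_mul_lap {x : ℂ} (hx : x ∈ disk) (h : TestFun) :
    ∫ y, Real.log ‖y - x‖ * lap h y = -(2 * Real.pi * h x) := by
  -- Two limits of the same integrals are compared: dominated convergence gives the left side, while
  -- moving the Laplacian onto the regularized logarithm gives `-2π` times an approximate identity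
  -- applied to `h`.
  refine tendsto_nhds_unique (tendsto_integral_regLog hx (lap h)) ?_
  have hpeak := tendsto_integral_comp_smul_smul_of_integrable' (μ := (volume : Measure ℂ))
    (φ := fun x : ℂ => Real.pi⁻¹ * ((1 + ‖x‖ ^ 2) ^ 2)⁻¹) (fun x => by positivity)
    integral_inv_one_add_norm_sq (by
      have h1 : Filter.Tendsto (fun r : ℝ => (r ^ 2)⁻¹) Filter.atTop (𝓝 0) :=
        (Filter.tendsto_pow_atTop (by simp)).inv_tendsto_atTop
      have h2 := (h1.comp (tendsto_norm_cobounded_atTop (E := ℂ))).const_mul Real.pi⁻¹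
      rw [mul_zero] at h2
      refine tendsto_of_tendsto_of_tendsto_of_le_of_le' tendsto_const_nhds h2
        (Filter.Eventually.of_forall fun x => by positivity) ?_
      filter_upwards [tendsto_norm_cobounded_atTop.eventually (Filter.eventually_gt_atTop 0)]
        with x hx
      simp only [Complex.finrank_real_complex, Function.comp_apply]
      rw [mul_left_comm]
      gcongr
      rw [← div_eq_mul_inv, div_le_iff₀ (by positivity), inv_mul_eq_div, le_div_iff₀ (by positivity)]
      nlinarith [sq_nonneg (‖x‖ ^ 2)]) (testFun_integrable h)
    (h.continuous.continuousAt (x := x))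
  have h2 := (hpeak.const_mul (2 * Real.pi)).neg
  refine h2.congr' ?_
  filter_upwards [Filter.eventually_gt_atTop 0] with c hc
  have hc0 : 0 < (c ^ 2)⁻¹ := by positivity
  rw [integral_mul_lap (contDiff_regLog hc0 x).contDiffOn, ← integral_const_mul]
  congr 1
  -- With `r = |y - x|` the identity is `2 c² / (1 + c² r²)² = 2 c⁻² / (r² + c⁻²)²`.
  refine integral_congr_ae (Filter.Eventually.of_forall fun y => ?_)
  simp only [laplacian_regLog hc0, Complex.finrank_real_complex, smul_eq_mul, norm_smul,
    Real.norm_eq_abs, abs_of_pos hc, norm_sub_rev x y]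
  have hpi := Real.pi_pos
  field_simp
  ring

end Logarithm

/-! ### Bilinear forms of kernels by Fubini, and the Green kernel `G₂`. -/

section KernelForms

open MeasureTheory

theorem measurableSet_disk2 : MeasurableSet disk2 := (disk.isOpen.prod disk.isOpen).measurableSet

/-- Kernels are meaningful only off the diagonal: since `Real.log 0 = 0`, the value `cocycle φ z z`
is `-log |φ'(z)|` rather than the limit of `H_φ`. The diagonal being null, such values do not affect
any form. -/
theorem ae_fst_ne_snd : ∀ᵐ p : ℂ × ℂ, p.1 ≠ p.2 := by
  have hm : MeasurableSet {p : ℂ × ℂ | p.1 = p.2} :=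
    (isClosed_eq continuous_fst continuous_snd).measurableSet
  rw [ae_iff]
  simp only [not_not]
  rw [Measure.volume_eq_prod, Measure.measure_prod_null hm]
  refine Filter.Eventually.of_forall fun x => ?_
  have : Prod.mk x ⁻¹' {p : ℂ × ℂ | p.1 = p.2} = {x} := by
    ext y
    simp [eq_comm]
  simp [this]

theorem ae_restrict_disk2_eq {P Q : ℂ → ℂ → ℝ}
    (h : ∀ z ∈ disk, ∀ w ∈ disk, z ≠ w → P z w = Q z w) :
    (fun p : ℂ × ℂ => P p.1 p.2) =ᵐ[volume.restrict disk2] fun p => Q p.1 p.2 := by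
  filter_upwards [ae_restrict_mem measurableSet_disk2, ae_restrict_of_ae ae_fst_ne_snd] with p hp hne
  exact h _ hp.1 _ hp.2 hne

theorem LocIntKernel.congr {P Q : ℂ → ℂ → ℝ} (hP : LocIntKernel P)
    (h : ∀ z ∈ disk, ∀ w ∈ disk, z ≠ w → P z w = Q z w) : LocIntKernel Q :=
  LocallyIntegrableOn.congr (ae_restrict_disk2_eq h) hP

theorem kernelForm_congr {P Q : ℂ → ℂ → ℝ} (hP : LocIntKernel P) (hQ : LocIntKernel Q)
    (h : ∀ z ∈ disk, ∀ w ∈ disk, z ≠ w → P z w = Q z w) : kernelForm P hP = kernelForm Q hQ := by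
  ext f g
  rw [kernelForm_apply, kernelForm_apply]
  refine integral_congr_ae ?_
  filter_upwards [ae_restrict_disk2_eq h] with p hp
  rw [hp]

theorem LocIntKernel.sub_mul {P Q : ℂ → ℂ → ℝ} (hP : LocIntKernel P) (hQ : LocIntKernel Q)
    (c : ℝ) : LocIntKernel fun x y => P x y - c * Q x y :=
  LocallyIntegrableOn.sub hP (LocallyIntegrableOn.smul hQ c)

theorem kernelForm_sub_mul {P Q : ℂ → ℂ → ℝ} (hP : LocIntKernel P) (hQ : LocIntKernel Q)
    (c : ℝ) (f g : TestFun) : kernelForm _ (hP.sub_mul hQ c) f g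
      = kernelForm P hP f g - c * kernelForm Q hQ f g := by
  rw [kernelForm_apply, kernelForm_apply, kernelForm_apply, ← integral_const_mul,
    ← integral_sub (hP.integrableOn f g) ((hQ.integrableOn f g).const_mul c)]
  simp only [sub_mul, mul_assoc]

theorem setIntegral_disk_mul (P : ℂ → ℝ) (g : TestFun) (c : ℝ) :
    ∫ y in disk, P y * (c * g y) = c * ∫ y, P y * g y := by
  rw [setIntegral_eq_integral_of_forall_compl_eq_zero
    fun y hy => by rw [testFun_eq_zero g hy, mul_zero, mul_zero], ← integral_const_mul]
  simp only [mul_left_comm]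

theorem integrable_mul_integral_kernel {P : ℂ → ℂ → ℝ} (hP : LocIntKernel P) (f g : TestFun) :
    Integrable fun x => f x * ∫ y, P x y * g y := by
  have h := hP.integrableOn f g
  rw [disk2, IntegrableOn, Measure.volume_eq_prod, ← Measure.prod_restrict] at h
  have h2 := h.integral_prod_left
  simp only [setIntegral_disk_mul] at h2
  refine IntegrableOn.integrable_of_forall_notMem_eq_zero h2 fun x hx => ?_
  rw [testFun_eq_zero f hx, zero_mul]

/-- Fubini reduces statements about distributions on the square to statements about one variable
with `x` fixed in the disk. -/
theorem kernelForm_eq_integral_integral {P : ℂ → ℂ → ℝ} (hP : LocIntKernel P) (f g : TestFun) :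
    kernelForm P hP f g = ∫ x, f x * ∫ y, P x y * g y := by
  have h := hP.integrableOn f g
  rw [disk2, Measure.volume_eq_prod] at h
  rw [kernelForm_apply, disk2, Measure.volume_eq_prod, setIntegral_prod _ h]
  simp only [setIntegral_disk_mul]
  refine setIntegral_eq_integral_of_forall_compl_eq_zero fun x hx => ?_
  rw [testFun_eq_zero f hx, zero_mul]

/-- Differences of points of the disk have modulus below `2`. On the square the kernel therefore
agrees with the integrand of the convolution of two integrable functions: the indicator of the disk
and the logarithm cut off to the ball of radius `2`. -/
theorem locIntKernel_log : LocIntKernel fun x y => Real.log ‖x - y‖ := by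
  have h1 : Integrable ((Metric.ball (0 : ℂ) 2).indicator fun x => Real.log ‖x‖) := by
    rw [integrable_indicator_iff Metric.isOpen_ball.measurableSet]
    exact (locallyIntegrable_log_norm.integrableOn_isCompact
      (isCompact_closedBall (0 : ℂ) 2)).mono_set Metric.ball_subset_closedBall
  have h2 : Integrable ((disk : Set ℂ).indicator fun _ => (1 : ℝ)) := by
    rw [integrable_indicator_iff disk.isOpen.measurableSet]
    refine integrableOn_const ?_
    simp [disk, Complex.volume_ball]
  have h3 := h2.convolution_integrand (ContinuousLinearMap.mul ℝ ℝ) h1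
  rw [← Measure.volume_eq_prod] at h3
  have h4 : IntegrableOn (fun p : ℂ × ℂ => Real.log ‖p.1 - p.2‖) disk2 := by
    refine (h3.integrableOn (s := disk2)).congr_fun (fun p hp => ?_) measurableSet_disk2
    have hp1 : ‖p.1‖ < 1 := by simpa [disk] using hp.1
    have hp2 : ‖p.2‖ < 1 := by simpa [disk] using hp.2
    have h5 : p.1 - p.2 ∈ Metric.ball (0 : ℂ) 2 := by
      rw [mem_ball_zero_iff]
      linarith [norm_sub_le p.1 p.2]
    simp [Set.indicator_of_mem h5, Set.indicator_of_mem hp.2]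
  exact h4.locallyIntegrableOn

theorem locIntKernel_green2 : LocIntKernel green2 :=
  LocallyIntegrableOn.smul locIntKernel_log (-(2 * Real.pi)⁻¹)

theorem isGreenKernel_green2 : IsGreenKernel green2 where
  symm x _ y _ := by rw [green2, green2, norm_sub_rev]
  locInt := locIntKernel_green2
  green f h := by
    rw [kernelForm_eq_integral_integral, l2Form_apply]
    refine integral_congr_ae (Filter.Eventually.of_forall fun x => ?_)
    by_cases hx : x ∈ disk
    · have h1 := integral_log_mul_lap hx h
      simp only [green2, mul_assoc, integral_const_mul, norm_sub_rev x, h1]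
      have := Real.pi_pos
      field_simp
    · simp only [testFun_eq_zero f hx, zero_mul]

end KernelForms

/-! ### The cocycle `H_φ`: extension over the diagonal, harmonicity, and pull-back of `G₂`. -/

section Cocycle

open MeasureTheory InnerProductSpace

variable (φ : ConfEmb)

theorem ConfEmb.differentiableOn_dslope {z : ℂ} (hz : z ∈ disk) :
    DifferentiableOn ℂ (dslope φ.toFun z) disk :=
  (Complex.differentiableOn_dslope (disk.isOpen.mem_nhds hz)).2 φ.holo

/-- Injectivity of `φ` excludes zeros off the diagonal, and `φ' ≠ 0` excludes them on it. So the
logarithm of the modulus of the divided difference is harmonic in the second variable. -/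
theorem ConfEmb.dslope_ne_zero {z w : ℂ} (hz : z ∈ disk) (hw : w ∈ disk) :
    dslope φ.toFun z w ≠ 0 := by
  rcases eq_or_ne w z with rfl | h
  · rw [dslope_same]
    exact φ.deriv_ne_zero _ hz
  · rw [dslope_of_ne _ h, slope_def_field]
    exact div_ne_zero (sub_ne_zero.2 fun h' => h (φ.injOn hw hz h')) (sub_ne_zero.2 h)

theorem ConfEmb.differentiableOn_deriv : DifferentiableOn ℂ (deriv φ.toFun) disk :=
  φ.holo.deriv disk.isOpen

/-- Joint continuity at a diagonal point needs both arguments to move, which is exactly what strict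
differentiability of `φ` controls. -/
theorem ConfEmb.continuousOn_dslope :
    ContinuousOn (fun p : ℂ × ℂ => dslope φ.toFun p.1 p.2) disk2 := by
  rintro ⟨z, w⟩ ⟨hz, hw⟩
  refine ContinuousAt.continuousWithinAt ?_
  simp only at hz hw
  rcases eq_or_ne w z with rfl | hne
  · rw [ContinuousAt, Metric.tendsto_nhds]
    intro ε hε
    -- `h1` treats nearby pairs with distinct entries, `h2` nearby pairs on the diagonal, where the
    -- divided difference is the derivative.
    have h1 := ((φ.hasStrictDerivAt hz).hasStrictFDerivAt.isLittleO.bound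
      (half_pos hε))
    have h2 : ∀ᶠ p : ℂ × ℂ in 𝓝 (w, w), dist (deriv φ.toFun p.1) (deriv φ.toFun w) < ε :=
      (((φ.differentiableOn_deriv.continuousOn.continuousAt
        (disk.isOpen.mem_nhds hz)).tendsto.comp continuous_fst.continuousAt.tendsto).eventually
        (Metric.ball_mem_nhds _ hε))
    filter_upwards [h1, h2] with p hp1 hp2
    rw [dslope_same]
    rcases eq_or_ne p.2 p.1 with h | h
    · rw [h, dslope_same]
      exact hp2
    · have hpos : 0 < ‖p.1 - p.2‖ := norm_pos_iff.2 (sub_ne_zero.2 h.symm)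
      rw [dslope_of_ne _ h, slope_comm, slope_def_field, dist_eq_norm]
      have h3 : (φ.toFun p.1 - φ.toFun p.2) / (p.1 - p.2) - deriv φ.toFun w
          = (φ.toFun p.1 - φ.toFun p.2 - (p.1 - p.2) * deriv φ.toFun w) / (p.1 - p.2) := by
        rw [sub_div _ ((p.1 - p.2) * _), mul_div_cancel_left₀ _ (sub_ne_zero.2 h.symm)]
      rw [h3, norm_div, div_lt_iff₀ hpos]
      refine lt_of_le_of_lt (by simpa using hp1) ?_
      exact mul_lt_mul_of_pos_right (half_lt_self hε) hpos
  · have he : (fun p : ℂ × ℂ => dslope φ.toFun p.1 p.2) =ᶠ[𝓝 (z, w)]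
        fun p => (φ.toFun p.2 - φ.toFun p.1) / (p.2 - p.1) := by
      filter_upwards [(isOpen_ne_fun continuous_snd continuous_fst).mem_nhds hne] with p hp
      rw [dslope_of_ne _ hp, slope_def_field]
    refine ContinuousAt.congr ?_ he.symm
    have hcz : ContinuousAt φ.toFun z := φ.holo.continuousOn.continuousAt (disk.isOpen.mem_nhds hz)
    have hcw : ContinuousAt φ.toFun w := φ.holo.continuousOn.continuousAt (disk.isOpen.mem_nhds hw)
    exact ((hcw.comp (f := Prod.snd) continuous_snd.continuousAt).sub
      (hcz.comp (f := Prod.fst) continuous_fst.continuousAt)).div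
      (continuous_snd.sub continuous_fst).continuousAt (sub_ne_zero.2 hne)

/-- The continuous extension of `H_φ` to the diagonal. -/
noncomputable def cocycleExt (z w : ℂ) : ℝ :=
  Real.log ‖dslope φ.toFun z w‖ - 1 / 2 * Real.log ‖deriv φ.toFun z‖
    - 1 / 2 * Real.log ‖deriv φ.toFun w‖

/-- The two halves of `log |φ'|` are chosen for this normalization; it is what makes the converse in
(4) work. -/
theorem cocycleExt_self (z : ℂ) : cocycleExt φ z z = 0 := by
  rw [cocycleExt, dslope_same]
  ring

theorem cocycle_eq_cocycleExt {z : ℂ} (hz : z ∈ disk) {w : ℂ} (hw : w ∈ disk) (h : z ≠ w) :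
    cocycle φ z w = cocycleExt φ z w := by
  have h1 : φ.toFun z - φ.toFun w ≠ 0 := sub_ne_zero.2 fun h' => h (φ.injOn hz hw h')
  rw [cocycle, cocycleExt, dslope_of_ne _ h.symm, slope_comm, slope_def_field, norm_div,
    Real.log_div (norm_ne_zero_iff.2 h1) (norm_ne_zero_iff.2 (sub_ne_zero.2 h))]

theorem cocycle_symm (z w : ℂ) : cocycle φ z w = cocycle φ w z := by
  rw [cocycle, cocycle, norm_sub_rev (φ.toFun z), norm_sub_rev z]
  ring

theorem cocycleExt_symm {z : ℂ} (hz : z ∈ disk) {w : ℂ} (hw : w ∈ disk) :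
    cocycleExt φ z w = cocycleExt φ w z := by
  rcases eq_or_ne z w with rfl | h
  · rfl
  · rw [← cocycle_eq_cocycleExt φ hz hw h, ← cocycle_eq_cocycleExt φ hw hz h.symm, cocycle_symm]

theorem continuousOn_cocycleExt :
    ContinuousOn (fun p : ℂ × ℂ => cocycleExt φ p.1 p.2) disk2 := by
  have hd : ContinuousOn (fun z => Real.log ‖deriv φ.toFun z‖) disk :=
    φ.differentiableOn_deriv.continuousOn.norm.log fun z hz =>
      norm_ne_zero_iff.2 (φ.deriv_ne_zero z hz)
  refine ((φ.continuousOn_dslope.norm.log fun p hp =>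
    norm_ne_zero_iff.2 (φ.dslope_ne_zero hp.1 hp.2)).sub (continuousOn_const.mul
    (hd.comp continuousOn_fst fun p hp => hp.1))).sub (continuousOn_const.mul
    (hd.comp continuousOn_snd fun p hp => hp.2))

theorem locIntKernel_cocycleExt : LocIntKernel (cocycleExt φ) :=
  (continuousOn_cocycleExt φ).locallyIntegrableOn measurableSet_disk2

theorem locIntKernel_cocycle : LocIntKernel (cocycle φ) :=
  (locIntKernel_cocycleExt φ).congr fun _ hz _ hw h => (cocycle_eq_cocycleExt φ hz hw h).symm

theorem contDiffOn_log_norm {F : ℂ → ℂ} (hF : DifferentiableOn ℂ F disk)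
    (h0 : ∀ z ∈ disk, F z ≠ 0) : ContDiffOn ℝ ∞ (fun z => Real.log ‖F z‖) disk := by
  have h1 : ContDiffOn ℝ ∞ F disk := fun z hz =>
    ((hF.contDiffOn disk.isOpen).contDiffWithinAt hz).restrict_scalars ℝ
  exact (h1.norm ℝ h0).log fun z hz => norm_ne_zero_iff.2 (h0 z hz)

theorem integral_log_norm_mul_lap {F : ℂ → ℂ} (hF : DifferentiableOn ℂ F disk)
    (h0 : ∀ z ∈ disk, F z ≠ 0) (h : TestFun) : ∫ x, Real.log ‖F x‖ * lap h x = 0 :=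
  integral_mul_lap_eq_zero (contDiffOn_log_norm hF h0)
    (fun z hz => (hF.analyticAt (disk.isOpen.mem_nhds hz)).harmonicAt_log_norm (h0 z hz)) h

theorem contDiffOn_log_norm_deriv : ContDiffOn ℝ ∞ (fun z => Real.log ‖deriv φ.toFun z‖) disk :=
  contDiffOn_log_norm φ.differentiableOn_deriv φ.deriv_ne_zero

theorem contDiffOn_log_norm_dslope {x : ℂ} (hx : x ∈ disk) :
    ContDiffOn ℝ ∞ (fun z => Real.log ‖dslope φ.toFun x z‖) disk :=
  contDiffOn_log_norm (φ.differentiableOn_dslope hx) fun _ hz => φ.dslope_ne_zero hx hz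

theorem integral_cocycle_mul {x : ℂ} (hx : x ∈ disk) (g : TestFun) :
    ∫ y, cocycle φ x y * g y = ∫ y, cocycleExt φ x y * g y := by
  refine integral_congr_ae ?_
  filter_upwards [show ∀ᵐ y : ℂ, y ≠ x by simp [ae_iff]] with y hy
  by_cases hyd : y ∈ disk
  · simp only [cocycle_eq_cocycleExt φ hx hyd hy.symm]
  · simp only [testFun_eq_zero g hyd, mul_zero]

/-- For fixed `x` each summand is a smooth function of `y` on the disk, so the integral may be
split. When `g` is a Laplacian the three terms vanish separately: the outer two by harmonicity, the
middle one because Laplacians have integral zero. -/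
theorem integral_cocycleExt_mul {x : ℂ} (hx : x ∈ disk) (g : TestFun) :
    ∫ y, cocycleExt φ x y * g y = (∫ y, Real.log ‖dslope φ.toFun x y‖ * g y)
      - 1 / 2 * Real.log ‖deriv φ.toFun x‖ * (∫ y, g y)
      - 1 / 2 * ∫ y, Real.log ‖deriv φ.toFun y‖ * g y := by
  have h1 : Integrable fun y => Real.log ‖dslope φ.toFun x y‖ * g y :=
    testFun_integrable (smoothMul _ (contDiffOn_log_norm_dslope φ hx) g)
  have h2 : Integrable fun y => Real.log ‖deriv φ.toFun y‖ * g y :=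
    testFun_integrable (smoothMul _ (contDiffOn_log_norm_deriv φ) g)
  rw [← integral_const_mul, ← integral_const_mul,
    ← integral_sub h1 ((testFun_integrable g).const_mul _),
    ← integral_sub (h1.sub' ((testFun_integrable g).const_mul _)) (h2.const_mul _)]
  congr 1
  ext y
  rw [cocycleExt]
  ring

theorem isHarmonicKernel_cocycle : IsHarmonicKernel (cocycle φ) where
  symm _ _ _ _ := cocycle_symm φ _ _
  locInt := locIntKernel_cocycle φ
  harmonic f h := by
    rw [kernelForm_eq_integral_integral]
    refine (integral_congr_ae (Filter.Eventually.of_forall fun x => ?_)).trans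
      (integral_zero _ _)
    by_cases hx : x ∈ disk
    · simp only [integral_cocycle_mul φ hx, integral_cocycleExt_mul φ hx,
        integral_log_norm_mul_lap (φ.differentiableOn_dslope hx)
          (fun _ hz => φ.dslope_ne_zero hx hz),
        integral_log_norm_mul_lap φ.differentiableOn_deriv φ.deriv_ne_zero, integral_lap]
      simp
    · simp only [testFun_eq_zero f hx, zero_mul]

/-- The terms in `log |ψ(z) - ψ(w)|` telescope, and the derivative terms add up by the chain rule.
-/
theorem cocycle_comp (φ ψ : ConfEmb) {z : ℂ} (hz : z ∈ disk) {w : ℂ} (hw : w ∈ disk) :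
    cocycle (φ.comp ψ) z w = cocycle ψ z w + cocycle φ (ψ.toFun z) (ψ.toFun w) := by
  have hderiv : ∀ z ∈ disk, Real.log ‖deriv (φ.comp ψ).toFun z‖
      = Real.log ‖deriv φ.toFun (ψ.toFun z)‖ + Real.log ‖deriv ψ.toFun z‖ := by
    intro z hz
    have h := ((φ.hasStrictDerivAt (ψ.mapsTo hz)).hasDerivAt.comp z
      (ψ.hasStrictDerivAt hz).hasDerivAt).deriv
    have h' : deriv (φ.comp ψ).toFun z = deriv φ.toFun (ψ.toFun z) * deriv ψ.toFun z := h
    rw [h', norm_mul, Real.log_mul (norm_ne_zero_iff.2 (φ.deriv_ne_zero _ (ψ.mapsTo hz)))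
      (norm_ne_zero_iff.2 (ψ.deriv_ne_zero _ hz))]
  rw [cocycle, cocycle, cocycle, hderiv z hz, hderiv w hw]
  simp only [ConfEmb.comp]
  ring

/-- `G₂ - (2π)⁻¹ H_φ` is a Green kernel. -/
theorem isGreenKernel_green2_sub_cocycle :
    IsGreenKernel fun x y => green2 x y - (2 * Real.pi)⁻¹ * cocycle φ x y where
  symm x hx y hy := by rw [isGreenKernel_green2.symm x hx y hy, cocycle_symm]
  locInt := locIntKernel_green2.sub_mul (locIntKernel_cocycle φ) _
  green f h := by
    rw [kernelForm_sub_mul locIntKernel_green2 (locIntKernel_cocycle φ), isGreenKernel_green2.green f h,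
      (isHarmonicKernel_cocycle φ).harmonic f h, mul_zero, sub_zero]

theorem integrable_green2_sub_cocycle_mul {x : ℂ} (hx : x ∈ disk) (g : TestFun) :
    Integrable fun y => (green2 x y - (2 * Real.pi)⁻¹ * cocycle φ x y) * g y := by
  have h1 : Integrable fun y => Real.log ‖y - x‖ * g y :=
    (locallyIntegrable_log_norm_sub x).integrable_smul_right_of_hasCompactSupport
      g.continuous g.hasCompactSupport
  have h2 : Integrable fun y => cocycle φ x y * g y := by
    have hs : ContDiffOn ℝ ∞ (cocycleExt φ x) disk :=
      ((contDiffOn_log_norm_dslope φ hx).sub contDiffOn_const).sub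
        (contDiffOn_const.mul (contDiffOn_log_norm_deriv φ))
    refine (testFun_integrable (smoothMul _ hs g)).congr ?_
    filter_upwards [show ∀ᵐ y : ℂ, y ≠ x by simp [ae_iff]] with y hy
    by_cases hyd : y ∈ disk
    · rw [smoothMul_apply, cocycle_eq_cocycleExt φ hx hyd hy.symm]
    · simp only [testFun_eq_zero _ hyd, mul_zero]
  refine ((h1.const_mul (-(2 * Real.pi)⁻¹)).sub (h2.const_mul (2 * Real.pi)⁻¹)).congr
    (Filter.Eventually.of_forall fun y => ?_)
  simp only [Pi.sub_apply, green2, norm_sub_rev x y]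
  ring

/-- On mean zero functions, the push-forward turns `G₂` into `G₂ - (2π)⁻¹ H_φ`. -/
theorem kernelForm_green2_push (f g : TestFun) (hf : ∫ x, f x = 0) (hg : ∫ x, g x = 0) :
    kernelForm green2 locIntKernel_green2 (φ.push f) (φ.push g)
      = kernelForm _ (isGreenKernel_green2_sub_cocycle φ).locInt f g := by
  set P : ℂ → ℂ → ℝ := fun x y => green2 x y - (2 * Real.pi)⁻¹ * cocycle φ x y with hP
  -- The factor is `½ (2π)⁻¹`: this is the contribution of `log |φ'(y)|` to the defect. It does not
  -- depend on `x`, so the mean zero condition on `f` removes it at the end.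
  set C : ℝ := ∫ y, (4 * Real.pi)⁻¹ * Real.log ‖deriv φ.toFun y‖ * g y with hC
  have hint : Integrable fun y => (4 * Real.pi)⁻¹ * Real.log ‖deriv φ.toFun y‖ * g y := by
    refine ((testFun_integrable (smoothMul _ (contDiffOn_log_norm_deriv φ) g)).const_mul
      (4 * Real.pi)⁻¹).congr (Filter.Eventually.of_forall fun y => ?_)
    simp only [smoothMul_apply]
    ring
  -- The contribution of `log |φ'(x)|` is a constant times `∫ g = 0`. The remaining identity between
  -- integrands is purely algebraic and holds even at `y = x` with `log 0 = 0`.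
  have hinner : ∀ x ∈ disk, ∫ y, g y * green2 (φ.toFun x) (φ.toFun y)
      = (∫ y, P x y * g y) - C := by
    intro x hx
    have h1 := integrable_green2_sub_cocycle_mul φ hx g
    have h2 : Integrable fun y => (4 * Real.pi)⁻¹ * Real.log ‖deriv φ.toFun x‖ * g y :=
      (testFun_integrable g).const_mul _
    have h3 : ∫ y, (4 * Real.pi)⁻¹ * Real.log ‖deriv φ.toFun x‖ * g y = 0 := by
      rw [integral_const_mul, hg, mul_zero]
    rw [hC, ← sub_zero (∫ y, P x y * g y), ← h3, ← integral_sub h1 h2,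
      ← integral_sub (h1.sub' h2) hint]
    refine integral_congr_ae (Filter.Eventually.of_forall fun y => ?_)
    simp only [green2, cocycle]
    have := Real.pi_pos
    field_simp
    ring
  rw [kernelForm_eq_integral_integral, kernelForm_eq_integral_integral, φ.integral_push_mul]
  have h4 : ∀ x, f x * ∫ y, green2 (φ.toFun x) y * φ.push g y
      = f x * (∫ y, P x y * g y) - f x * C := by
    intro x
    by_cases hx : x ∈ disk
    · simp only [mul_comm (green2 _ _)]
      rw [φ.integral_push_mul, hinner x hx, mul_sub]
    · simp [testFun_eq_zero f hx]
  simp only [h4]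
  rw [integral_sub (integrable_mul_integral_kernel
    (isGreenKernel_green2_sub_cocycle φ).locInt f g) ((testFun_integrable f).mul_const _),
    integral_mul_const, hf, zero_mul, sub_zero]

end Cocycle

/-! ### Recovering `H_φ` from its form on mean zero functions. -/

section Separation

open MeasureTheory

/-- Approximations of Dirac measures by test functions. -/
theorem exists_testFun_integral_eq_one {z : ℂ} (hz : z ∈ disk) {U : Set ℂ} (hU : U ∈ 𝓝 z) :
    ∃ f : TestFun, (∀ x, 0 ≤ f x) ∧ ∫ x, f x = 1 ∧ ∀ x ∉ U, f x = 0 := by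
  obtain ⟨r, hr, hsub⟩ := Metric.nhds_basis_closedBall.mem_iff.1
    (Filter.inter_mem hU (disk.isOpen.mem_nhds hz))
  let b : ContDiffBump z := ⟨r / 2, r, half_pos hr, half_lt_self hr⟩
  refine ⟨{ toFun := b.normed volume
            contDiff' := b.contDiff_normed
            hasCompactSupport' := b.hasCompactSupport_normed
            tsupport_subset' := ?_ }, b.nonneg_normed, b.integral_normed, fun x hx => ?_⟩
  · rw [b.tsupport_normed_eq]
    exact fun x hx => (hsub hx).2
  · refine image_eq_zero_of_notMem_tsupport fun h => hx ?_
    change x ∈ tsupport (b.normed volume) at h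
    rw [b.tsupport_normed_eq] at h
    exact (hsub h).1

/-- The form is an average of `P` against the probability density `f(x) g(y)`, so it is within `ε`
of `c` if `P` is within `ε` of `c` wherever that density lives. -/
theorem abs_kernelForm_sub_le {P : ℂ → ℂ → ℝ} (hP : LocIntKernel P) {f g : TestFun}
    (hf : ∀ x, 0 ≤ f x) (hg : ∀ x, 0 ≤ g x) (hf1 : ∫ x, f x = 1) (hg1 : ∫ x, g x = 1)
    {U V : Set ℂ} (hfU : ∀ x ∉ U, f x = 0) (hgV : ∀ x ∉ V, g x = 0) {c ε : ℝ}
    (h : ∀ x ∈ U, ∀ y ∈ V, x ∈ disk → y ∈ disk → |P x y - c| ≤ ε) :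
    |kernelForm P hP f g - c| ≤ ε := by
  have hone : ∫ p in disk2, f p.1 * g p.2 = 1 := by
    rw [disk2, Measure.volume_eq_prod, setIntegral_prod_mul,
      setIntegral_eq_integral_of_forall_compl_eq_zero fun x hx => testFun_eq_zero f hx,
      setIntegral_eq_integral_of_forall_compl_eq_zero fun x hx => testFun_eq_zero g hx, hf1, hg1,
      one_mul]
  have hint : IntegrableOn (fun p : ℂ × ℂ => f p.1 * g p.2) disk2 := by
    rw [Measure.volume_eq_prod]
    exact ((testFun_integrable f).mul_prod (testFun_integrable g)).integrableOn
  have h1 : kernelForm P hP f g - c = ∫ p in disk2, (P p.1 p.2 - c) * (f p.1 * g p.2) := by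
    simp only [sub_mul]
    rw [integral_sub (hP.integrableOn f g) (hint.const_mul c), integral_const_mul, hone, mul_one,
      kernelForm_apply]
  rw [h1, ← Real.norm_eq_abs]
  calc ‖∫ p in disk2, (P p.1 p.2 - c) * (f p.1 * g p.2)‖
      ≤ ∫ p in disk2, ε * (f p.1 * g p.2) := by
        refine norm_integral_le_of_norm_le (hint.const_mul ε) ?_
        filter_upwards [ae_restrict_mem measurableSet_disk2] with p hp
        by_cases hU : p.1 ∈ U
        · by_cases hV : p.2 ∈ V
          · rw [norm_mul, Real.norm_of_nonneg (mul_nonneg (hf _) (hg _)), Real.norm_eq_abs]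
            exact mul_le_mul_of_nonneg_right (h _ hU _ hV hp.1 hp.2) (mul_nonneg (hf _) (hg _))
          · simp [hgV _ hV]
        · simp [hfU _ hU]
    _ = ε := by rw [integral_const_mul, hone, mul_one]

theorem exists_nhds_abs_cocycleExt_sub_le (φ : ConfEmb) {z w : ℂ} (hz : z ∈ disk) (hw : w ∈ disk)
    {ε : ℝ} (hε : 0 < ε) : ∃ U ∈ 𝓝 z, ∃ V ∈ 𝓝 w, ∀ x ∈ U, ∀ y ∈ V,
      |cocycleExt φ x y - cocycleExt φ z w| ≤ ε := by
  have hc : ContinuousAt (fun p : ℂ × ℂ => cocycleExt φ p.1 p.2) (z, w) :=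
    (continuousOn_cocycleExt φ).continuousAt
      ((disk.isOpen.prod disk.isOpen).mem_nhds ⟨hz, hw⟩)
  have h1 : ∀ᶠ p : ℂ × ℂ in 𝓝 z ×ˢ 𝓝 w,
      dist (cocycleExt φ p.1 p.2) (cocycleExt φ z w) < ε := by
    rw [← nhds_prod_eq]
    exact Metric.tendsto_nhds.1 hc ε hε
  obtain ⟨U, hU, V, hV, h⟩ := Filter.eventually_prod_iff.1 h1
  refine ⟨{x | U x}, hU, {y | V y}, hV, fun x hx y hy => ?_⟩
  have h2 := h hx hy
  rw [Real.dist_eq] at h2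
  exact h2.le

/-- `∂_{H_φ}` vanishes on mean zero functions only if `H_φ` vanishes. -/
theorem cocycle_eq_zero_of_kernelForm_eq_zero (φ : ConfEmb)
    (h : ∀ f g : TestFun, ∫ x, f x = 0 → ∫ x, g x = 0 →
      kernelForm (cocycle φ) (locIntKernel_cocycle φ) f g = 0) {z w : ℂ} (hz : z ∈ disk)
    (hw : w ∈ disk) (hzw : z ≠ w) : cocycle φ z w = 0 := by
  rw [cocycle_eq_cocycleExt φ hz hw hzw]
  have hform := kernelForm_congr (locIntKernel_cocycle φ) (locIntKernel_cocycleExt φ)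
    fun _ hz _ hw h => cocycle_eq_cocycleExt φ hz hw h
  -- For `f` and `g` concentrated near `z` and `w`, the form on the pair `(f - g, f - g)` is zero.
  -- Its four terms approximate `H(z, z)`, `H(z, w)`, `H(w, z)` and `H(w, w)` up to `ε` each; the
  -- diagonal values vanish and the mixed ones agree.
  have hsmall : ∀ ε > 0, 2 * |cocycleExt φ z w| ≤ 4 * ε := by
    intro ε hε
    obtain ⟨U₁, hU₁, V₁, hV₁, h₁⟩ := exists_nhds_abs_cocycleExt_sub_le φ hz hz hε
    obtain ⟨U₂, hU₂, V₂, hV₂, h₂⟩ := exists_nhds_abs_cocycleExt_sub_le φ hz hw hε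
    obtain ⟨U₃, hU₃, V₃, hV₃, h₃⟩ := exists_nhds_abs_cocycleExt_sub_le φ hw hz hε
    obtain ⟨U₄, hU₄, V₄, hV₄, h₄⟩ := exists_nhds_abs_cocycleExt_sub_le φ hw hw hε
    -- The support of `f` must suit every slot in which `f` occurs: both slots of the first
    -- estimate, the first slot of the second and the second slot of the third. The choice for `g`
    -- is analogous.
    obtain ⟨f, hf, hf1, hfU⟩ := exists_testFun_integral_eq_one hz
      (Filter.inter_mem (Filter.inter_mem hU₁ hV₁) (Filter.inter_mem hU₂ hV₃))
    obtain ⟨g, hg, hg1, hgU⟩ := exists_testFun_integral_eq_one hw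
      (Filter.inter_mem (Filter.inter_mem hU₃ hV₂) (Filter.inter_mem hU₄ hV₄))
    have h0 : ∫ x, (f - g) x = 0 := by
      have : ∫ x, (f x - g x) = 0 := by
        rw [integral_sub (testFun_integrable f) (testFun_integrable g), hf1, hg1, sub_self]
      exact this
    have hzero := h (f - g) (f - g) h0 h0
    rw [hform, LinearMap.map_sub₂, map_sub, map_sub] at hzero
    have e₁ := abs_kernelForm_sub_le (locIntKernel_cocycleExt φ) hf hf hf1 hf1 hfU hfU
      (c := cocycleExt φ z z) (ε := ε) fun x hx y hy _ _ => h₁ x hx.1.1 y hy.1.2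
    have e₂ := abs_kernelForm_sub_le (locIntKernel_cocycleExt φ) hf hg hf1 hg1 hfU hgU
      (c := cocycleExt φ z w) (ε := ε) fun x hx y hy _ _ => h₂ x hx.2.1 y hy.1.2
    have e₃ := abs_kernelForm_sub_le (locIntKernel_cocycleExt φ) hg hf hg1 hf1 hgU hfU
      (c := cocycleExt φ w z) (ε := ε) fun x hx y hy _ _ => h₃ x hx.1.1 y hy.2.2
    have e₄ := abs_kernelForm_sub_le (locIntKernel_cocycleExt φ) hg hg hg1 hg1 hgU hgU
      (c := cocycleExt φ w w) (ε := ε) fun x hx y hy _ _ => h₄ x hx.2.1 y hy.2.2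
    rw [cocycleExt_self, abs_le] at e₁ e₄
    rw [cocycleExt_symm φ hw hz, abs_le] at e₃
    rw [abs_le] at e₂
    rcases abs_cases (cocycleExt φ z w) with ⟨ha, _⟩ | ⟨ha, _⟩ <;> rw [ha] <;> linarith
  by_contra hne
  have hpos := abs_pos.2 hne
  linarith [hsmall (|cocycleExt φ z w| / 4) (by linarith)]

end Separation

/-! ### Functoriality of push-forwards and the operad axioms. -/

theorem ConfEmb.push_id : ConfEmb.id.push = LinearMap.id := by
  ext f x
  by_cases hx : x ∈ disk
  · have h := ConfEmb.id.push_apply f hx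
    simpa [ConfEmb.id, ConfEmb.factor] using h
  · have hx' : x ∉ ConfEmb.id.image := by simpa [ConfEmb.image, ConfEmb.id] using hx
    rw [ConfEmb.id.push_eq_zero f hx', LinearMap.id_apply, testFun_eq_zero f hx]

theorem ConfEmb.factor_comp (φ ψ : ConfEmb) {z : ℂ} (hz : z ∈ disk) :
    (φ.comp ψ).factor z = φ.factor (ψ.toFun z) * ψ.factor z := by
  have h := ((φ.hasStrictDerivAt (ψ.mapsTo hz)).hasDerivAt.comp z
    (ψ.hasStrictDerivAt hz).hasDerivAt).deriv
  have h' : deriv (φ.comp ψ).toFun z = deriv φ.toFun (ψ.toFun z) * deriv ψ.toFun z := h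
  rw [ConfEmb.factor, h', norm_mul, ConfEmb.factor, ConfEmb.factor]

/-- The chain rule makes the conformal factors multiplicative. Injectivity of `φ` ensures that
`φ(y)` lies in the image of `φ ∘ ψ` only if `y` lies in that of `ψ`, so the extensions by zero
agree. -/
theorem ConfEmb.push_comp (φ ψ : ConfEmb) : (φ.comp ψ).push = φ.push ∘ₗ ψ.push := by
  ext f x
  rw [LinearMap.comp_apply]
  by_cases hx : x ∈ φ.image
  · obtain ⟨y, hy, rfl⟩ := hx
    rw [φ.push_apply _ hy]
    by_cases hy' : y ∈ ψ.image
    · obtain ⟨z, hz, rfl⟩ := hy'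
      rw [ψ.push_apply _ hz]
      have h := (φ.comp ψ).push_apply f hz
      rw [φ.factor_comp ψ hz, mul_zpow, mul_assoc] at h
      exact h
    · rw [ψ.push_eq_zero _ hy', mul_zero]
      refine (φ.comp ψ).push_eq_zero _ ?_
      rintro ⟨z, hz, h⟩
      exact hy' ⟨z, hz, φ.injOn (ψ.mapsTo hz) hy h⟩
  · rw [φ.push_eq_zero _ hx, (φ.comp ψ).push_eq_zero _ fun h => hx (φ.image_comp_subset ψ h)]

namespace TestSpace

variable (A : TestSpace)

theorem push_id : A.push ConfEmb.id = LinearMap.id := by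
  ext1 f
  exact Subtype.ext (congr($(ConfEmb.push_id) f.1))

theorem push_comp (φ ψ : ConfEmb) : A.push (φ.comp ψ) = A.push φ ∘ₗ A.push ψ := by
  ext1 f
  exact Subtype.ext (congr($(ConfEmb.push_comp φ ψ) f.1))

theorem form_symm {P : ℂ → ℂ → ℝ} (hs : ∀ x ∈ disk, ∀ y ∈ disk, P x y = P y x)
    (hP : LocIntKernel P) (f g : A.carrier) : A.form P hP f g = A.form P hP g f :=
  kernelForm_symm hs hP f.1 g.1

variable {P : ℂ → ℂ → ℝ} (hP : IsGreenKernel P)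

/-- Since `Ψ_P` is onto, every tuple of classical observables comes from representatives in `P(A)`;
together with `rho_Psi_mk` this turns identities for `ρ^cl` into identities between products of
push-forwards. -/
theorem exists_Psi_mk_eq {ι : Type} (F : ι → A.Classical) :
    ∃ x : ι → PolyAlg A.carrier, F = fun i => A.Psi hP (Submodule.Quotient.mk (x i)) := by
  have h : ∀ i, ∃ x, F i = A.Psi hP (Submodule.Quotient.mk x) := by
    intro i
    obtain ⟨q, hq⟩ := (A.Psi hP).surjective (F i)
    obtain ⟨x, rfl⟩ := Submodule.Quotient.mk_surjective _ q
    exact ⟨x, hq.symm⟩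
  choose x hx using h
  exact ⟨x, funext hx⟩

theorem rho_Psi_mk {ι : Type} [Fintype ι] (φ : Config ι) (x : ι → PolyAlg A.carrier) :
    A.rho hP φ (fun i => A.Psi hP (Submodule.Quotient.mk (x i)))
      = A.Psi hP (Submodule.Quotient.mk (∏ i, polyMap (A.push (φ.emb i)) (x i))) := by
  rw [← quantumMap_mk]
  simp [rho]

/-- On representatives the operations are products of algebra maps, so composition reduces to
functoriality of `W`, and equivariance to reindexing a commutative product. The choice of Green
kernel plays no role. -/
theorem isOperadAlgebra_rho :
    IsOperadAlgebra (fun (ι : Type) (_ : Fintype ι) (φ : Config ι) => A.rho hP φ) where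
  unit F := by
    obtain ⟨x, rfl⟩ := A.exists_Psi_mk_eq hP F
    simp only [rho_Psi_mk, Config.single, push_id, polyMap_id]
    simp
  circ ι κ _ _ φ i ψ F := by
    classical
    obtain ⟨x, rfl⟩ := A.exists_Psi_mk_eq hP F
    set y : ι → PolyAlg A.carrier := fun j => if h : j = i then
      ∏ k, polyMap (A.push (ψ.emb k)) (x (Sum.inr k)) else x (Sum.inl ⟨j, h⟩) with hy
    have hF : (fun j => if h : j = i then
        A.rho hP ψ (fun k => A.Psi hP (Submodule.Quotient.mk (x (Sum.inr k))))
        else A.Psi hP (Submodule.Quotient.mk (x (Sum.inl ⟨j, h⟩))))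
        = fun j => A.Psi hP (Submodule.Quotient.mk (y j)) := by
      ext1 j
      by_cases h : j = i
      · simp only [hy, h, dif_pos, rho_Psi_mk]
      · simp only [hy, h, dif_neg, not_false_eq_true]
    refine (A.rho_Psi_mk hP (φ.circ i ψ) x).trans (Eq.trans ?_
      (congrArg (A.rho hP φ) (Eq.trans hF.symm ?_)))
    · rw [rho_Psi_mk]
      congr 2
      -- The factor at `i` unfolds into the product over `κ`; the others form a product over the
      -- subtype of indices different from `i`.
      rw [Fintype.prod_sum_type, ← Finset.mul_prod_erase _ _ (Finset.mem_univ i), mul_comm]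
      congr 1
      · simp only [hy, dif_pos, map_prod, Config.circ, Sum.elim_inr, push_comp,
          polyMap_comp_apply]
      · rw [Finset.prod_subtype (Finset.univ.erase i) (p := fun j => j ≠ i) (by simp)]
        refine Finset.prod_congr rfl fun j _ => ?_
        simp only [hy, dif_neg j.2, Config.circ, Sum.elim_inl]
    · ext1 j
      congr
  equivariant ι κ _ _ φ e F := by
    obtain ⟨x, rfl⟩ := A.exists_Psi_mk_eq hP F
    rw [rho_Psi_mk, A.rho_Psi_mk hP φ fun i => x (e.symm i)]
    congr 2
    exact Fintype.prod_equiv e _ _ fun k => by simp [Config.reindex]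

theorem pushClassical_proj (φ : ConfEmb) (x : PolyAlg A.carrier) :
    A.pushClassical φ (A.proj x) = A.proj (polyMap (A.push φ) x) := by
  rw [pushClassical, proj, classicalProj, ← polyMap_comp_apply, ← polyMap_comp_apply]
  rfl

theorem expPair_smul_classicalForm_proj {H : ℂ → ℂ → ℝ} (hH : IsHarmonicKernel H) (c : ℝ)
    (x : PolyAlg A.carrier) : expPair (c • A.classicalForm hH) (A.proj x)
      = A.proj (expPair (c • A.form H hH.locInt) x) := by
  rw [proj, classicalProj, expPair_polyMap]
  have h : (c • A.classicalForm hH).compl₁₂ (LinearMap.range A.lap).mkQ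
      (LinearMap.range A.lap).mkQ = c • A.form H hH.locInt := by
    ext f g
    exact congrArg (c * ·) (A.classicalForm_mk hH f g)
  rw [h]

end TestSpace

/-! ### The mean zero subalgebra. -/

/-- The inclusion of the mean zero test functions. -/
noncomputable def meanZeroToFull : meanZeroSpace.carrier →ₗ[ℝ] fullSpace.carrier :=
  Submodule.inclusion le_top

/-- Both quotients are by the same space `Δ C_c^∞(𝔻)`, which already consists of mean zero
functions. -/
theorem injective_meanZeroInclusion : Function.Injective meanZeroInclusion := by
  rw [← LinearMap.ker_eq_bot, Submodule.eq_bot_iff]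
  intro q hq
  obtain ⟨f, rfl⟩ := Submodule.Quotient.mk_surjective _ q
  change (Submodule.Quotient.mk (meanZeroToFull f) : fullSpace.Linear) = 0 at hq
  rw [Submodule.Quotient.mk_eq_zero] at hq
  obtain ⟨h, hh⟩ := hq
  rw [Submodule.Quotient.mk_eq_zero]
  exact ⟨h, Subtype.ext congr(($hh).1)⟩

/-- Integration descends to `S^cl`, because Laplacians have integral zero. It is onto the reals by a
bump function, and its kernel is the image of `S₀^cl`. -/
theorem finrank_quotient_range_meanZeroInclusion :
    Module.finrank ℝ (fullSpace.Linear ⧸ LinearMap.range meanZeroInclusion) = 1 := by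
  let I : fullSpace.Linear →ₗ[ℝ] ℝ := (LinearMap.range fullSpace.lap).liftQ
    (integralForm ∘ₗ fullSpace.carrier.subtype) (by
      rintro _ ⟨h, rfl⟩
      exact integral_lap h)
  have hI : LinearMap.range meanZeroInclusion = LinearMap.ker I := by
    ext q
    constructor
    · rintro ⟨p, rfl⟩
      obtain ⟨f, rfl⟩ := Submodule.Quotient.mk_surjective _ p
      exact f.2
    · intro hq
      obtain ⟨f, rfl⟩ := Submodule.Quotient.mk_surjective _ q
      exact ⟨Submodule.Quotient.mk ⟨f.1, hq⟩, rfl⟩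
  have hsurj : Function.Surjective I := by
    obtain ⟨f, -, hf, -⟩ := exists_testFun_integral_eq_one (z := 0) (by simp [disk])
      Filter.univ_mem
    intro c
    refine ⟨Submodule.Quotient.mk ⟨c • f, trivial⟩, ?_⟩
    change integralForm (c • f) = c
    rw [map_smul]
    change c * ∫ x, f x = c
    rw [hf, mul_one]
  rw [hI, (I.quotKerEquivOfSurjective hsurj).finrank_eq, Module.finrank_self]

theorem polyMap_meanZeroInclusion_Psi_mk {P : ℂ → ℂ → ℝ} (hP : IsGreenKernel P)
    (x : PolyAlg meanZeroSpace.carrier) :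
    polyMap meanZeroInclusion (meanZeroSpace.Psi hP (Submodule.Quotient.mk x))
      = fullSpace.Psi hP (Submodule.Quotient.mk (polyMap meanZeroToFull x)) := by
  rw [TestSpace.Psi_mk, TestSpace.Psi_mk, expPair_polyMap, TestSpace.proj, classicalProj,
    TestSpace.proj, classicalProj, ← polyMap_comp_apply, ← polyMap_comp_apply]
  rfl

theorem rho_polyMap_meanZeroInclusion {P : ℂ → ℂ → ℝ} (hP : IsGreenKernel P) {ι : Type}
    [Fintype ι] (φ : Config ι) (F : ι → meanZeroSpace.Classical) :
    fullSpace.rho hP φ (fun i => polyMap meanZeroInclusion (F i))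
      = polyMap meanZeroInclusion (meanZeroSpace.rho hP φ F) := by
  obtain ⟨x, rfl⟩ := meanZeroSpace.exists_Psi_mk_eq hP F
  simp only [TestSpace.rho_Psi_mk, polyMap_meanZeroInclusion_Psi_mk, map_prod,
    ← polyMap_comp_apply]
  rfl

/-! ### The formulas for `ρ^cl` on mean zero observables and the naturality criterion. -/

section MeanZero

theorem compl₁₂_form_green2_push (φ : ConfEmb) :
    (meanZeroSpace.form green2 locIntKernel_green2).compl₁₂ (meanZeroSpace.push φ)
      (meanZeroSpace.push φ)
      = meanZeroSpace.form _ (isGreenKernel_green2_sub_cocycle φ).locInt := by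
  ext f g
  exact kernelForm_green2_push φ f.1 g.1 f.2 g.2

theorem form_green2_sub_cocycle (A : TestSpace) (φ : ConfEmb) :
    A.form _ (isGreenKernel_green2_sub_cocycle φ).locInt
      = -(2 * Real.pi)⁻¹ • A.form (cocycle φ) (isHarmonicKernel_cocycle φ).locInt
        + A.form green2 locIntKernel_green2 := by
  ext f g
  refine (kernelForm_sub_mul locIntKernel_green2 (locIntKernel_cocycle φ) _ f.1 g.1).trans ?_
  simp only [LinearMap.add_apply, LinearMap.smul_apply, smul_eq_mul, neg_mul,
    sub_eq_neg_add]
  rfl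

/-- Conformal covariance of `Ψ` on mean zero functions. -/
theorem Psi_quantumMap_single (φ : ConfEmb) (x : meanZeroSpace.Quantum) :
    meanZeroSpace.Psi isGreenKernel_green2
        (meanZeroSpace.quantumMap (Config.single φ) (fun _ => x))
      = meanZeroSpace.pushClassical φ
          (meanZeroSpace.Psi (isGreenKernel_green2_sub_cocycle φ) x) := by
  obtain ⟨x, rfl⟩ := Submodule.Quotient.mk_surjective _ x
  rw [TestSpace.quantumMap_mk, TestSpace.Psi_mk, TestSpace.Psi_mk, TestSpace.pushClassical_proj,
    ← compl₁₂_form_green2_push, ← expPair_polyMap]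
  simp [Config.single]

/-- Change of the Green kernel. -/
theorem Psi_green2_sub_cocycle (A : TestSpace) (φ : ConfEmb) (x : A.Quantum) :
    A.Psi (isGreenKernel_green2_sub_cocycle φ) x
      = expPair (-(2 * Real.pi)⁻¹ • A.classicalForm (isHarmonicKernel_cocycle φ))
          (A.Psi isGreenKernel_green2 x) := by
  obtain ⟨x, rfl⟩ := Submodule.Quotient.mk_surjective _ x
  rw [TestSpace.Psi_mk, TestSpace.Psi_mk, TestSpace.expPair_smul_classicalForm_proj,
    form_green2_sub_cocycle, expPair_add]

theorem rho_single (φ : ConfEmb) (F : meanZeroSpace.Classical) :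
    meanZeroSpace.rho isGreenKernel_green2 (Config.single φ) (fun _ => F)
      = meanZeroSpace.pushClassical φ (expPair
          (-(2 * Real.pi)⁻¹ • meanZeroSpace.classicalForm (isHarmonicKernel_cocycle φ)) F) := by
  have h := Psi_quantumMap_single φ ((meanZeroSpace.Psi isGreenKernel_green2).symm F)
  rw [Psi_green2_sub_cocycle, LinearEquiv.apply_symm_apply] at h
  exact h

/-- The hypothesis on `R` says that `R i` represents `Ψ` of the corrected Green kernel applied to
the quantum observable behind `F i`. Undoing this `Ψ` on representatives supplies the inner factors
`exp(-∂)` of the contraction map. -/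
theorem rho_eq_proj_contractionMap {n : ℕ} (φ : Config (Fin n))
    (F : Fin n → meanZeroSpace.Classical) (R : Fin n → PolyAlg meanZeroSpace.carrier)
    (hR : ∀ i, meanZeroSpace.proj (R i) = expPair (-(2 * Real.pi)⁻¹ •
      meanZeroSpace.classicalForm (isHarmonicKernel_cocycle (φ.emb i))) (F i)) :
    meanZeroSpace.rho isGreenKernel_green2 φ F
      = meanZeroSpace.proj (contractionMap (meanZeroSpace.form green2 locIntKernel_green2) n
          (fun i => polyMap (meanZeroSpace.push (φ.emb i)) (R i))) := by
  set B := meanZeroSpace.form green2 locIntKernel_green2 with hB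
  have hF : F = fun i => meanZeroSpace.Psi isGreenKernel_green2 (Submodule.Quotient.mk
      (expPair (-(B.compl₁₂ (meanZeroSpace.push (φ.emb i)) (meanZeroSpace.push (φ.emb i))))
        (R i))) := by
    ext1 i
    obtain ⟨q, hq⟩ := (meanZeroSpace.Psi isGreenKernel_green2).surjective (F i)
    rw [← hq]
    congr 1
    -- Equality is tested after `Ψ` for the kernel `G₂ - (2π)⁻¹ H_φ`, whose form on mean zero
    -- functions is the pull-back of `G₂`; there the two exponentials cancel.
    apply (meanZeroSpace.Psi (isGreenKernel_green2_sub_cocycle (φ.emb i))).injective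
    rw [Psi_green2_sub_cocycle, hq, ← hR, TestSpace.Psi_mk, hB, compl₁₂_form_green2_push,
      expPair_expPair_neg]
  rw [hF, TestSpace.rho_Psi_mk, TestSpace.Psi_mk, contractionMap_apply]
  congr 3
  ext1 i
  rw [expPair_polyMap]
  rfl

theorem naturality_iff_cocycle_eq_zero (φ : ConfEmb) :
    (∀ x : meanZeroSpace.Quantum,
      meanZeroSpace.Psi isGreenKernel_green2
          (meanZeroSpace.quantumMap (Config.single φ) (fun _ => x))
        = meanZeroSpace.pushClassical φ (meanZeroSpace.Psi isGreenKernel_green2 x)) ↔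
    ∀ z ∈ disk, ∀ w ∈ disk, z ≠ w → cocycle φ z w = 0 := by
  simp only [Psi_quantumMap_single, Psi_green2_sub_cocycle]
  constructor
  · intro h z hz w hw hzw
    refine cocycle_eq_zero_of_kernelForm_eq_zero φ (fun f g hf hg => ?_) hz hw hzw
    set f' : meanZeroSpace.carrier := ⟨f, hf⟩
    set g' : meanZeroSpace.carrier := ⟨g, hg⟩
    set c := -(2 * Real.pi)⁻¹ with hc
    -- A quadratic monomial is the smallest test: the exponential changes it only by a scalar. As
    -- `W_φ^cl` is an algebra map and fixes `1`, that scalar is visible without knowing `W_φ^cl` to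
    -- be injective.
    have h1 := h ((meanZeroSpace.Psi isGreenKernel_green2).symm
      (meanZeroSpace.proj (gen f' * gen g')))
    rw [LinearEquiv.apply_symm_apply, TestSpace.expPair_smul_classicalForm_proj] at h1
    have hsymm : ∀ v w, (c • meanZeroSpace.form (cocycle φ) (isHarmonicKernel_cocycle φ).locInt) v w
        = (c • meanZeroSpace.form (cocycle φ) (isHarmonicKernel_cocycle φ).locInt) w v := by
      intro v w
      exact congrArg (c * ·) (meanZeroSpace.form_symm (isHarmonicKernel_cocycle φ).symm _ v w)
    have h2 : expPair (c • meanZeroSpace.form (cocycle φ) (isHarmonicKernel_cocycle φ).locInt)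
        (gen f' * gen g') = gen f' * gen g'
          + (c * kernelForm (cocycle φ) (locIntKernel_cocycle φ) f g) • 1 := by
      have h3 := expPair_gen_mul
        (c • meanZeroSpace.form (cocycle φ) (isHarmonicKernel_cocycle φ).locInt) g' 1
      rw [expPair_one, contract_one, add_zero, mul_one] at h3
      rw [expPair_gen_mul, h3, contract_gen, symForm_eq hsymm]
      rfl
    rw [h2, map_add, map_add, add_eq_left, map_smul, map_smul, map_one, map_one] at h1
    rw [smul_eq_zero_iff_left one_ne_zero] at h1
    have hpi := Real.pi_pos
    exact (mul_eq_zero.1 h1).resolve_left (by rw [hc]; simp [hpi.ne'])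
  · intro h x
    have h0 : meanZeroSpace.form (cocycle φ) (isHarmonicKernel_cocycle φ).locInt = 0 := by
      ext f g
      refine (kernelForm_apply (locIntKernel_cocycle φ) f.1 g.1).trans ?_
      refine (MeasureTheory.integral_congr_ae ?_).trans (MeasureTheory.integral_zero _ _)
      filter_upwards [ae_restrict_disk2_eq (Q := fun _ _ => 0) h] with p hp
      rw [hp, zero_mul]
    obtain ⟨x, rfl⟩ := Submodule.Quotient.mk_surjective _ x
    rw [TestSpace.Psi_mk, TestSpace.expPair_smul_classicalForm_proj, h0, smul_zero, expPair_zero]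

end MeanZero

end FreeField

open FreeField
-- Products of generators span `P(A)`, so `IsContractionMap` determines the multilinear map `C`
-- uniquely. The existential in (3) thus speaks of the sum of contractions itself, and `C` is fixed
-- by `n` before `φ` is chosen.
theorem mainTheorem5 :
    -- `G₂` is a Green kernel, so that `Ψ_{G₂}` and the structure maps `ρ^cl` exist
    ∃ hG : IsGreenKernel green2,
      -- `S₀^cl(𝔻)` is a subspace of codimension one of `S^cl(𝔻)`, and `P(S₀^cl(𝔻))` is a
      -- subalgebra of the `ℂ𝔼₂^emb`-algebra `P(S^cl(𝔻))`
      Function.Injective meanZeroInclusion ∧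
      Module.finrank ℝ (fullSpace.Linear ⧸ LinearMap.range meanZeroInclusion) = 1 ∧
      Function.Injective (polyMap meanZeroInclusion) ∧
      IsOperadAlgebra (fun (ι : Type) (_ : Fintype ι) (φ : Config ι) => fullSpace.rho hG φ) ∧
      IsOperadAlgebra (fun (ι : Type) (_ : Fintype ι) (φ : Config ι) => meanZeroSpace.rho hG φ) ∧
      (∀ (ι : Type) [Fintype ι] (φ : Config ι) (F : ι → meanZeroSpace.Classical),
        fullSpace.rho hG φ (fun i => polyMap meanZeroInclusion (F i))
          = polyMap meanZeroInclusion (meanZeroSpace.rho hG φ F)) ∧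
      -- `H_φ` is a harmonic cocycle
      (∀ φ ψ : ConfEmb, ∀ z ∈ disk, ∀ w ∈ disk, z ≠ w →
        cocycle (φ.comp ψ) z w = cocycle ψ z w + cocycle φ (ψ.toFun z) (ψ.toFun w)) ∧
      ∃ hH : ∀ φ : ConfEmb, IsHarmonicKernel (cocycle φ),
      -- `G₂ - (2π)⁻¹ H_φ` is a Green kernel, and `Ψ_{G₂} ∘ F_CL(φ) = W_φ^cl ∘ Ψ_{G₂ - (2π)⁻¹ H_φ}`
      (∀ φ : ConfEmb,
        ∃ hGH : IsGreenKernel (fun x y => green2 x y - (2 * Real.pi)⁻¹ * cocycle φ x y),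
          ∀ x : meanZeroSpace.Quantum,
            meanZeroSpace.Psi hG (meanZeroSpace.quantumMap (Config.single φ) (fun _ => x))
              = meanZeroSpace.pushClassical φ (meanZeroSpace.Psi hGH x)) ∧
      -- the unary operations
      (∀ (φ : ConfEmb) (F : meanZeroSpace.Classical),
        meanZeroSpace.rho hG (Config.single φ) (fun _ => F)
          = meanZeroSpace.pushClassical φ
              (expPair (-(2 * Real.pi)⁻¹ • meanZeroSpace.classicalForm (hH φ)) F)) ∧
      -- the `n`-ary operations
      (∀ n : ℕ, ∃ C : MultilinearMap ℝ (fun _ : Fin n => PolyAlg meanZeroSpace.carrier)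
          (PolyAlg meanZeroSpace.carrier),
        IsContractionMap (meanZeroSpace.form green2 hG.locInt) C ∧
        ∀ (φ : Config (Fin n)) (F : Fin n → meanZeroSpace.Classical)
          (R : Fin n → PolyAlg meanZeroSpace.carrier),
          (∀ i, meanZeroSpace.proj (R i)
            = expPair (-(2 * Real.pi)⁻¹ • meanZeroSpace.classicalForm (hH (φ.emb i))) (F i)) →
          meanZeroSpace.rho hG φ F
            = meanZeroSpace.proj
                (C (fun i => polyMap (meanZeroSpace.push (φ.emb i)) (R i)))) ∧
      -- the naturality square of `Ψ_{G₂}` for `φ` commutes exactly when `H_φ` vanishes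
      (∀ φ : ConfEmb,
        (∀ x : meanZeroSpace.Quantum,
          meanZeroSpace.Psi hG (meanZeroSpace.quantumMap (Config.single φ) (fun _ => x))
            = meanZeroSpace.pushClassical φ (meanZeroSpace.Psi hG x)) ↔
        ∀ z ∈ disk, ∀ w ∈ disk, z ≠ w → cocycle φ z w = 0) := by
  exact ⟨isGreenKernel_green2, injective_meanZeroInclusion,
    finrank_quotient_range_meanZeroInclusion, polyMap_injective injective_meanZeroInclusion,
    fullSpace.isOperadAlgebra_rho _, meanZeroSpace.isOperadAlgebra_rho _,
    fun ι _ φ F => rho_polyMap_meanZeroInclusion _ φ F,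
    fun φ ψ z hz w hw _ => cocycle_comp φ ψ hz hw, isHarmonicKernel_cocycle,
    fun φ => ⟨isGreenKernel_green2_sub_cocycle φ, Psi_quantumMap_single φ⟩,
    rho_single,
    fun n => ⟨contractionMap _ n, isContractionMap_contractionMap
      (meanZeroSpace.form_symm isGreenKernel_green2.symm _),
      fun φ F R hR => rho_eq_proj_contractionMap φ F R hR⟩,
    naturality_iff_cocycle_eq_zero⟩
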